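/- Let $\mathcal H$ be a complex Hilbert space, $T>0$, and let $(H(s))_{s\in[0,T)}$ be self-adjoint operators on $\mathcal H$ with a common domain $D$. Let $n\ge 1$ and assume: **H1.** $H(s)\ge 1$ for all $s\in[0,T)$. **H2.** For each $\phi\in D$ the map $s\mapsto H(s)\phi$ is in $C^n([0,T),\mathcal H)$ (with one-sided derivatives at $0$), and for $1\le l\le n$ the operators $H^{(l)}(s)$, defined on $D$ by $H^{(l)}(s)\phi=\frac{d^l}{ds^l}(H(s)\phi)$, satisfy $\sup_{s\in[0,T)}\|H^{(l)}(s)H(s)^{-1}\|\le\alpha_l<\infty$. **H3.** There are $M\in\mathbb R$ and continuous $a_\pm:[0,T]\to\mathbb R$ with $0\le a_-\le a_+\le M$ such that, with $I(s)=[a_-(s),a_+(s)]$, for all $s\in[0,T)$ $$g(s):=\min\bigl(1,\operatorname{dist}(I(s),\sigma(H(s))\setminus(\sigma(H(s))\cap I(s)))\bigr)>0$$ (the distance to the empty set being $+\infty$), and the spectral projector $P(s):=\mathbf 1_{I(s)}(H(s))$ has a finite rank $N\ge 1$ that does not depend on $s$. Call a bounded operator $A$ off-diagonal at $s$ if $P(s)AP(s)=(1-P(s))A(1-P(s))=0$,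 and diagonal if $P(s)A(1-P(s))+(1-P(s))AP(s)=0$. Then for every $s\in[0,T)$ the Liouvillian $L(s)=[H(s),\cdot\,]$ has a partial inverse $L^+(s)\in\mathcal L(\mathcal L(\mathcal H))$, that is, a bounded linear map on $\mathcal L(\mathcal H)$ that inverts $L(s)$ on the off-diagonal operators, has off-diagonal values, and vanishes on diagonal operators. Moreover: 1. $P\in C^n([0,T),\mathcal L(\mathcal H))$ in operator norm. For every $A\in\mathcal L(\mathcal H)$ the map $s\mapsto L^+(s)A$ is in $C^n([0,T),\mathcal L(\mathcal H))$ in operator norm. In the norm of $\mathcal L(\mathcal L(\mathcal H))$, $L^+$ is of class $C^{n-1}$, and it is of class $C^n$ if the operators $H(s)$ have compact resolvent. 2. For all $s\in[0,T)$ the commutator $[P(s),\dot H(s)]$, defined on $D$, extends to a bounded operator, and $\dot P(s)=L^+(s)[P(s),\dot H(s)]$. 3. There are constants $C_0,\dots,C_n\ge 0$ depending only on $n$, $\alpha_1,\dots,\alpha_n$ and $M$ such that, for all $0\le l\le n$, $s\in[0,T)$ and $A\in\mathcal L(\mathcal H)$, $$\|H(s)P(s)\|\le M,\qquad \|H(s)P^{(l)}(s)\|\le\frac{C_l}{g(s)^{l+1}},\qquad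 \|H(s)(L^+)^{(l)}(s)A\|\le\frac{C_l}{g(s)^{l+3}}\|A\|,$$ where $(L^+)^{(l)}(s)A=\frac{d^l}{ds^l}(L^+(s)A)$ (in particular these operators map $\mathcal H$ into $D$). 4. For all $0\le l\le n$, $s\in[0,T)$ and $A\in\mathcal L(\mathcal H)$, the rank of $P^{(l)}(s)$ is at most $(l+1)N$ and the rank of $(L^+)^{(l)}(s)A$ is at most $c_lN$, where $c_l$ depends only on $l$, and one can take $c_0=2$, $c_1=10$. -/

import Mathlib

open Set

namespace UnboundedOp

variable {E : Type*} [NormedAddCommGroup E] [InnerProductSpace ℂ E]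

/-- `R` is the bounded inverse `(z - h)⁻¹`: for every `φ`, the vector `R φ` is the one and only
element `ψ` of the domain of `h` with `z ψ - h ψ = φ`. -/
def IsResolvent (h : E →ₗ.[ℂ] E) (z : ℂ) (R : E →L[ℂ] E) : Prop :=
  ∀ φ ψ : E, R φ = ψ ↔ ∃ hψ : ψ ∈ h.domain, z • ψ - h ⟨ψ, hψ⟩ = φ

/-- The resolvent `(z - h)⁻¹` (zero if `z` is not in the resolvent set). -/
noncomputable def resolvent (h : E →ₗ.[ℂ] E) (z : ℂ) : E →L[ℂ] E :=
  open Classical in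
  if hz : ∃ R : E →L[ℂ] E, IsResolvent h z R then hz.choose else 0

/-- The real points of the spectrum of `h` (all of the spectrum, if `h` is self-adjoint). -/
def realSpectrum (h : E →ₗ.[ℂ] E) : Set ℝ :=
  {x : ℝ | ¬ ∃ R : E →L[ℂ] E, IsResolvent h (x : ℂ) R}

/-- `h` has compact resolvent. -/
def HasCompactResolvent (h : E →ₗ.[ℂ] E) : Prop :=
  ∃ (z : ℂ) (R : E →L[ℂ] E), IsResolvent h z R ∧ IsCompactOperator R

/-- `min (1, dist (I, σ(h) \ (σ(h) ∩ I)))`. The distance to the empty set is infinite, and then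
the minimum is `1`. -/
noncomputable def gap (h : E →ₗ.[ℂ] E) (I : Set ℝ) : ℝ :=
  (min 1 (⨅ x ∈ I, Metric.infEDist x (realSpectrum h \ (realSpectrum h ∩ I)))).toReal

/-- The spectral projector `1_I(h)` of a self-adjoint operator `h`. For a function `f`, the operator
`f(h)` is `F(R)`, where `R = (i - h)⁻¹` is a bounded normal operator and `F(w) = f(i - w⁻¹)`,
so that `F((i - x)⁻¹) = f(x)`. For `f = 1_I`, with `I` bounded and `gap h I > 0`, the function `F`
is continuous on the spectrum of `R` (and vanishes at `w = 0`), so that the continuous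
functional calculus of `R` applies. -/
noncomputable def spectralProjector [CompleteSpace E] (h : E →ₗ.[ℂ] E) (I : Set ℝ) : E →L[ℂ] E :=
  cfc (fun w : ℂ => ((↑) '' I : Set ℂ).indicator (fun _ => (1 : ℂ)) (Complex.I - w⁻¹))
    (resolvent h Complex.I)

/-- `A` is in the domain of the Liouvillian `L_h = [h, ·]` and `L_h A = B`: the bounded
operator `A` maps the domain of `h` to itself and the commutator `h A - A h`, defined on the domain
of `h`, is the restriction of the bounded operator `B`. -/
def IsLiouvillian (h : E →ₗ.[ℂ] E) (A B : E →L[ℂ] E) : Prop :=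
  ∀ φ : h.domain, ∃ hφ : A φ ∈ h.domain, h ⟨A φ, hφ⟩ - A (h φ) = B φ

/-- The operator `A` is off-diagonal with respect to `P`. -/
def IsOffDiagonal (P A : E →L[ℂ] E) : Prop :=
  P * A * P = 0 ∧ (1 - P) * A * (1 - P) = 0

/-- The off-diagonal part of `A` with respect to `P`. -/
noncomputable def offDiagonalPart (P A : E →L[ℂ] E) : E →L[ℂ] E :=
  P * A * (1 - P) + (1 - P) * A * P

/-- The bounded superoperator `K` is the partial inverse of the Liouvillian `L_h`, with respect to
`P = 1_I(h)`: it inverts `L_h` on off-diagonal operators and it vanishes on diagonal ones, that is,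
`K A` is off-diagonal and `L_h (K A)` is the off-diagonal part of `A`. -/
def IsPartialInverseLiouvillian [CompleteSpace E] (h : E →ₗ.[ℂ] E) (I : Set ℝ)
    (K : (E →L[ℂ] E) →L[ℂ] (E →L[ℂ] E)) : Prop :=
  (∀ A, IsOffDiagonal (spectralProjector h I) (K A)) ∧
  (∀ A, IsLiouvillian h (K A) (offDiagonalPart (spectralProjector h I) A)) ∧
  (∀ A, IsOffDiagonal (spectralProjector h I) A → ∀ B, IsLiouvillian h A B → K B = A) ∧
  (∀ A, offDiagonalPart (spectralProjector h I) A = 0 → K A = 0)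

/-- The partial inverse `L⁺_{h,I}` of the Liouvillian (zero if there is none). -/
noncomputable def partialInverseLiouvillian [CompleteSpace E] (h : E →ₗ.[ℂ] E) (I : Set ℝ) :
    (E →L[ℂ] E) →L[ℂ] (E →L[ℂ] E) :=
  open Classical in
  if hK : ∃ K, IsPartialInverseLiouvillian h I K then hK.choose else 0

/-- The product `h B` is an everywhere defined bounded operator with `‖h B‖ ≤ c`. -/
def CompNormLE (h : E →ₗ.[ℂ] E) (B : E →L[ℂ] E) (c : ℝ) : Prop :=
  0 ≤ c ∧ ∀ φ : E, ∃ hφ : B φ ∈ h.domain, ‖h ⟨B φ, hφ⟩‖ ≤ c * ‖φ‖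

end UnboundedOp

/-! No contour integrals are used: everything rests on a Sylvester equation and its a priori bound.
Put `R = H⁻¹`, `Q = 1 - P` and `m = H P`, which is bounded. For bounded `B` let `Z B` be the
operator `X = Q X P` with `H X - X H = Q B P`. As `X H` is `X m`, in bounded operators this reads `X
= R (Q B P + X m)`. If the interval has centre `c` and half-length `ρ`, then `H - c` is bounded
below by `ρ + g` on the range of `Q`, while `m - c P` has norm at most `ρ`. Hence `g ‖X‖ ≤ ‖B‖`
(`sylvester_apriori`), and a Neumann series gives existence (`exists_sylvester`). The other
off-diagonal block is obtained by taking adjoints, so `L⁺ A = Z A - (Z A*)*`.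

Derivatives come from the same bound with the left factor at time `t` and the right factor at time
`s`. For instance `Q(t) P(s)` solves such an equation with residual `Q(t) (H(t) H(s)⁻¹ - 1) m(s)`.
Dividing by `t - s` and letting `t → s` gives `P' = -(Z (H' H⁻¹ m) + adjoint)`, and similarly for
`m` and `Z`. Two facts make this work. The gap stays open near `s` because the rank of `P` is
constant (`lower_bound_stable`, a min-max argument). And `H(t) H(s)⁻¹`, only strongly
differentiable, always acts on operators that factor through `P`, hence compact, where strong
convergence is norm convergence.

The derivatives of `P`, `m` and `Z` are polynomials in `P`, `m`, `Z` and products of `H' H⁻¹` with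
compact families, so an induction (`RegBound.succ`) gives `n` derivatives, each costing one power of
`1 / g`. To multiply by `H`, write `P = R m` and `L⁺ A = R (H L⁺ A)` and use `(R X)' = R (X' - H'
H⁻¹ X)`: every derivative keeps a factor `R` on the left.

As a superoperator, `Z` has a derivative in which `H' H⁻¹` enters only as `H' H⁻¹ m` and `R H' H⁻¹`.
The latter is of class `C^{n-2}` in norm in general (if `n ≥ 2`), and `C^{n-1}` when `R` is compact;
`Z` has one derivative more (`contDiffOn_Z`).

The rank bounds hold because an `l`-th derivative is a limit of combinations of `l + 1` values, and
bounded rank is a closed condition. -/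

open Filter Topology

/-! ### Passing from strong to norm convergence and differentiability. -/

section StrongConvergence

variable {X Y : Type*} [NormedAddCommGroup X] [NormedSpace ℂ X] [NormedAddCommGroup Y]
  [NormedSpace ℂ Y]

/-- Split `F i (v i)` as `F i (v i - v₀) + F i v₀`. Convergence of `F` is needed at the single
vector `v₀` only, so that `F` need not converge in norm. -/
theorem tendsto_clm_apply_of_pointwise {ι : Type*} {l : Filter ι} {F : ι → X →L[ℂ] Y}
    {v : ι → X} {v₀ : X} {y : Y} (hb : ∃ C, ∀ᶠ i in l, ‖F i‖ ≤ C)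
    (hF : Tendsto (fun i => F i v₀) l (𝓝 y)) (hv : Tendsto v l (𝓝 v₀)) :
    Tendsto (fun i => F i (v i)) l (𝓝 y) := by
  obtain ⟨C, hC⟩ := hb
  have h1 : Tendsto (fun i => F i (v i - v₀)) l (𝓝 0) := by
    have h2 : Tendsto (fun i => C * ‖v i - v₀‖) l (𝓝 0) := by
      simpa using ((hv.sub_const v₀).norm.const_mul C)
    refine squeeze_zero_norm' ?_ h2
    filter_upwards [hC] with i hi
    exact (F i).le_of_opNorm_le hi _
  simpa using h1.add hF

/-- Leibniz rule for a strongly differentiable family of operators. -/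
theorem HasDerivWithinAt.clm_apply_of_strong {F : ℝ → X →L[ℂ] Y} {v : ℝ → X} {v' : X} {d : Y}
    {S : Set ℝ} {s : ℝ} (hF : HasDerivWithinAt (fun t => F t (v s)) d S s)
    (hb : ∃ C, ∀ᶠ t in 𝓝[S] s, ‖F t‖ ≤ C)
    (hc : Tendsto (fun t => F t v') (𝓝[S] s) (𝓝 (F s v')))
    (hv : HasDerivWithinAt v v' S s) :
    HasDerivWithinAt (fun t => F t (v t)) (d + F s v') S s := by
  rw [hasDerivWithinAt_iff_tendsto_slope] at hF hv ⊢
  have hle : 𝓝[S \ {s}] s ≤ 𝓝[S] s := nhdsWithin_mono _ sdiff_subset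
  have h2 : Tendsto (fun t => F t (slope v s t)) (𝓝[S \ {s}] s) (𝓝 (F s v')) :=
    tendsto_clm_apply_of_pointwise (hb.imp fun C h => hle h) (hc.mono_left hle) hv
  refine (hF.add h2).congr fun t => ?_
  have hr : ∀ (r : ℝ) (x : X), F t (r • x) = r • F t x := fun r x =>
    ((F t).restrictScalars ℝ).map_smul r x
  simp only [slope, vsub_eq_sub, hr, map_sub]
  rw [← smul_add]
  congr 1
  abel

/-- A strongly convergent bounded family of operators converges in norm on a compact operator. -/
theorem tendsto_comp_of_isCompactOperator {ι : Type*} {l : Filter ι} {W : Type*}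
    [NormedAddCommGroup W] [NormedSpace ℂ W] {F : ι → X →L[ℂ] Y} {F₀ : X →L[ℂ] Y} {K : W →L[ℂ] X}
    (hK : IsCompactOperator K) (hb : ∃ C, ∀ᶠ i in l, ‖F i‖ ≤ C)
    (hF : ∀ x, Tendsto (fun i => F i x) l (𝓝 (F₀ x))) :
    Tendsto (fun i => (F i).comp K) l (𝓝 (F₀.comp K)) := by
  obtain ⟨C, hC⟩ := hb
  -- `D` bounds `‖F i - F₀‖`. The image of the unit ball under `K` has a finite net of mesh `ε / (4
  -- D)`, and strong convergence is uniform on a finite set.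
  set D := |C| + ‖F₀‖ + 1 with hD
  have hDpos : 0 < D := by positivity
  rw [Metric.tendsto_nhds]
  intro ε hε
  have hcomp := hK.isCompact_closure_image_closedBall (𝕜₁ := ℂ) (1 : ℝ)
  have htb := (hcomp.totallyBounded).subset subset_closure
  obtain ⟨t, htf, ht⟩ := Metric.totallyBounded_iff.1 htb (ε / (4 * D)) (by positivity)
  have hev : ∀ᶠ i in l, ∀ x ∈ t, dist (F i x) (F₀ x) < ε / 4 := by
    rw [eventually_all_finite htf]
    exact fun x _ => (Metric.tendsto_nhds.1 (hF x)) _ (by positivity)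
  filter_upwards [hev, hC] with i hi hCi
  have hbound : ‖(F i).comp K - F₀.comp K‖ ≤ ε / 2 := by
    refine ContinuousLinearMap.opNorm_le_of_unit_norm (𝕜 := ℂ) (by positivity) fun x hx => ?_
    have hmem : K x ∈ K '' Metric.closedBall 0 1 := ⟨x, by simp [hx], rfl⟩
    obtain ⟨y, hy, hxy⟩ := by simpa using ht hmem
    rw [dist_eq_norm] at hxy
    have h1 : ((F i).comp K - F₀.comp K) x
        = (F i - F₀) (K x - y) + (F i y - F₀ y) := by
      simp only [sub_apply, ContinuousLinearMap.comp_apply, map_sub]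
      abel
    rw [h1]
    have h2 : ‖(F i - F₀) (K x - y)‖ ≤ D * (ε / (4 * D)) := by
      refine ((F i - F₀).le_opNorm _).trans ?_
      have h3 : ‖F i - F₀‖ ≤ D := by
        have := norm_sub_le (F i) F₀
        have := le_abs_self C
        linarith
      gcongr
    have h4 : D * (ε / (4 * D)) = ε / 4 := by field_simp
    have h5 := hi y hy
    rw [dist_eq_norm] at h5
    have := norm_add_le ((F i - F₀) (K x - y)) (F i y - F₀ y)
    linarith
  rw [dist_eq_norm]
  linarith

theorem norm_sub_le_of_pointwise_hasDerivWithinAt {F F' : ℝ → X →L[ℂ] Y} {S : Set ℝ} {C : ℝ}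
    (hS : Convex ℝ S)
    (hF : ∀ u ∈ S, ∀ x, HasDerivWithinAt (fun t => F t x) (F' u x) S u)
    (hC : ∀ u ∈ S, ‖F' u‖ ≤ C) {s t : ℝ} (hs : s ∈ S) (ht : t ∈ S) :
    ‖F t - F s‖ ≤ C * |t - s| := by
  have hC0 : 0 ≤ C := (norm_nonneg _).trans (hC s hs)
  refine ContinuousLinearMap.opNorm_le_bound _ (by positivity) fun x => ?_
  have h := hS.norm_image_sub_le_of_norm_hasDerivWithin_le (f := fun u => F u x)
    (f' := fun u => F' u x) (C := C * ‖x‖) (fun u hu => hF u hu x)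
    (fun u hu => (F' u).le_of_opNorm_le (hC u hu) x) hs ht
  calc ‖(F t - F s) x‖ = ‖F t x - F s x‖ := by simp
    _ ≤ C * ‖x‖ * ‖t - s‖ := h
    _ = C * |t - s| * ‖x‖ := by rw [Real.norm_eq_abs]; ring

/-- The mean value inequality, vector by vector, makes `F` Lipschitz in norm near `s`. -/
theorem continuousWithinAt_of_pointwise_hasDerivWithinAt {F F' : ℝ → X →L[ℂ] Y} {S : Set ℝ}
    (hS : Convex ℝ S)
    (hF : ∀ u ∈ S, ∀ x, HasDerivWithinAt (fun t => F t x) (F' u x) S u) {s : ℝ} (hs : s ∈ S)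
    (hC : ∃ C, ∀ᶠ u in 𝓝[S] s, ‖F' u‖ ≤ C) : ContinuousWithinAt F S s := by
  obtain ⟨C, hC⟩ := hC
  obtain ⟨δ, hδ, hb⟩ := Metric.mem_nhdsWithin_iff.1 hC
  have hconv : Convex ℝ (S ∩ Metric.ball s δ) := hS.inter (convex_ball s δ)
  have hs' : s ∈ S ∩ Metric.ball s δ := ⟨hs, Metric.mem_ball_self hδ⟩
  have hlip : ∀ t ∈ S ∩ Metric.ball s δ, ‖F t - F s‖ ≤ C * |t - s| := fun t ht =>
    norm_sub_le_of_pointwise_hasDerivWithinAt hconv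
      (fun u hu x => (hF u hu.1 x).mono inter_subset_left) (fun u hu => hb ⟨hu.2, hu.1⟩) hs' ht
  rw [ContinuousWithinAt, tendsto_iff_norm_sub_tendsto_zero]
  have h0 : Tendsto (fun t => C * |t - s|) (𝓝[S] s) (𝓝 0) := by
    have : Tendsto (fun t => C * |t - s|) (𝓝 s) (𝓝 (C * |s - s|)) := by
      apply Continuous.tendsto; fun_prop
    simpa using this.mono_left nhdsWithin_le_nhds
  refine squeeze_zero' (Eventually.of_forall fun t => norm_nonneg _) ?_ h0
  filter_upwards [self_mem_nhdsWithin, nhdsWithin_le_nhds (Metric.ball_mem_nhds s hδ)] with t h1 h2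
  exact hlip t ⟨h1, h2⟩

/-- Apply the mean value inequality to `u ↦ F u x - (u - s) • F' s x`, whose derivative is small
uniformly for `x` in the unit ball. Norm continuity of `F'` at `s` is what supplies this uniformity.
-/
theorem hasDerivWithinAt_of_pointwise {F F' : ℝ → X →L[ℂ] Y} {S : Set ℝ} (hS : Convex ℝ S)
    (hF : ∀ u ∈ S, ∀ x, HasDerivWithinAt (fun t => F t x) (F' u x) S u) {s : ℝ} (hs : s ∈ S)
    (hc : ContinuousWithinAt F' S s) : HasDerivWithinAt F (F' s) S s := by
  rw [hasDerivWithinAt_iff_isLittleO, Asymptotics.isLittleO_iff]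
  intro ε hε
  have hev : ∀ᶠ u in 𝓝[S] s, ‖F' u - F' s‖ ≤ ε := by
    filter_upwards [(Metric.tendsto_nhds.1 hc) ε hε] with u hu
    rw [dist_eq_norm] at hu
    exact hu.le
  obtain ⟨δ, hδ, hb⟩ := Metric.mem_nhdsWithin_iff.1 hev
  have hconv : Convex ℝ (S ∩ Metric.ball s δ) := hS.inter (convex_ball s δ)
  have hs' : s ∈ S ∩ Metric.ball s δ := ⟨hs, Metric.mem_ball_self hδ⟩
  filter_upwards [self_mem_nhdsWithin, nhdsWithin_le_nhds (Metric.ball_mem_nhds s hδ)] with t h1 h2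
  refine ContinuousLinearMap.opNorm_le_bound _ (by positivity) fun x => ?_
  have h := hconv.norm_image_sub_le_of_norm_hasDerivWithin_le
    (f := fun u => F u x - (u - s) • F' s x)
    (f' := fun u => F' u x - (1 : ℝ) • F' s x) (C := ε * ‖x‖)
    (fun u hu => ((hF u hu.1 x).mono inter_subset_left).sub
      ((((hasDerivWithinAt_id u _).sub_const s)).smul_const (F' s x)))
    (fun u hu => by
      have := (F' u - F' s).le_of_opNorm_le (hb ⟨hu.2, hu.1⟩) x
      simpa using this) hs' ⟨h1, h2⟩
  calc ‖(F t - F s - (t - s) • F' s) x‖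
      = ‖F t x - (t - s) • F' s x - (F s x - (s - s) • F' s x)‖ := by
        simp only [sub_apply, smul_apply, sub_self,
          zero_smul, sub_zero]
        congr 1; abel
    _ ≤ ε * ‖x‖ * ‖t - s‖ := h
    _ = ε * ‖t - s‖ * ‖x‖ := by ring

end StrongConvergence

/-! ### Forward differences and the rank of derivatives. -/

section FiniteDifferences

open Finset in
theorem sum_alternating_choose_mul_pow {l j : ℕ} (hj : j ≤ l) :
    ∑ k ∈ Finset.range (l + 1), (((-1 : ℝ) ^ (l - k) * l.choose k) * (k : ℝ) ^ j)
      = if j = l then (l.factorial : ℝ) else 0 := by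
  have h := fwdDiff_iter_eq_sum_shift (1 : ℝ) (fun r : ℝ => r ^ j) l 0
  have h2 : ∑ k ∈ Finset.range (l + 1), (((-1 : ℝ) ^ (l - k) * l.choose k) * (k : ℝ) ^ j)
      = (fwdDiff (1 : ℝ))^[l] (fun r : ℝ => r ^ j) 0 := by
    rw [h]
    refine Finset.sum_congr rfl fun k _ => ?_
    simp [zsmul_eq_mul]
  rw [h2]
  split_ifs with hjl
  · subst hjl
    rw [fwdDiff_iter_eq_factorial]
    simp
  · rw [fwdDiff_iter_pow_eq_zero_of_lt (lt_of_le_of_ne hj hjl)]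
    simp

/-- The `l`-th derivative is the limit of the `l`-th forward difference quotients. -/
theorem tendsto_fwdDiff_quotient {V : Type*} [NormedAddCommGroup V] [NormedSpace ℝ V] {f : ℝ → V}
    {S : Set ℝ} (hS : Convex ℝ S) {s : ℝ} (hs : s ∈ S) {l : ℕ} (hf : ContDiffOn ℝ l f S)
    (hr : ∀ᶠ h in 𝓝[>] (0 : ℝ), s + h ∈ S) :
    Tendsto (fun h : ℝ => (h ^ l)⁻¹ • ∑ k ∈ Finset.range (l + 1),
      ((-1 : ℝ) ^ (l - k) * l.choose k) • f (s + k * h)) (𝓝[>] 0)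
      (𝓝 (iteratedDerivWithin l f S s)) := by
  -- Taylor's formula with Peano remainder: the remainder contributes `o(h ^ l)`, and the `l`-th
  -- difference annihilates every Taylor term except the top one.
  set r : ℝ → V := fun x => f x - taylorWithinEval f l S s x with hrdef
  have ho := taylor_isLittleO hS hs hf
  have hscale : ∀ k : ℕ, ∀ᶠ h in 𝓝[>] (0 : ℝ), s + k * h ∈ S := by
    intro k
    rcases Nat.eq_zero_or_pos k with rfl | hk
    · simp [hs]
    · have hk' : (0 : ℝ) < k := by exact_mod_cast hk
      have ht : Tendsto (fun h : ℝ => (k : ℝ) * h) (𝓝[>] 0) (𝓝[>] 0) := by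
        refine tendsto_nhdsWithin_iff.2 ⟨?_, ?_⟩
        · have : Tendsto (fun h : ℝ => (k : ℝ) * h) (𝓝 0) (𝓝 (k * 0)) :=
            (continuous_const.mul continuous_id).tendsto 0
          simpa using this.mono_left nhdsWithin_le_nhds
        · filter_upwards [self_mem_nhdsWithin] with h hh
          exact mul_pos hk' hh
      exact ht.eventually hr
  have hrem : ∀ k : ℕ, Tendsto (fun h : ℝ => (h ^ l)⁻¹ • r (s + k * h)) (𝓝[>] 0) (𝓝 0) := by
    intro k
    have ht : Tendsto (fun h : ℝ => s + (k : ℝ) * h) (𝓝[>] 0) (𝓝[S] s) := by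
      refine tendsto_nhdsWithin_iff.2 ⟨?_, hscale k⟩
      have : Tendsto (fun h : ℝ => s + (k : ℝ) * h) (𝓝 0) (𝓝 (s + k * 0)) := by
        apply Continuous.tendsto; fun_prop
      simpa using this.mono_left nhdsWithin_le_nhds
    have h1 := ho.comp_tendsto ht
    have h2 : (fun h : ℝ => r (s + k * h)) =o[𝓝[>] 0] fun h : ℝ => h ^ l := by
      have h3 : (fun h : ℝ => r (s + k * h)) =o[𝓝[>] 0] fun h : ℝ => (k : ℝ) ^ l * h ^ l := by
        refine h1.congr (fun h => rfl) fun h => ?_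
        simp [mul_pow]
      exact h3.trans_isBigO ((Asymptotics.isBigO_refl _ _).const_mul_left _)
    have h4 := h2.norm_norm
    rw [tendsto_zero_iff_norm_tendsto_zero]
    have h5 := h4.tendsto_div_nhds_zero
    refine h5.congr fun h => ?_
    rw [norm_smul, norm_inv, div_eq_inv_mul]
  have hsum : Tendsto (fun h : ℝ => iteratedDerivWithin l f S s + ∑ k ∈ Finset.range (l + 1),
      ((-1 : ℝ) ^ (l - k) * l.choose k) • ((h ^ l)⁻¹ • r (s + k * h))) (𝓝[>] 0)
      (𝓝 (iteratedDerivWithin l f S s + ∑ k ∈ Finset.range (l + 1),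
      ((-1 : ℝ) ^ (l - k) * l.choose k) • (0 : V))) :=
    tendsto_const_nhds.add (tendsto_finsetSum _ fun k _ => (hrem k).const_smul _)
  simp only [smul_zero, Finset.sum_const_zero, add_zero] at hsum
  refine hsum.congr' ?_
  filter_upwards [self_mem_nhdsWithin] with h hh
  have hh0 : h ≠ 0 := ne_of_gt hh
  have key : ∑ k ∈ Finset.range (l + 1), ((-1 : ℝ) ^ (l - k) * l.choose k) •
      taylorWithinEval f l S s (s + k * h) = h ^ l • iteratedDerivWithin l f S s := by
    simp only [taylor_within_apply, Finset.smul_sum]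
    rw [Finset.sum_comm]
    have : ∀ j ∈ Finset.range (l + 1), ∑ k ∈ Finset.range (l + 1),
        ((-1 : ℝ) ^ (l - k) * l.choose k) •
          (((j.factorial : ℝ)⁻¹ * (s + k * h - s) ^ j) • iteratedDerivWithin j f S s)
        = if j = l then h ^ l • iteratedDerivWithin l f S s else 0 := by
      intro j hj
      have hjl : j ≤ l := by simpa [Nat.lt_succ_iff] using hj
      have h1 := sum_alternating_choose_mul_pow hjl
      have h2 : ∑ k ∈ Finset.range (l + 1),
        ((-1 : ℝ) ^ (l - k) * l.choose k) *
          ((j.factorial : ℝ)⁻¹ * (s + k * h - s) ^ j) = (j.factorial : ℝ)⁻¹ * h ^ j *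
          (if j = l then (l.factorial : ℝ) else 0) := by
        rw [← h1, Finset.mul_sum]
        refine Finset.sum_congr rfl fun k _ => ?_
        rw [add_sub_cancel_left, mul_pow]
        ring
      simp only [smul_smul]
      rw [← Finset.sum_smul, h2]
      split_ifs with hjl'
      · subst hjl'
        congr 1
        have : (j.factorial : ℝ) ≠ 0 := by exact_mod_cast j.factorial_ne_zero
        field_simp
      · simp
    rw [Finset.sum_congr rfl this]
    simp
  have h6 : ∑ k ∈ Finset.range (l + 1), ((-1 : ℝ) ^ (l - k) * l.choose k) • f (s + k * h)
      = h ^ l • iteratedDerivWithin l f S s + ∑ k ∈ Finset.range (l + 1),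
        ((-1 : ℝ) ^ (l - k) * l.choose k) • r (s + k * h) := by
    rw [← key, ← Finset.sum_add_distrib]
    refine Finset.sum_congr rfl fun k _ => ?_
    rw [← smul_add]
    simp [hrdef]
  rw [h6, smul_add, smul_smul, inv_mul_cancel₀ (pow_ne_zero _ hh0), one_smul, Finset.smul_sum]
  congr 1
  refine Finset.sum_congr rfl fun k _ => ?_
  rw [smul_comm]

variable {E : Type*} [NormedAddCommGroup E] [NormedSpace ℂ E]

/-- The rank is lower semicontinuous in norm: `k + 1 ≤ rank` is an open condition. -/
theorem isClosed_setOf_rank_le (k : ℕ) :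
    IsClosed {A : E →L[ℂ] E | LinearMap.rank (A : E →ₗ[ℂ] E) ≤ (k : Cardinal)} := by
  have h := (isOpen_setOfPred_nat_le_rank (𝕜 := ℂ) (E := E) (F := E) (k + 1)).isClosed_compl
  convert h using 1
  ext A
  simp only [mem_ofPred_eq, mem_compl_iff, not_le, Nat.cast_add, Nat.cast_one]
  rw [← Cardinal.succ_natCast, Order.lt_succ_iff]

theorem rank_smul_le (r : ℝ) (A : E →L[ℂ] E) :
    LinearMap.rank ((r • A : E →L[ℂ] E) : E →ₗ[ℂ] E) ≤ LinearMap.rank (A : E →ₗ[ℂ] E) := by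
  have : ((r • A : E →L[ℂ] E) : E →ₗ[ℂ] E)
      = (A : E →ₗ[ℂ] E).comp ((r : ℂ) • LinearMap.id) := by
    ext x
    simp
  rw [this]
  exact LinearMap.rank_comp_le_left _ _

theorem rank_sum_le {ι : Type*} (t : Finset ι) (A : ι → E →L[ℂ] E) (r : ℕ)
    (hr : ∀ i ∈ t, LinearMap.rank (A i : E →ₗ[ℂ] E) ≤ (r : Cardinal)) :
    LinearMap.rank ((∑ i ∈ t, A i : E →L[ℂ] E) : E →ₗ[ℂ] E) ≤ ((t.card * r : ℕ) : Cardinal) := by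
  classical
  induction t using Finset.induction_on with
  | empty => simp
  | insert i t hi ih =>
    rw [Finset.sum_insert hi, Finset.card_insert_of_notMem hi]
    have h1 := LinearMap.rank_add_le (A i : E →ₗ[ℂ] E) ((∑ i ∈ t, A i : E →L[ℂ] E) : E →ₗ[ℂ] E)
    have h2 := ih fun j hj => hr j (Finset.mem_insert_of_mem hj)
    have h3 := hr i (Finset.mem_insert_self _ _)
    have h4 := h1.trans (add_le_add h3 h2)
    refine h4.trans (le_of_eq ?_)
    push_cast
    ring

/-- The difference quotients of order `l` are combinations of `l + 1` values of `f`, so their ranks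
are at most `(l + 1) * r`, and this bound passes to the limit. -/
theorem rank_iteratedDerivWithin_le {f : ℝ → E →L[ℂ] E} {S : Set ℝ} (hS : Convex ℝ S) {s : ℝ}
    (hs : s ∈ S) {l : ℕ} (hf : ContDiffOn ℝ l f S) (hr : ∀ᶠ h in 𝓝[>] (0 : ℝ), s + h ∈ S) {r : ℕ}
    (hrank : ∀ t ∈ S, LinearMap.rank (f t : E →ₗ[ℂ] E) ≤ (r : Cardinal)) :
    LinearMap.rank ((iteratedDerivWithin l f S s : E →L[ℂ] E) : E →ₗ[ℂ] E)
      ≤ (((l + 1) * r : ℕ) : Cardinal) := by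
  have hlim := tendsto_fwdDiff_quotient hS hs hf hr
  refine (isClosed_setOf_rank_le ((l + 1) * r)).mem_of_tendsto hlim ?_
  have hev : ∀ᶠ h in 𝓝[>] (0 : ℝ), s + l * h ∈ S := by
    rcases Nat.eq_zero_or_pos l with rfl | hk
    · simp [hs]
    · have hk' : (0 : ℝ) < l := by exact_mod_cast hk
      have ht : Tendsto (fun h : ℝ => (l : ℝ) * h) (𝓝[>] 0) (𝓝[>] 0) := by
        refine tendsto_nhdsWithin_iff.2 ⟨?_, ?_⟩
        · have : Tendsto (fun h : ℝ => (l : ℝ) * h) (𝓝 0) (𝓝 (l * 0)) :=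
            (continuous_const.mul continuous_id).tendsto 0
          simpa using this.mono_left nhdsWithin_le_nhds
        · filter_upwards [self_mem_nhdsWithin] with h hh
          exact mul_pos hk' hh
      exact ht.eventually hr
  filter_upwards [hev, self_mem_nhdsWithin] with h hh hpos
  have hpos' : 0 < h := hpos
  have hmem : ∀ k ∈ Finset.range (l + 1), s + k * h ∈ S := by
    intro k hk
    have hkl : (k : ℝ) ≤ l := by
      have : k ≤ l := by simpa [Nat.lt_succ_iff] using hk
      exact_mod_cast this
    exact hS.ordConnected.out hs hh ⟨by nlinarith [Nat.cast_nonneg (α := ℝ) k], by nlinarith⟩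
  refine (rank_smul_le _ _).trans ?_
  have := rank_sum_le (Finset.range (l + 1))
    (fun k => ((-1 : ℝ) ^ (l - k) * l.choose k) • f (s + k * h)) r
    (fun k hk => (rank_smul_le _ _).trans (hrank _ (hmem k hk)))
  simpa using this

end FiniteDifferences

/-! ### Calculus of `C^k` families with bounds in powers of the gap. -/

section DerivBound

variable {V : Type*} [NormedAddCommGroup V] [NormedSpace ℝ V]

/-- `X` is of class `C^k` on `S`, and its `l`-th derivative is at most `C / g ^ (a + l)`. -/
def DerivBound (S : Set ℝ) (g : ℝ → ℝ) : ℕ → ℕ → ℝ → (ℝ → V) → Prop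
  | 0, a, C, X => ContinuousOn X S ∧ ∀ s ∈ S, ‖X s‖ ≤ C / g s ^ a
  | k + 1, a, C, X => (∀ s ∈ S, ‖X s‖ ≤ C / g s ^ a) ∧
      ∃ X' : ℝ → V, (∀ s ∈ S, HasDerivWithinAt X (X' s) S s) ∧ DerivBound S g k (a + 1) C X'

namespace DerivBound

variable {S : Set ℝ} {g : ℝ → ℝ} {k a b : ℕ} {C D : ℝ} {X Y : ℝ → V}

theorem norm_le (h : DerivBound S g k a C X) {s : ℝ} (hs : s ∈ S) : ‖X s‖ ≤ C / g s ^ a := by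
  cases k with
  | zero => exact h.2 s hs
  | succ k => exact h.1 s hs

theorem continuousOn (h : DerivBound S g k a C X) : ContinuousOn X S := by
  cases k with
  | zero => exact h.1
  | succ k =>
    obtain ⟨-, X', hX', -⟩ := h
    exact fun s hs => (hX' s hs).continuousWithinAt

theorem of_succ (h : DerivBound S g (k + 1) a C X) : DerivBound S g k a C X := by
  induction k generalizing a X with
  | zero => exact ⟨h.continuousOn, h.1⟩
  | succ k ih =>
    obtain ⟨h0, X', hX', h1⟩ := h
    exact ⟨h0, X', hX', ih h1⟩

theorem mono (h : DerivBound S g k a C X) (hg : ∀ s ∈ S, 0 < g s) (hCD : C ≤ D) :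
    DerivBound S g k a D X := by
  have hle : ∀ a, ∀ s ∈ S, C / g s ^ a ≤ D / g s ^ a := fun a s hs => by
    have := hg s hs
    gcongr
  induction k generalizing a X with
  | zero => exact ⟨h.1, fun s hs => (h.2 s hs).trans (hle a s hs)⟩
  | succ k ih =>
    obtain ⟨h0, X', hX', h1⟩ := h
    exact ⟨fun s hs => (h0 s hs).trans (hle a s hs), X', hX', ih h1⟩

theorem add (hX : DerivBound S g k a C X) (hY : DerivBound S g k a D Y) :
    DerivBound S g k a (C + D) (fun s => X s + Y s) := by
  have hle : ∀ {k a : ℕ} {X Y : ℝ → V}, DerivBound S g k a C X → DerivBound S g k a D Y → ∀ s ∈ S,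
      ‖X s + Y s‖ ≤ (C + D) / g s ^ a := fun {k a X Y} hX hY s hs => by
    rw [add_div]
    exact (norm_add_le _ _).trans (add_le_add (hX.norm_le hs) (hY.norm_le hs))
  induction k generalizing a X Y with
  | zero => exact ⟨hX.1.add hY.1, hle hX hY⟩
  | succ k ih =>
    refine ⟨hle hX hY, ?_⟩
    obtain ⟨-, X', hX', h1⟩ := hX
    obtain ⟨-, Y', hY', h2⟩ := hY
    exact ⟨fun s => X' s + Y' s, fun s hs => (hX' s hs).add (hY' s hs), ih h1 h2⟩

theorem neg (hX : DerivBound S g k a C X) : DerivBound S g k a C (fun s => -X s) := by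
  induction k generalizing a X with
  | zero => exact ⟨hX.1.neg, fun s hs => by rw [norm_neg]; exact hX.2 s hs⟩
  | succ k ih =>
    obtain ⟨h0, X', hX', h1⟩ := hX
    exact ⟨fun s hs => by rw [norm_neg]; exact h0 s hs, fun s => -X' s,
      fun s hs => (hX' s hs).neg, ih h1⟩

theorem sub (hX : DerivBound S g k a C X) (hY : DerivBound S g k a D Y) :
    DerivBound S g k a (C + D) (fun s => X s - Y s) := by
  simpa only [sub_eq_add_neg] using hX.add hY.neg

theorem weaken (h : DerivBound S g k a C X) (hC : 0 ≤ C) (hg : ∀ s ∈ S, 0 < g s)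
    (hg1 : ∀ s ∈ S, g s ≤ 1) (hab : a ≤ b) : DerivBound S g k b C X := by
  have hle : ∀ a b : ℕ, a ≤ b → ∀ s ∈ S, C / g s ^ a ≤ C / g s ^ b := fun a b hab s hs => by
    have h0 := hg s hs
    exact div_le_div_of_nonneg_left hC (pow_pos h0 _)
      (pow_le_pow_of_le_one h0.le (hg1 s hs) hab)
  induction k generalizing a b X with
  | zero => exact ⟨h.1, fun s hs => (h.2 s hs).trans (hle a b hab s hs)⟩
  | succ k ih =>
    obtain ⟨h0, X', hX', h1⟩ := h
    exact ⟨fun s hs => (h0 s hs).trans (hle a b hab s hs), X', hX', ih h1 (by omega)⟩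

theorem const (x : V) (hC : ‖x‖ ≤ C) (hg : ∀ s ∈ S, 0 < g s) :
    DerivBound S g k 0 C (fun _ => x) := by
  have hC0 := (norm_nonneg x).trans hC
  -- All powers `a` are needed, since each derivative raises the power by one.
  have hzero : ∀ k a, DerivBound S g k a C (fun _ => (0 : V)) := by
    have hz : ∀ a, ∀ s ∈ S, ‖(0 : V)‖ ≤ C / g s ^ a := fun a s hs => by
      have := hg s hs
      rw [norm_zero]
      positivity
    intro k
    induction k with
    | zero => exact fun a => ⟨continuousOn_const, hz a⟩
    | succ k ih => exact fun a => ⟨hz a, fun _ => 0, fun s _ => hasDerivWithinAt_const _ _ _, ih _⟩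
  cases k with
  | zero => exact ⟨continuousOn_const, fun s _ => by simpa using hC⟩
  | succ k => exact ⟨fun s _ => by simpa using hC, fun _ => 0,
      fun s _ => hasDerivWithinAt_const _ _ _, hzero _ _⟩

theorem contDiffOn (h : DerivBound S g k a C X) (hS : UniqueDiffOn ℝ S) : ContDiffOn ℝ k X S := by
  induction k generalizing a X with
  | zero => simpa [contDiffOn_zero] using h.1
  | succ k ih =>
    obtain ⟨-, X', hX', h1⟩ := h
    have : ((k + 1 : ℕ) : WithTop ℕ∞) = (k : WithTop ℕ∞) + 1 := by push_cast; rfl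
    rw [this, contDiffOn_succ_iff_derivWithin hS]
    refine ⟨fun s hs => (hX' s hs).differentiableWithinAt, by simp, ?_⟩
    exact (ih h1).congr fun s hs => (hX' s hs).derivWithin (hS s hs)

/-- The two terms of the Leibniz rule double the constant at each derivative, whence `2 ^ k`. -/
theorem mul {𝔸 : Type*} [NormedRing 𝔸] [NormedAlgebra ℝ 𝔸] {X Y : ℝ → 𝔸}
    (hX : DerivBound S g k a C X) (hY : DerivBound S g k b D Y) (hC : 0 ≤ C) (hD : 0 ≤ D)
    (hg : ∀ s ∈ S, 0 < g s) :
    DerivBound S g k (a + b) (2 ^ k * (C * D)) (fun s => X s * Y s) := by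
  have hle : ∀ {k a b : ℕ} {X Y : ℝ → 𝔸}, DerivBound S g k a C X → DerivBound S g k b D Y → ∀ s ∈ S,
      ‖X s * Y s‖ ≤ 2 ^ k * (C * D) / g s ^ (a + b) := fun {k a b X Y} hX hY s hs => by
    have h0 := hg s hs
    calc ‖X s * Y s‖ ≤ ‖X s‖ * ‖Y s‖ := norm_mul_le _ _
      _ ≤ (C / g s ^ a) * (D / g s ^ b) :=
        mul_le_mul (hX.norm_le hs) (hY.norm_le hs) (norm_nonneg _) (by positivity)
      _ = 1 * (C * D) / g s ^ (a + b) := by rw [pow_add]; field_simp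
      _ ≤ 2 ^ k * (C * D) / g s ^ (a + b) := by
        gcongr
        exact one_le_pow₀ (by norm_num)
  induction k generalizing a b X Y with
  | zero => exact ⟨hX.1.mul hY.1, hle hX hY⟩
  | succ k ih =>
    refine ⟨hle hX hY, ?_⟩
    have hX0 := hX.of_succ
    have hY0 := hY.of_succ
    obtain ⟨-, X', hX', h1⟩ := hX
    obtain ⟨-, Y', hY', h2⟩ := hY
    refine ⟨fun s => X' s * Y s + X s * Y' s, fun s hs => (hX' s hs).mul (hY' s hs), ?_⟩
    have h3 := ih h1 hY0
    have h4 := ih hX0 h2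
    rw [show a + 1 + b = a + b + 1 by ring] at h3
    have h5 := h3.add h4
    rw [show 2 ^ k * (C * D) + 2 ^ k * (C * D) = 2 ^ (k + 1) * (C * D) by ring] at h5
    exact h5

end DerivBound

theorem DerivBound.star {𝔸 : Type*} [NormedRing 𝔸] [NormedAlgebra ℝ 𝔸] [StarRing 𝔸]
    [NormedStarGroup 𝔸] [StarModule ℝ 𝔸] {S : Set ℝ} {g : ℝ → ℝ} {k a : ℕ} {C : ℝ} {X : ℝ → 𝔸}
    (hX : DerivBound S g k a C X) :
    DerivBound S g k a C (fun s => star (X s)) := by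
  induction k generalizing a X with
  | zero => exact ⟨hX.1.star, fun s hs => by rw [norm_star]; exact hX.2 s hs⟩
  | succ k ih =>
    obtain ⟨h0, X', hX', h1⟩ := hX
    exact ⟨fun s hs => by rw [norm_star]; exact h0 s hs, fun s => Star.star (X' s),
      fun s hs => (hX' s hs).star, ih h1⟩

end DerivBound

/-! ### Resolvents and spectral gap of a self-adjoint operator. -/

namespace UnboundedOp

variable {E : Type*} [NormedAddCommGroup E] [InnerProductSpace ℂ E]

namespace IsResolvent

variable {h : E →ₗ.[ℂ] E} {z : ℂ} {R : E →L[ℂ] E}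

theorem mem (hR : IsResolvent h z R) (φ : E) : R φ ∈ h.domain := ((hR φ _).1 rfl).1

theorem smul_sub_apply (hR : IsResolvent h z R) (φ : E) :
    z • R φ - h ⟨R φ, hR.mem φ⟩ = φ := ((hR φ _).1 rfl).2

theorem apply_eq (hR : IsResolvent h z R) (φ : E) :
    h ⟨R φ, hR.mem φ⟩ = z • R φ - φ := by
  rw [eq_sub_iff_add_eq, ← eq_sub_iff_add_eq', hR.smul_sub_apply]

theorem apply_smul_sub (hR : IsResolvent h z R) (ψ : h.domain) : R (z • (ψ : E) - h ψ) = ψ :=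
  (hR _ _).2 ⟨ψ.2, rfl⟩

end IsResolvent

theorem gap_le_one (h : E →ₗ.[ℂ] E) (I : Set ℝ) : gap h I ≤ 1 := by
  have := ENNReal.toReal_mono ENNReal.one_ne_top (min_le_left 1
    (⨅ x ∈ I, Metric.infEDist x (realSpectrum h \ (realSpectrum h ∩ I))))
  simpa [gap] using this

theorem gap_le_dist {h : E →ₗ.[ℂ] E} {I : Set ℝ} {x y : ℝ} (hx : x ∈ realSpectrum h)
    (hxI : x ∉ I) (hy : y ∈ I) : gap h I ≤ |y - x| := by
  have h1 : (min 1 (⨅ x ∈ I, Metric.infEDist x (realSpectrum h \ (realSpectrum h ∩ I))))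
      ≤ edist y x :=
    (min_le_right _ _).trans ((iInf₂_le y hy).trans
      (Metric.infEDist_le_edist_of_mem ⟨hx, fun hh => hxI hh.2⟩))
  have h2 := ENNReal.toReal_mono (edist_ne_top y x) h1
  rwa [← dist_edist, Real.dist_eq] at h2

/-- Seen from the centre, the spectrum inside the interval lies within the half-length, and the
spectrum outside lies beyond the half-length plus the gap. This margin drives all later estimates.
-/
theorem half_length_add_gap_le {h : E →ₗ.[ℂ] E} {a b x : ℝ} (hab : a ≤ b)
    (hx : x ∈ realSpectrum h) (hxI : x ∉ Icc a b) :
    (b - a) / 2 + gap h (Icc a b) ≤ |x - (a + b) / 2| := by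
  have h1 := gap_le_dist hx hxI (left_mem_Icc.2 hab)
  have h2 := gap_le_dist hx hxI (right_mem_Icc.2 hab)
  rw [mem_Icc, not_and_or, not_le, not_le] at hxI
  rcases hxI with h3 | h3
  · rw [abs_of_pos (by linarith)] at h1
    rw [abs_of_neg (by linarith)]
    linarith
  · rw [abs_of_neg (by linarith)] at h2
    rw [abs_of_pos (by linarith)]
    linarith

variable [CompleteSpace E] {h : E →ₗ.[ℂ] E}

theorem inner_apply_left (hsa : IsSelfAdjoint h) (x y : h.domain) :
    inner ℂ (h x) (y : E) = inner ℂ (x : E) (h y) := by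
  have := LinearPMap.adjoint_isFormalAdjoint hsa.dense_domain
  rw [LinearPMap.isSelfAdjoint_def.1 hsa] at this
  exact this x y

theorem exists_apply_eq_of_inner (hsa : IsSelfAdjoint h) {y w : E}
    (hw : ∀ x : h.domain, inner ℂ w (x : E) = inner ℂ y (h x)) :
    ∃ hy : y ∈ h.domain, h ⟨y, hy⟩ = w := by
  have h1 : y ∈ h.domain := by
    have := LinearPMap.mem_adjoint_domain_of_exists (T := h) y ⟨w, hw⟩
    rwa [LinearPMap.isSelfAdjoint_def.1 hsa] at this
  refine ⟨h1, ?_⟩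
  refine hsa.dense_domain.eq_of_inner_left ℂ fun v hv => ?_
  rw [hw ⟨v, hv⟩, ← inner_apply_left hsa ⟨y, h1⟩ ⟨v, hv⟩]

/-- The bound for `z - h` gives injectivity and, as `h` is closed, a closed range. A vector
orthogonal to the range is in the kernel of `conj z - h`, which is trivial by the second bound. -/
theorem exists_isResolvent (hsa : IsSelfAdjoint h) {z : ℂ} {κ : ℝ} (hκ : 0 < κ)
    (h1 : ∀ ψ : h.domain, κ * ‖(ψ : E)‖ ≤ ‖z • (ψ : E) - h ψ‖)
    (h2 : ∀ ψ : h.domain, κ * ‖(ψ : E)‖ ≤ ‖(starRingEnd ℂ z) • (ψ : E) - h ψ‖) :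
    ∃ R, IsResolvent h z R := by
  let f : h.domain →ₗ[ℂ] E := z • h.domain.subtype - h.toFun
  have hf : ∀ ψ, f ψ = z • (ψ : E) - h ψ := fun ψ => rfl
  have hinj : Function.Injective f := by
    rw [injective_iff_map_eq_zero]
    intro ψ hψ
    have := h1 ψ
    rw [← hf, hψ, norm_zero] at this
    have : ‖(ψ : E)‖ ≤ 0 := by nlinarith [norm_nonneg (ψ : E)]
    exact Subtype.ext (norm_le_zero_iff.1 this)
  have hclosed : IsClosed (LinearMap.range f : Set E) := by
    refine IsSeqClosed.isClosed fun y y₀ hy hlim => ?_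
    choose ψ hψ using hy
    have hc : CauchySeq (fun n => (ψ n : E)) := by
      have hyc := hlim.cauchySeq
      rw [Metric.cauchySeq_iff] at hyc ⊢
      intro ε hε
      obtain ⟨N, hN⟩ := hyc (κ * ε) (by positivity)
      refine ⟨N, fun m hm n hn => ?_⟩
      have h3 := hN m hm n hn
      have h4 := h1 (ψ m - ψ n)
      rw [← hf, map_sub, hψ, hψ, ← dist_eq_norm] at h4
      rw [dist_eq_norm]
      have h5 : κ * ‖(ψ m : E) - ψ n‖ < κ * ε := lt_of_le_of_lt h4 h3
      exact lt_of_mul_lt_mul_left h5 hκ.le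
    obtain ⟨ψ₀, hψ₀⟩ := cauchySeq_tendsto_of_complete hc
    have hgr : (ψ₀, z • ψ₀ - y₀) ∈ h.graph := by
      have hcl : IsClosed (h.graph : Set (E × E)) := hsa.isClosed
      refine hcl.mem_of_tendsto (b := atTop)
        (f := fun n => ((ψ n : E), z • (ψ n : E) - y n)) ?_ ?_
      · exact hψ₀.prodMk_nhds ((hψ₀.const_smul z).sub hlim)
      · refine Eventually.of_forall fun n => ?_
        rw [SetLike.mem_coe, LinearPMap.mem_graph_iff]
        exact ⟨ψ n, rfl, by rw [← hψ n, hf]; exact (sub_sub_cancel _ _).symm⟩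
    rw [LinearPMap.mem_graph_iff] at hgr
    obtain ⟨χ, hχ1, hχ2⟩ := hgr
    simp only at hχ1 hχ2
    exact ⟨χ, by rw [hf, hχ2, hχ1]; abel⟩
  have hrange : LinearMap.range f = ⊤ := by
    have : CompleteSpace (LinearMap.range f) := hclosed.completeSpace_coe
    rw [← Submodule.orthogonal_eq_bot_iff, Submodule.eq_bot_iff]
    intro y hy
    have h3 : ∀ x : h.domain, inner ℂ ((starRingEnd ℂ z) • y) (x : E) = inner ℂ y (h x) := by
      intro x
      have h4 := Submodule.inner_left_of_mem_orthogonal (LinearMap.mem_range_self f x) hy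
      rw [hf, inner_sub_right, inner_smul_right, sub_eq_zero] at h4
      rw [inner_smul_left, Complex.conj_conj, h4]
    obtain ⟨hy1, hy2⟩ := exists_apply_eq_of_inner hsa h3
    have h5 := h2 ⟨y, hy1⟩
    rw [hy2, sub_self, norm_zero] at h5
    have : ‖y‖ ≤ 0 := by
      have h5' : κ * ‖y‖ ≤ 0 := h5
      nlinarith [norm_nonneg y]
    exact norm_le_zero_iff.1 this
  let e := LinearEquiv.ofBijective f ⟨hinj, LinearMap.range_eq_top.1 hrange⟩
  have he : ∀ ψ, e ψ = f ψ := fun ψ => rfl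
  let R : E →L[ℂ] E := (h.domain.subtype ∘ₗ e.symm.toLinearMap).mkContinuous κ⁻¹ (by
    intro φ
    have h3 := h1 (e.symm φ)
    rw [← hf, ← he, e.apply_symm_apply] at h3
    rw [inv_mul_eq_div, le_div_iff₀ hκ, mul_comm]
    exact h3)
  have hR : ∀ φ, R φ = (e.symm φ : E) := fun φ => rfl
  refine ⟨R, fun φ ψ => ⟨?_, ?_⟩⟩
  · rintro rfl
    refine ⟨(e.symm φ).2, ?_⟩
    have : f (e.symm φ) = φ := by rw [← he, e.apply_symm_apply]
    exact this
  · rintro ⟨hψ, h3⟩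
    have : e ⟨ψ, hψ⟩ = φ := h3
    rw [hR, ← this, e.symm_apply_apply]

/-- The imaginary part of `⟨ψ, (z - h) ψ⟩` is `z.im * ‖ψ‖ ^ 2`, because `⟨ψ, h ψ⟩` is real. -/
theorem abs_im_mul_norm_le (hsa : IsSelfAdjoint h) (z : ℂ) (ψ : h.domain) :
    |z.im| * ‖(ψ : E)‖ ≤ ‖z • (ψ : E) - h ψ‖ := by
  have hreal : (inner ℂ (ψ : E) (h ψ)).im = 0 := by
    have h1 := inner_apply_left hsa ψ ψ
    rw [← inner_conj_symm] at h1
    exact Complex.conj_eq_iff_im.1 h1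
  have h1 : (inner ℂ (ψ : E) (z • (ψ : E) - h ψ)).im = z.im * ‖(ψ : E)‖ ^ 2 := by
    rw [inner_sub_right, inner_smul_right, inner_self_eq_norm_sq_to_K, Complex.sub_im, hreal,
      sub_zero]
    have : ((‖(ψ : E)‖ : ℂ) ^ 2) = ((‖(ψ : E)‖ ^ 2 : ℝ) : ℂ) := by push_cast; rfl
    rw [show ((RCLike.ofReal ‖(ψ : E)‖ : ℂ) ^ 2) = ((‖(ψ : E)‖ ^ 2 : ℝ) : ℂ) from this,
      Complex.im_mul_ofReal]
  have h2 : |z.im * ‖(ψ : E)‖ ^ 2| ≤ ‖(ψ : E)‖ * ‖z • (ψ : E) - h ψ‖ := by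
    rw [← h1]
    exact (Complex.abs_im_le_norm _).trans (norm_inner_le_norm _ _)
  rw [abs_mul, abs_of_nonneg (sq_nonneg ‖(ψ : E)‖)] at h2
  rcases eq_or_lt_of_le (norm_nonneg (ψ : E)) with h3 | h3
  · rw [← h3]; simp
  · refine le_of_mul_le_mul_left ?_ h3
    nlinarith

theorem exists_isResolvent_of_im_ne_zero (hsa : IsSelfAdjoint h) {z : ℂ} (hz : z.im ≠ 0) :
    ∃ R, IsResolvent h z R := by
  refine exists_isResolvent hsa (abs_pos.2 hz) (abs_im_mul_norm_le hsa z) fun ψ => ?_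
  have := abs_im_mul_norm_le hsa (starRingEnd ℂ z) ψ
  simpa using this

theorem isResolvent_resolvent_I (hsa : IsSelfAdjoint h) :
    IsResolvent h Complex.I (resolvent h Complex.I) := by
  have hex := exists_isResolvent_of_im_ne_zero hsa (z := Complex.I) (by simp)
  rw [resolvent, dif_pos hex]
  exact hex.choose_spec

theorem IsResolvent.star_eq (hsa : IsSelfAdjoint h) {z : ℂ} {R R' : E →L[ℂ] E}
    (hR : IsResolvent h z R) (hR' : IsResolvent h (starRingEnd ℂ z) R') : star R = R' := by
  rw [ContinuousLinearMap.star_eq_adjoint]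
  symm
  rw [ContinuousLinearMap.eq_adjoint_iff]
  intro x y
  have h1 := hR'.smul_sub_apply x
  have h2 := hR.smul_sub_apply y
  have h3 := inner_apply_left hsa ⟨R' x, hR'.mem x⟩ ⟨R y, hR.mem y⟩
  simp only at h3
  calc inner ℂ (R' x) y
      = inner ℂ (R' x) (z • R y - h ⟨R y, hR.mem y⟩) := by rw [h2]
    _ = inner ℂ ((starRingEnd ℂ z) • R' x - h ⟨R' x, hR'.mem x⟩) (R y) := by
      rw [inner_sub_right, inner_sub_left, inner_smul_right, inner_smul_left, h3,
        Complex.conj_conj]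
    _ = inner ℂ x (R y) := by rw [h1]

omit [CompleteSpace E] in
theorem IsResolvent.mul_eq {z w : ℂ} {R R' : E →L[ℂ] E}
    (hR : IsResolvent h z R) (hR' : IsResolvent h w R') : R' - R = (z - w) • (R * R') := by
  ext φ
  have h1 := hR.apply_smul_sub ⟨R' φ, hR'.mem φ⟩
  have h2 : z • R' φ - h ⟨R' φ, hR'.mem φ⟩ = (z - w) • R' φ + φ := by
    rw [hR'.apply_eq]; module
  simp only at h1
  rw [h2, map_add, map_smul] at h1
  simp only [sub_apply, smul_apply, mul_apply_eq_comp]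
  exact sub_eq_of_eq_add h1.symm

/-- The adjoint is the resolvent at `-i`, and two resolvents commute by the resolvent identity
written in both orders. -/
theorem isStarNormal_resolvent_I (hsa : IsSelfAdjoint h) :
    IsStarNormal (resolvent h Complex.I) := by
  have hA := isResolvent_resolvent_I hsa
  obtain ⟨R', hR'⟩ := exists_isResolvent_of_im_ne_zero hsa (z := starRingEnd ℂ Complex.I) (by simp)
  have hs := hA.star_eq hsa hR'
  refine ⟨?_⟩
  rw [hs, commute_iff_eq]
  have h1 := hA.mul_eq hR'
  have h2 := hR'.mul_eq hA
  have hne : (Complex.I - starRingEnd ℂ Complex.I) ≠ 0 := by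
    simp [Complex.ext_iff]
  have h3 : (Complex.I - starRingEnd ℂ Complex.I) • (R' * resolvent h Complex.I)
      = (Complex.I - starRingEnd ℂ Complex.I) • (resolvent h Complex.I * R') := by
    rw [← h1, ← neg_sub (starRingEnd ℂ Complex.I), neg_smul, ← h2]; abel
  exact smul_right_injective _ hne h3

/-- If `i - w⁻¹` had a resolvent `R`, then `w⁻¹ (1 + w⁻¹ R)` would invert `w - (i - h)⁻¹`. Non-real
points always have a resolvent, so `i - w⁻¹` must be real. -/
theorem mem_realSpectrum_of_mem_spectrum (hsa : IsSelfAdjoint h) {w : ℂ}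
    (hw : w ∈ spectrum ℂ (resolvent h Complex.I)) (hw0 : w ≠ 0) :
    ∃ x : ℝ, x ∈ realSpectrum h ∧ Complex.I - w⁻¹ = x := by
  set A := resolvent h Complex.I with hAdef
  have hA := isResolvent_resolvent_I hsa
  have key : ¬ ∃ R, IsResolvent h (Complex.I - w⁻¹) R := by
    rintro ⟨R, hR⟩
    refine hw ?_
    have h1 := hR.mul_eq hA
    have h2 := hA.mul_eq hR
    rw [show Complex.I - w⁻¹ - Complex.I = -w⁻¹ by ring] at h1
    rw [show Complex.I - (Complex.I - w⁻¹) = w⁻¹ by ring] at h2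
    rw [← hAdef] at h1 h2
    have e1 : R * A = w • (R - A) := by
      rw [← neg_sub A R, h1, neg_smul, neg_neg, smul_smul,
        mul_inv_cancel₀ hw0, one_smul]
    have e2 : A * R = w • (R - A) := by
      rw [h2, smul_smul, mul_inv_cancel₀ hw0, one_smul]
    refine ⟨⟨algebraMap ℂ _ w - A, w⁻¹ • (1 + w⁻¹ • R), ?_, ?_⟩, rfl⟩
    · rw [Algebra.algebraMap_eq_smul_one]
      simp only [sub_mul, mul_add, smul_mul_assoc, mul_smul_comm, one_mul, mul_one]
      rw [e2]
      match_scalars <;> field_simp <;> ring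
    · rw [Algebra.algebraMap_eq_smul_one]
      simp only [mul_sub, add_mul, smul_mul_assoc, mul_smul_comm, one_mul, mul_one]
      rw [e1]
      match_scalars <;> field_simp <;> ring
  have him : (Complex.I - w⁻¹).im = 0 := by
    by_contra hne
    exact key (exists_isResolvent_of_im_ne_zero hsa hne)
  have hre : Complex.I - w⁻¹ = ((Complex.I - w⁻¹).re : ℂ) := by
    apply Complex.ext
    · simp
    · rw [him, Complex.ofReal_im]
  refine ⟨_, ?_, hre⟩
  rw [hre] at key
  exact key

end UnboundedOp

/-! ### The spectral projector and the reduced resolvent by functional calculus. -/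

namespace UnboundedOp

variable {E : Type*} [NormedAddCommGroup E] [InnerProductSpace ℂ E] [CompleteSpace E]
  {h : E →ₗ.[ℂ] E}

/-- The hypothesis says `(i - h)⁻¹ (i X - Y) = X`. It reduces a claim `h X = Y` about the unbounded
operator to an identity between functions of the resolvent. -/
theorem exists_apply_eq_of_mul_sub (hsa : IsSelfAdjoint h) {X Y : E →L[ℂ] E}
    (hXY : resolvent h Complex.I * (Complex.I • X - Y) = X) (φ : E) :
    ∃ hφ : X φ ∈ h.domain, h ⟨X φ, hφ⟩ = Y φ := by
  have hA := isResolvent_resolvent_I hsa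
  have h1 : resolvent h Complex.I ((Complex.I • X - Y) φ) = X φ := by
    conv_rhs => rw [← hXY]
    rfl
  obtain ⟨h2, h3⟩ := (hA _ _).1 h1
  refine ⟨h2, ?_⟩
  simp only [sub_apply, smul_apply] at h3
  exact sub_right_injective h3

/-- The spectral projector of an interval isolated from the rest of the spectrum, the restriction
`m` of `h` to its range, and the reduced resolvent `S` at the centre of the interval. -/
theorem exists_spectralProjector_data (hsa : IsSelfAdjoint h) {a b : ℝ} (hab : a ≤ b) (ha : 0 ≤ a)
    (hg : 0 < gap h (Icc a b)) :
    ∃ P m S : E →L[ℂ] E, spectralProjector h (Icc a b) = P ∧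
      P * P = P ∧ star P = P ∧ star m = m ∧ star S = S ∧ m * P = m ∧ P * S = 0 ∧ ‖m‖ ≤ b ∧
      ‖m - ((a + b) / 2 : ℂ) • P‖ ≤ (b - a) / 2 ∧
      ‖S‖ ≤ ((b - a) / 2 + gap h (Icc a b))⁻¹ ∧
      (∀ φ, ∃ hφ : P φ ∈ h.domain, h ⟨P φ, hφ⟩ = m φ) ∧
      (∀ φ, ∃ hφ : S φ ∈ h.domain, h ⟨S φ, hφ⟩ = φ - P φ + ((a + b) / 2 : ℂ) • S φ) := by
  classical
  set A := resolvent h Complex.I with hAdef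
  set c : ℝ := (a + b) / 2 with hc
  set ρ : ℝ := (b - a) / 2 with hρ
  set γ := gap h (Icc a b) with hγ
  have hcC : ((a + b) / 2 : ℂ) = (c : ℂ) := by rw [hc]; push_cast; rfl
  rw [hcC]
  have hρ0 : 0 ≤ ρ := by rw [hρ]; linarith
  have hnormal : IsStarNormal A := isStarNormal_resolvent_I hsa
  -- If `w = (i - x)⁻¹` then `d w = (x - c) w`, so `‖d w‖ / ‖w‖ = |x - c|`. Thus `C₁` contains the
  -- image of the spectrum in the interval, and `C₂` the image of the remaining spectrum together
  -- with `w = 0`, the image of infinity.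
  let d : ℂ → ℂ := fun w => (Complex.I - c) * w - 1
  have hd : Continuous d := by fun_prop
  let C₁ : Set ℂ := {w | ‖d w‖ ≤ ρ * ‖w‖}
  let C₂ : Set ℂ := {w | (ρ + γ) * ‖w‖ ≤ ‖d w‖}
  have hC₁ : IsClosed C₁ := isClosed_le hd.norm (continuous_const.mul continuous_norm)
  have hC₂ : IsClosed C₂ := isClosed_le (continuous_const.mul continuous_norm) hd.norm
  have hd0 : ‖d 0‖ = 1 := by simp [d]
  have h1ne : ∀ w ∈ C₁, w ≠ 0 := by
    rintro w hw rfl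
    have : ‖d 0‖ ≤ ρ * ‖(0 : ℂ)‖ := hw
    rw [hd0, norm_zero, mul_zero] at this
    linarith
  have hdisj : ∀ w ∈ C₂, w ∉ C₁ := by
    intro w h2 h1
    have h3 : (ρ + γ) * ‖w‖ ≤ ρ * ‖w‖ := le_trans h2 h1
    have h4 := norm_pos_iff.2 (h1ne w h1)
    nlinarith
  have h2ne : ∀ w ∈ C₂, d w ≠ 0 := by
    intro w hw h0
    have h1 : (ρ + γ) * ‖w‖ ≤ ‖d w‖ := hw
    rw [h0, norm_zero] at h1
    have h2 : ‖w‖ ≤ 0 := by nlinarith [norm_nonneg w]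
    rw [norm_le_zero_iff.1 h2] at h0
    rw [h0, norm_zero] at hd0
    norm_num at hd0
  have hdw : ∀ (w : ℂ) (x : ℝ), w ≠ 0 → Complex.I - w⁻¹ = x → ‖d w‖ = |x - c| * ‖w‖ := by
    intro w x hw hx
    have : d w = ((x - c : ℝ) : ℂ) * w := by
      simp only [d]
      push_cast
      rw [← hx]
      field_simp
      ring
    rw [this, norm_mul, Complex.norm_real, Real.norm_eq_abs]
  have hσ : ∀ w ∈ spectrum ℂ A, (w ∈ C₁ ∧ ∃ x : ℝ, x ∈ Icc a b ∧ Complex.I - w⁻¹ = x) ∨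
      (w ∈ C₂ ∧ w = 0) ∨ (w ∈ C₂ ∧ w ≠ 0 ∧ ∃ x : ℝ, x ∉ Icc a b ∧ Complex.I - w⁻¹ = x) := by
    intro w hw
    by_cases hw0 : w = 0
    · refine Or.inr (Or.inl ⟨?_, hw0⟩)
      subst hw0
      simp [C₂, hd0]
    · obtain ⟨x, hx, hxw⟩ := mem_realSpectrum_of_mem_spectrum hsa hw hw0
      by_cases hxI : x ∈ Icc a b
      · refine Or.inl ⟨?_, x, hxI, hxw⟩
        change ‖d w‖ ≤ ρ * ‖w‖
        rw [hdw w x hw0 hxw]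
        gcongr
        rw [abs_le]
        constructor <;> rw [hc, hρ] <;> linarith [hxI.1, hxI.2]
      · refine Or.inr (Or.inr ⟨?_, hw0, x, hxI, hxw⟩)
        change (ρ + γ) * ‖w‖ ≤ ‖d w‖
        rw [hdw w x hw0 hxw]
        gcongr
        exact half_length_add_gap_le hab hx hxI
  have hσ' : ∀ w ∈ spectrum ℂ A, w ∈ C₁ ∪ C₂ := fun w hw => by
    rcases hσ w hw with h1 | h1 | h1
    · exact Or.inl h1.1
    · exact Or.inr h1.1
    · exact Or.inr h1.1
  let glue : (ℂ → ℂ) → (ℂ → ℂ) → ℂ → ℂ := fun f₁ f₂ w => if w ∈ C₁ then f₁ w else f₂ w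
  have hcont : ∀ {f₁ f₂ : ℂ → ℂ}, ContinuousOn f₁ C₁ → ContinuousOn f₂ C₂ →
      ContinuousOn (glue f₁ f₂) (spectrum ℂ A) := by
    intro f₁ f₂ h1 h2
    refine ContinuousOn.mono (ContinuousOn.union_of_isClosed ?_ ?_ hC₁ hC₂) hσ'
    · exact h1.congr fun w hw => if_pos hw
    · exact h2.congr fun w hw => if_neg (hdisj w hw)
  have hinv : ContinuousOn (fun w : ℂ => Complex.I - w⁻¹) C₁ :=
    continuousOn_const.sub (continuousOn_inv₀.mono fun w hw => h1ne w hw)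
  have hdiv : ContinuousOn (fun w : ℂ => w / d w) C₂ :=
    continuousOn_id.div hd.continuousOn h2ne
  -- In the variable `x`, the functions `F`, `G` and `K` are `1_I(x)`, `x 1_I(x)` and `(1 - 1_I(x))
  -- / (x - c)`. They are continuous on the spectrum since `C₁` and `C₂` are closed and disjoint.
  set F := glue (fun _ => 1) (fun _ => 0) with hF
  set G := glue (fun w => Complex.I - w⁻¹) (fun _ => 0) with hG
  set K := glue (fun _ => 0) (fun w => w / d w) with hK
  have cF : ContinuousOn F (spectrum ℂ A) := hcont continuousOn_const continuousOn_const
  have cG : ContinuousOn G (spectrum ℂ A) := hcont hinv continuousOn_const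
  have cK : ContinuousOn K (spectrum ℂ A) := hcont continuousOn_const hdiv
  have cF' : ∀ z : ℂ, ContinuousOn (fun w => z • F w) (spectrum ℂ A) := fun z => cF.const_smul z
  have cK' : ∀ z : ℂ, ContinuousOn (fun w => z • K w) (spectrum ℂ A) := fun z => cK.const_smul z
  have gl1 : ∀ {f₁ f₂ : ℂ → ℂ} {w : ℂ}, w ∈ C₁ → glue f₁ f₂ w = f₁ w := fun hw => if_pos hw
  have gl2 : ∀ {f₁ f₂ : ℂ → ℂ} {w : ℂ}, w ∈ C₂ → glue f₁ f₂ w = f₂ w := fun hw =>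
    if_neg (hdisj _ hw)
  have hKreal : ∀ (w : ℂ) (x : ℝ), w ≠ 0 → Complex.I - w⁻¹ = x → w / d w = ((x - c)⁻¹ : ℝ) := by
    intro w x hw hx
    have : d w = ((x - c : ℝ) : ℂ) * w := by
      simp only [d]
      push_cast
      rw [← hx]
      field_simp
      ring
    rw [this]
    push_cast
    rw [div_mul_cancel_right₀ hw]
  have hA : A = cfc (fun w : ℂ => w) A := (cfc_id' ℂ A).symm
  refine ⟨cfc F A, cfc G A, cfc K A, ?_, ?_, ?_, ?_, ?_, ?_, ?_, ?_, ?_, ?_, ?_, ?_⟩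
  · refine cfc_congr fun w hw => ?_
    rcases hσ w hw with ⟨h1, x, hx, hxw⟩ | ⟨h1, h2⟩ | ⟨h1, h0, x, hx, hxw⟩
    · simp only [hF, gl1 h1, hxw]
      rw [indicator_of_mem]
      exact ⟨x, hx, rfl⟩
    · subst h2
      simp only [hF, gl2 h1]
      refine indicator_of_notMem ?_ _
      rintro ⟨x, -, hx⟩
      have := congrArg Complex.im hx
      simp at this
    · simp only [hF, gl2 h1, hxw]
      refine indicator_of_notMem ?_ _
      rintro ⟨y, hy, hyx⟩
      have : y = x := by exact_mod_cast hyx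
      exact hx (this ▸ hy)
  · rw [← cfc_mul F F A cF cF]
    refine cfc_congr fun w hw => ?_
    rcases hσ' w hw with h1 | h1
    · simp only [hF, gl1 h1, mul_one]
    · simp only [hF, gl2 h1, mul_zero]
  · rw [← cfc_star]
    refine cfc_congr fun w hw => ?_
    rcases hσ' w hw with h1 | h1
    · simp only [hF, gl1 h1, star_one]
    · simp only [hF, gl2 h1, star_zero]
  · rw [← cfc_star]
    refine cfc_congr fun w hw => ?_
    rcases hσ w hw with ⟨h1, x, hx, hxw⟩ | ⟨h1, h2⟩ | ⟨h1, h0, x, hx, hxw⟩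
    · simp only [hG, gl1 h1, hxw]
      exact Complex.conj_ofReal x
    · simp only [hG, gl2 h1, star_zero]
    · simp only [hG, gl2 h1, star_zero]
  · rw [← cfc_star]
    refine cfc_congr fun w hw => ?_
    rcases hσ w hw with ⟨h1, x, hx, hxw⟩ | ⟨h1, h2⟩ | ⟨h1, h0, x, hx, hxw⟩
    · simp only [hK, gl1 h1, star_zero]
    · subst h2
      simp only [hK, gl2 h1, zero_div, star_zero]
    · simp only [hK, gl2 h1, hKreal w x h0 hxw]
      exact Complex.conj_ofReal _
  · rw [← cfc_mul G F A cG cF]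
    refine cfc_congr fun w hw => ?_
    rcases hσ' w hw with h1 | h1
    · simp only [hF, hG, gl1 h1, mul_one]
    · simp only [hF, hG, gl2 h1, mul_zero]
  · rw [← cfc_mul F K A cF cK, ← cfc_const_zero ℂ A]
    refine cfc_congr fun w hw => ?_
    rcases hσ' w hw with h1 | h1
    · simp only [hF, hK, gl1 h1, mul_zero]
    · simp only [hF, hK, gl2 h1, zero_mul]
  · refine norm_cfc_le (by linarith) fun w hw => ?_
    rcases hσ w hw with ⟨h1, x, hx, hxw⟩ | ⟨h1, h2⟩ | ⟨h1, h0, x, hx, hxw⟩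
    · simp only [hG, gl1 h1, hxw, Complex.norm_real, Real.norm_eq_abs]
      rw [abs_of_nonneg (ha.trans hx.1)]
      exact hx.2
    · simp only [hG, gl2 h1, norm_zero]; linarith
    · simp only [hG, gl2 h1, norm_zero]; linarith
  · rw [← cfc_smul (c : ℂ) F A cF, ← cfc_sub G (fun w => (c : ℂ) • F w) A cG (cF' _)]
    refine norm_cfc_le hρ0 fun w hw => ?_
    rcases hσ w hw with ⟨h1, x, hx, hxw⟩ | ⟨h1, h2⟩ | ⟨h1, h0, x, hx, hxw⟩
    · simp only [hF, hG, gl1 h1, hxw, smul_eq_mul, mul_one]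
      rw [← Complex.ofReal_sub, Complex.norm_real, Real.norm_eq_abs, abs_le]
      constructor <;> rw [hc, hρ] <;> linarith [hx.1, hx.2]
    · simp only [hF, hG, gl2 h1, smul_zero, sub_zero, norm_zero, hρ0]
    · simp only [hF, hG, gl2 h1, smul_zero, sub_zero, norm_zero, hρ0]
  · refine norm_cfc_le (by positivity) fun w hw => ?_
    rcases hσ' w hw with h1 | h1
    · simp only [hK, gl1 h1, norm_zero]
      positivity
    · simp only [hK, gl2 h1, norm_div]
      rw [div_le_iff₀ (norm_pos_iff.2 (h2ne w h1)), inv_mul_eq_div, le_div_iff₀ (by linarith),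
        mul_comm]
      exact h1
  · refine exists_apply_eq_of_mul_sub hsa ?_
    rw [← hAdef, ← cfc_smul Complex.I F A cF,
      ← cfc_sub (fun w => Complex.I • F w) G A (cF' _) cG]
    nth_rewrite 1 [hA]
    rw [← cfc_mul (fun w => w) (fun w => Complex.I • F w - G w) A continuousOn_id
      ((cF' _).sub cG)]
    refine cfc_congr fun w hw => ?_
    rcases hσ' w hw with h1 | h1
    · simp only [hF, hG, gl1 h1, smul_eq_mul]
      have := h1ne w h1
      field_simp
      ring
    · simp only [hF, hG, gl2 h1, smul_zero, sub_zero, mul_zero]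
  · intro φ
    have key : A * (Complex.I • cfc K A - (1 - cfc F A + (c : ℂ) • cfc K A)) = cfc K A := by
      rw [← cfc_const_one ℂ A, ← cfc_sub (fun _ => (1 : ℂ)) F A continuousOn_const cF,
        ← cfc_smul Complex.I K A cK, ← cfc_smul (c : ℂ) K A cK,
        ← cfc_add A (fun w => 1 - F w) (fun w => (c : ℂ) • K w)
          (continuousOn_const.sub cF) (cK' _),
        ← cfc_sub (fun w => Complex.I • K w) (fun w => 1 - F w + (c : ℂ) • K w) A
          (cK' _) ((continuousOn_const.sub cF).add (cK' _))]
      nth_rewrite 1 [hA]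
      rw [← cfc_mul (fun w => w) (fun w => Complex.I • K w - (1 - F w + (c : ℂ) • K w)) A
        continuousOn_id ((cK' _).sub ((continuousOn_const.sub cF).add (cK' _)))]
      refine cfc_congr fun w hw => ?_
      rcases hσ' w hw with h1 | h1
      · simp only [hF, hK, gl1 h1, smul_zero, sub_self, add_zero, mul_zero]
      · simp only [hF, hK, gl2 h1, smul_eq_mul, sub_zero]
        have h3 := h2ne w h1
        have h4 : d w = (Complex.I - c) * w - 1 := rfl
        field_simp
        rw [h4]
        ring
    obtain ⟨h1, h2⟩ := exists_apply_eq_of_mul_sub hsa key φ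
    exact ⟨h1, h2⟩

end UnboundedOp

/-! ### The Sylvester equation: a priori bound and existence. -/

section Sylvester

variable {E : Type*} [NormedAddCommGroup E] [InnerProductSpace ℂ E] [CompleteSpace E]

theorem norm_le_one_of_star_eq_of_mul_self {P : E →L[ℂ] E} (h1 : star P = P) (h2 : P * P = P) :
    ‖P‖ ≤ 1 := by
  have h3 := CStarRing.norm_star_mul_self (x := P)
  rw [h1, h2] at h3
  rcases eq_or_lt_of_le (norm_nonneg P) with h4 | h4
  · rw [← h4]; norm_num
  · nlinarith

theorem norm_one_sub_le_one {P : E →L[ℂ] E} (h1 : star P = P) (h2 : P * P = P) :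
    ‖1 - P‖ ≤ 1 := by
  refine norm_le_one_of_star_eq_of_mul_self (by rw [star_sub, star_one, h1]) ?_
  rw [mul_sub, mul_one, sub_mul, one_mul, h2, sub_self, sub_zero]

omit [CompleteSpace E] in
theorem isCompactOperator_of_rank_eq {P : E →L[ℂ] E} {N : ℕ}
    (h : LinearMap.rank (P : E →ₗ[ℂ] E) = (N : Cardinal)) : IsCompactOperator P := by
  have hfin : FiniteDimensional ℂ (LinearMap.range (P : E →ₗ[ℂ] E)) := by
    refine Module.rank_lt_aleph0_iff.1 ?_
    have : Module.rank ℂ (LinearMap.range (P : E →ₗ[ℂ] E)) = (N : Cardinal) := h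
    rw [this]
    exact Cardinal.natCast_lt_aleph0
  have : ProperSpace (LinearMap.range (P : E →ₗ[ℂ] E)) := FiniteDimensional.proper ℂ _
  let P₁ : E →L[ℂ] LinearMap.range (P : E →ₗ[ℂ] E) :=
    P.codRestrict _ (fun x => LinearMap.mem_range_self _ x)
  have hP₁ : IsCompactOperator P₁ := isCompactOperator_of_locallyCompactSpace_dom P₁
  exact hP₁.clm_comp (LinearMap.range (P : E →ₗ[ℂ] E)).subtypeL

/-- A-priori bound for the Sylvester equation. -/
theorem sylvester_apriori {R P m' P' X Y : E →L[ℂ] E} {c : ℂ} {κ₀ κ₁ : ℝ} (hκ₁ : 0 < κ₁)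
    (hlow : ∀ ψ, P (R ψ) = 0 → κ₁ * ‖R ψ‖ ≤ ‖ψ - c • R ψ‖) (hκ₀ : ‖m' - c • P'‖ ≤ κ₀)
    (h1 : X = R * Y) (h2 : P * X = 0) (h3 : X * P' = X) :
    (κ₁ - κ₀) * ‖X‖ ≤ ‖Y - X * m'‖ := by
  -- `Y` plays the role of `H X`; as `X` takes values in the kernel of `P`, `H - c` is bounded below
  -- by `κ₁` there.
  have h4 : ‖X‖ ≤ κ₁⁻¹ * ‖Y - c • X‖ := by
    refine ContinuousLinearMap.opNorm_le_bound _ (by positivity) fun φ => ?_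
    have hX : X φ = R (Y φ) := by rw [h1]; rfl
    have h5 : P (R (Y φ)) = 0 := by
      rw [← hX]
      exact congrArg (fun A : E →L[ℂ] E => A φ) h2
    have h6 := hlow _ h5
    rw [← hX] at h6
    have h7 : ‖Y φ - c • X φ‖ ≤ ‖Y - c • X‖ * ‖φ‖ := (Y - c • X).le_opNorm φ
    rw [mul_assoc, inv_mul_eq_div, le_div_iff₀ hκ₁]
    linarith
  -- On the right, replacing `m'` by `c P'` costs at most `κ₀ ‖X‖`, which is absorbed because only
  -- the margin `κ₁ - κ₀` is claimed.
  have h5 : Y - c • X = (Y - X * m') + X * (m' - c • P') := by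
    rw [mul_sub, mul_smul_comm, h3]; abel
  have h6 : ‖Y - c • X‖ ≤ ‖Y - X * m'‖ + ‖X‖ * κ₀ := by
    rw [h5]
    refine (norm_add_le _ _).trans (add_le_add le_rfl ((norm_mul_le _ _).trans ?_))
    gcongr
  rw [inv_mul_eq_div, le_div_iff₀ hκ₁] at h4
  linarith

/-- Solution of the Sylvester equation. -/
theorem exists_sylvester {R P m Sr : E →L[ℂ] E} {c : ℂ} {ρ κ : ℝ}
    (hm : ‖m - c • P‖ ≤ ρ) (hSr : ‖Sr‖ ≤ κ⁻¹) (hκ : 0 < κ) (hρκ : ρ < κ)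
    (hPP : P * P = P) (hmP : m * P = m) (hPS : P * Sr = 0) (hS : Sr = R * (1 - P + c • Sr)) :
    ∃ Z : (E →L[ℂ] E) →L[ℂ] (E →L[ℂ] E), ∀ B, P * Z B = 0 ∧ Z B * P = Z B ∧
      Z B = R * ((1 - P) * B * P + Z B * m) := by
  set K := m - c • P with hK
  -- Shifting both blocks by `c` turns the equation into the fixed point `X = Sr (X K + B P)`. The
  -- linear part `T` has norm at most `ρ / κ < 1`.
  let T : (E →L[ℂ] E) →L[ℂ] (E →L[ℂ] E) :=
    (ContinuousLinearMap.mul ℂ (E →L[ℂ] E) Sr).comp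
      ((ContinuousLinearMap.mul ℂ (E →L[ℂ] E)).flip K)
  have hT : ∀ X, T X = Sr * (X * K) := fun X => rfl
  have hTn : ‖T‖ < 1 := by
    have h1 : ‖T‖ ≤ κ⁻¹ * ρ := by
      have hρ : 0 ≤ ρ := (norm_nonneg _).trans hm
      refine ContinuousLinearMap.opNorm_le_bound _ (by positivity) fun X => ?_
      rw [hT]
      calc ‖Sr * (X * K)‖ ≤ ‖Sr‖ * (‖X‖ * ‖K‖) :=
            (norm_mul_le _ _).trans (mul_le_mul_of_nonneg_left (norm_mul_le _ _) (norm_nonneg _))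
        _ ≤ κ⁻¹ * (‖X‖ * ρ) := by gcongr
        _ = κ⁻¹ * ρ * ‖X‖ := by ring
    refine lt_of_le_of_lt h1 ?_
    rw [inv_mul_eq_div, div_lt_one hκ]
    exact hρκ
  let U := Units.oneSub T hTn
  let L : (E →L[ℂ] E) →L[ℂ] (E →L[ℂ] E) :=
    (ContinuousLinearMap.mul ℂ (E →L[ℂ] E) Sr).comp
      ((ContinuousLinearMap.mul ℂ (E →L[ℂ] E)).flip P)
  have hL : ∀ X, L X = Sr * (X * P) := fun X => rfl
  refine ⟨(↑U⁻¹ : (E →L[ℂ] E) →L[ℂ] (E →L[ℂ] E)) * L, fun B => ?_⟩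
  set X := ((↑U⁻¹ : (E →L[ℂ] E) →L[ℂ] (E →L[ℂ] E)) * L) B with hX
  have hfix : X = Sr * (X * K + B * P) := by
    have h1 : (↑U : (E →L[ℂ] E) →L[ℂ] (E →L[ℂ] E)) X = L B := by
      have h2 : (↑U : (E →L[ℂ] E) →L[ℂ] (E →L[ℂ] E)) *
          ((↑U⁻¹ : (E →L[ℂ] E) →L[ℂ] (E →L[ℂ] E)) * L) = L := by
        rw [← mul_assoc, Units.mul_inv, one_mul]
      exact congrArg (fun A : (E →L[ℂ] E) →L[ℂ] (E →L[ℂ] E) => A B) h2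
    have h3 : X - T X = L B := h1
    rw [hT, hL, sub_eq_iff_eq_add'] at h3
    rw [mul_add]
    exact h3
  have hPX : P * X = 0 := by rw [hfix, ← mul_assoc, hPS, zero_mul]
  have hKP : K * P = K := by rw [hK, sub_mul, smul_mul_assoc, hmP, hPP]
  have hXP : X * P = X := by
    conv_lhs => rw [hfix]
    rw [mul_assoc, add_mul, mul_assoc, hKP, mul_assoc, hPP, ← hfix]
  refine ⟨hPX, hXP, ?_⟩
  have h1 : X = R * ((1 - P) * (X * K + B * P) + c • X) := by
    conv_lhs => rw [hfix, hS]
    conv_rhs => rw [hfix, ← hfix]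
    rw [mul_assoc, add_mul, smul_mul_assoc, ← hfix]
  conv_lhs => rw [h1]
  congr 1
  rw [mul_add, ← mul_assoc (1 - P) X K, sub_mul 1 P X, hPX, one_mul, sub_zero, hK, mul_sub,
    mul_smul_comm, hXP, mul_assoc]
  abel

end Sylvester

/-! ### Abstract spectral families and stability of the gap. -/

theorem tendsto_abs_sub_nhdsWithin (S : Set ℝ) (s : ℝ) : Tendsto (fun t => |t - s|) (𝓝[S] s) (𝓝 0) := by
  have : Tendsto (fun t => |t - s|) (𝓝 s) (𝓝 |s - s|) := by
    apply Continuous.tendsto; fun_prop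
  simpa using this.mono_left nhdsWithin_le_nhds

/-- The bounded operators attached to a family of self-adjoint operators `H(s)`, `s ∈ S`:
`R = H⁻¹`, `T i = H^{(i)} H⁻¹`, `W t s = H(t) H(s)⁻¹`, the spectral projector `P` of an interval of
centre `c` and half-length `ρ` at distance `g` from the rest of the spectrum, `m = H P`, and the
reduced resolvent `Sr = (1 - P) (H - c)⁻¹`. -/
structure SpectralFamily (E : Type*) [NormedAddCommGroup E] [InnerProductSpace ℂ E]
    [CompleteSpace E] (n : ℕ) (α : ℕ → ℝ) (M : ℝ) (N : ℕ) (S : Set ℝ) where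
  R : ℝ → E →L[ℂ] E
  P : ℝ → E →L[ℂ] E
  m : ℝ → E →L[ℂ] E
  Sr : ℝ → E →L[ℂ] E
  T : ℕ → ℝ → E →L[ℂ] E
  W : ℝ → ℝ → E →L[ℂ] E
  c : ℝ → ℝ
  ρ : ℝ → ℝ
  g : ℝ → ℝ
  convex : Convex ℝ S
  uniqueDiff : UniqueDiffOn ℝ S
  one_le : 1 ≤ n
  α_nonneg : ∀ i, 0 ≤ α i
  M_nonneg : 0 ≤ M
  g_pos : ∀ s ∈ S, 0 < g s
  g_le_one : ∀ s ∈ S, g s ≤ 1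
  ρ_nonneg : ∀ s ∈ S, 0 ≤ ρ s
  c_cont : ContinuousOn c S
  ρ_cont : ContinuousOn ρ S
  norm_R : ∀ s ∈ S, ‖R s‖ ≤ 1
  star_R : ∀ s ∈ S, star (R s) = R s
  R_inj : ∀ s ∈ S, Function.Injective (R s)
  R_mul_W : ∀ s ∈ S, ∀ t ∈ S, R t * W t s = R s
  hasDerivWithinAt_W : ∀ s ∈ S, ∀ φ, HasDerivWithinAt (fun t => W t s φ) (T 1 s φ) S s
  norm_W : ∀ s ∈ S, ∀ t ∈ S, α 1 * |t - s| ≤ 1 / 2 → ‖W t s - 1‖ ≤ 2 * α 1 * |t - s|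
  hasDerivWithinAt_R : ∀ s ∈ S, ∀ φ, HasDerivWithinAt (fun t => R t φ) (-(R s (T 1 s φ))) S s
  norm_T : ∀ i, 1 ≤ i → i ≤ n → ∀ s ∈ S, ‖T i s‖ ≤ α i
  hasDerivWithinAt_T : ∀ i, 1 ≤ i → i < n → ∀ s ∈ S, ∀ φ,
    HasDerivWithinAt (fun t => T i t φ) (T (i + 1) s φ - T i s (T 1 s φ)) S s
  T_cont : ∀ φ, ContinuousOn (fun t => T n t φ) S
  P_mul_P : ∀ s ∈ S, P s * P s = P s
  star_P : ∀ s ∈ S, star (P s) = P s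
  star_m : ∀ s ∈ S, star (m s) = m s
  star_Sr : ∀ s ∈ S, star (Sr s) = Sr s
  m_mul_P : ∀ s ∈ S, m s * P s = m s
  P_mul_Sr : ∀ s ∈ S, P s * Sr s = 0
  norm_m : ∀ s ∈ S, ‖m s‖ ≤ M
  norm_m_sub : ∀ s ∈ S, ‖m s - (c s : ℂ) • P s‖ ≤ ρ s
  norm_Sr : ∀ s ∈ S, ‖Sr s‖ ≤ (ρ s + g s)⁻¹
  R_mul_m : ∀ s ∈ S, R s * m s = P s
  Sr_eq : ∀ s ∈ S, Sr s = R s * (1 - P s + (c s : ℂ) • Sr s)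
  rank_P : ∀ s ∈ S, LinearMap.rank (P s : E →ₗ[ℂ] E) = (N : Cardinal)

namespace SpectralFamily

variable {E : Type*} [NormedAddCommGroup E] [InnerProductSpace ℂ E] [CompleteSpace E]
  {n : ℕ} {α : ℕ → ℝ} {M : ℝ} {N : ℕ} {S : Set ℝ} (F : SpectralFamily E n α M N S) {s t : ℝ}

include F

theorem P_mul_m (hs : s ∈ S) : F.P s * F.m s = F.m s := by
  have := congrArg star (F.m_mul_P s hs)
  rwa [star_mul, F.star_P s hs, F.star_m s hs] at this

theorem m_mul_R (hs : s ∈ S) : F.m s * F.R s = F.P s := by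
  have := congrArg star (F.R_mul_m s hs)
  rwa [star_mul, F.star_P s hs, F.star_m s hs, F.star_R s hs] at this

theorem P_mul_R (hs : s ∈ S) : F.P s * F.R s = F.R s * F.P s := by
  conv_lhs => rw [← F.R_mul_m s hs, mul_assoc, F.m_mul_R hs]

theorem norm_P (hs : s ∈ S) : ‖F.P s‖ ≤ 1 :=
  norm_le_one_of_star_eq_of_mul_self (F.star_P s hs) (F.P_mul_P s hs)

theorem norm_Q (hs : s ∈ S) : ‖1 - F.P s‖ ≤ 1 :=
  norm_one_sub_le_one (F.star_P s hs) (F.P_mul_P s hs)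

theorem isCompactOperator_P (hs : s ∈ S) : IsCompactOperator (F.P s) :=
  isCompactOperator_of_rank_eq (F.rank_P s hs)

theorem isCompactOperator_of_mul_P {A : E →L[ℂ] E} (hs : s ∈ S) (hA : A * F.P s = A) :
    IsCompactOperator A := by
  rw [← hA]
  exact (F.isCompactOperator_P hs).clm_comp A

theorem mul_cancel {A B : E →L[ℂ] E} (hs : s ∈ S) (h : F.R s * A = F.R s * B) : A = B := by
  ext φ
  exact F.R_inj s hs (congrArg (fun A : E →L[ℂ] E => A φ) h)

theorem W_self (hs : s ∈ S) : F.W s s = 1 :=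
  F.mul_cancel hs (by rw [F.R_mul_W s hs s hs, mul_one])

theorem W_mul_W (hs : s ∈ S) (ht : t ∈ S) : F.W t s * F.W s t = 1 :=
  F.mul_cancel ht (by rw [← mul_assoc, F.R_mul_W s hs t ht, F.R_mul_W t ht s hs, mul_one])

/-- On vectors killed by `P`, the reduced resolvent `Sr` inverts `H - c` from the left, so the lower
bound is the inverse of the bound on `‖Sr‖`. -/
theorem lower_bound (hs : s ∈ S) (ψ : E) (hψ : F.P s (F.R s ψ) = 0) :
    (F.ρ s + F.g s) * ‖F.R s ψ‖ ≤ ‖ψ - (F.c s : ℂ) • F.R s ψ‖ := by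
  have hpos : 0 < F.ρ s + F.g s := add_pos_of_nonneg_of_pos (F.ρ_nonneg s hs) (F.g_pos s hs)
  have h1 := congrArg star (F.Sr_eq s hs)
  rw [star_mul, F.star_Sr s hs, F.star_R s hs, star_add, star_sub, star_one, F.star_P s hs,
    star_smul, F.star_Sr s hs] at h1
  have h2 : F.Sr s ψ = F.R s ψ + (F.c s : ℂ) • F.Sr s (F.R s ψ) := by
    conv_lhs => rw [h1]
    have hc : star (F.c s : ℂ) = F.c s := Complex.conj_ofReal _
    simp [hψ, hc]
  have h3 : F.Sr s (ψ - (F.c s : ℂ) • F.R s ψ) = F.R s ψ := by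
    rw [map_sub, map_smul, h2]; abel
  have h4 := (F.Sr s).le_of_opNorm_le (F.norm_Sr s hs) (ψ - (F.c s : ℂ) • F.R s ψ)
  rwa [h3, inv_mul_eq_div, le_div_iff₀ hpos, mul_comm] at h4

theorem eventually_norm_W_le (hs : s ∈ S) : ∀ᶠ t in 𝓝[S] s,
    ‖F.W t s - 1‖ ≤ 2 * α 1 * |t - s| ∧ ‖F.W s t - 1‖ ≤ 2 * α 1 * |t - s| := by
  have h1 : Tendsto (fun t => α 1 * |t - s|) (𝓝[S] s) (𝓝 (α 1 * 0)) :=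
    (tendsto_abs_sub_nhdsWithin S s).const_mul _
  rw [mul_zero] at h1
  filter_upwards [self_mem_nhdsWithin, h1.eventually (ge_mem_nhds (by norm_num : (0 : ℝ) < 1 / 2))]
    with t ht h2
  refine ⟨F.norm_W s hs t ht h2, ?_⟩
  have h3 := F.norm_W t ht s hs (by rwa [abs_sub_comm])
  rwa [abs_sub_comm s t] at h3

theorem tendsto_norm_W (hs : s ∈ S) :
    Tendsto (fun t => F.W t s) (𝓝[S] s) (𝓝 1) := by
  rw [tendsto_iff_norm_sub_tendsto_zero]
  have h1 : Tendsto (fun t => 2 * α 1 * |t - s|) (𝓝[S] s) (𝓝 (2 * α 1 * 0)) :=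
    (tendsto_abs_sub_nhdsWithin S s).const_mul _
  rw [mul_zero] at h1
  exact squeeze_zero' (Eventually.of_forall fun _ => norm_nonneg _)
    ((F.eventually_norm_W_le hs).mono fun t h => h.1) h1

/-- `H(t)` is a relatively small perturbation of `H(s)`, since `W t s` is close to `1`. The vectors
are those killed by the old projector `P s`, while the operator is the new one. -/
theorem lower_bound_of_near (hs : s ∈ S) : ∀ᶠ t in 𝓝[S] s, ∀ ψ, F.P s (F.R t ψ) = 0 →
    (F.ρ s + F.g s / 2) * ‖F.R t ψ‖ ≤ ‖ψ - (F.c s : ℂ) • F.R t ψ‖ := by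
  have hg := F.g_pos s hs
  have hρ := F.ρ_nonneg s hs
  -- The perturbation lowers the bound `(ρ + g) ‖χ‖` by at most `η C ‖χ‖`, and `η C ≤ g / 2` for `t`
  -- close to `s`.
  set C := F.ρ s + F.g s + |F.c s| with hC
  have hCpos : 0 < C := by positivity
  have h1 : Tendsto (fun t => 2 * α 1 * |t - s|) (𝓝[S] s) (𝓝 (2 * α 1 * 0)) :=
    (tendsto_abs_sub_nhdsWithin S s).const_mul _
  rw [mul_zero] at h1
  filter_upwards [self_mem_nhdsWithin, F.eventually_norm_W_le hs,
    h1.eventually (ge_mem_nhds (by positivity : 0 < F.g s / (2 * C))),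
    h1.eventually (ge_mem_nhds (by norm_num : (0 : ℝ) < 1))] with t ht hW hη hη1 ψ hψ
  set η := 2 * α 1 * |t - s| with hηdef
  set χ := F.R t ψ with hχ
  set ψ' := F.W s t ψ with hψ'
  have hχ' : F.R s ψ' = χ := congrArg (fun A : E →L[ℂ] E => A ψ) (F.R_mul_W t ht s hs)
  have hψW : F.W t s ψ' = ψ := congrArg (fun A : E →L[ℂ] E => A ψ) (F.W_mul_W hs ht)
  have h2 := F.lower_bound hs ψ' (by rw [hχ']; exact hψ)
  rw [hχ'] at h2
  have h3 : ‖ψ - ψ'‖ ≤ η * ‖ψ'‖ := by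
    have := (F.W t s - 1).le_of_opNorm_le hW.1 ψ'
    rwa [sub_apply, hψW, one_apply_eq_self] at this
  have h4 : ‖ψ'‖ ≤ ‖ψ' - (F.c s : ℂ) • χ‖ + |F.c s| * ‖χ‖ := by
    have := norm_add_le (ψ' - (F.c s : ℂ) • χ) ((F.c s : ℂ) • χ)
    rwa [sub_add_cancel, norm_smul, Complex.norm_real, Real.norm_eq_abs] at this
  have h5 : ‖ψ' - (F.c s : ℂ) • χ‖ ≤ ‖ψ - (F.c s : ℂ) • χ‖ + ‖ψ - ψ'‖ := by
    have := norm_sub_le (ψ - (F.c s : ℂ) • χ) (ψ - ψ')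
    rwa [show ψ - (F.c s : ℂ) • χ - (ψ - ψ') = ψ' - (F.c s : ℂ) • χ by abel] at this
  have hη0 : 0 ≤ η := (norm_nonneg _).trans hW.1
  have h6 : η * C ≤ F.g s / 2 := by
    rw [le_div_iff₀ (by positivity)] at hη
    linarith
  have h7 := norm_nonneg χ
  have h8 : (1 - η) * ((F.ρ s + F.g s) * ‖χ‖) ≤ (1 - η) * ‖ψ' - (F.c s : ℂ) • χ‖ :=
    mul_le_mul_of_nonneg_left h2 (by linarith)
  have h9 : η * ‖ψ'‖ ≤ η * (‖ψ' - (F.c s : ℂ) • χ‖ + |F.c s| * ‖χ‖) :=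
    mul_le_mul_of_nonneg_left h4 hη0
  have h10 : η * C * ‖χ‖ ≤ F.g s / 2 * ‖χ‖ := mul_le_mul_of_nonneg_right h6 h7
  rw [hC] at h10
  nlinarith

theorem eventually_norm_m_sub_le (hs : s ∈ S) : ∀ᶠ t in 𝓝[S] s,
    ‖F.m t - (F.c s : ℂ) • F.P t‖ ≤ F.ρ s + F.g s / 4 := by
  have hg := F.g_pos s hs
  have hc := (Metric.tendsto_nhds.1 (F.c_cont s hs)) (F.g s / 8) (by positivity)
  have hρ := (Metric.tendsto_nhds.1 (F.ρ_cont s hs)) (F.g s / 8) (by positivity)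
  filter_upwards [self_mem_nhdsWithin, hc, hρ] with t ht h1 h2
  rw [Real.dist_eq] at h1 h2
  have h3 : F.m t - (F.c s : ℂ) • F.P t
      = (F.m t - (F.c t : ℂ) • F.P t) + ((F.c t - F.c s : ℝ) : ℂ) • F.P t := by
    push_cast
    rw [sub_smul]; abel
  rw [h3]
  have h4 : ‖((F.c t - F.c s : ℝ) : ℂ) • F.P t‖ ≤ F.g s / 8 * 1 := by
    rw [norm_smul, Complex.norm_real, Real.norm_eq_abs]
    exact mul_le_mul h1.le (F.norm_P ht) (norm_nonneg _) (by positivity)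
  have h5 := norm_add_le (F.m t - (F.c t : ℂ) • F.P t) (((F.c t - F.c s : ℝ) : ℂ) • F.P t)
  have h6 := F.norm_m_sub t ht
  have h7 := (abs_lt.1 h2).2
  linarith

/-- Stability of the spectral gap: since the rank of `P` is constant, a min-max argument shows that
no spectrum enters the gap for parameters close to `s`. -/
theorem lower_bound_stable (hs : s ∈ S) : ∀ᶠ t in 𝓝[S] s, ∀ ψ, F.P t (F.R t ψ) = 0 →
    (F.ρ s + F.g s / 2) * ‖F.R t ψ‖ ≤ ‖ψ - (F.c s : ℂ) • F.R t ψ‖ := by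
  filter_upwards [self_mem_nhdsWithin, F.lower_bound_of_near hs, F.eventually_norm_m_sub_le hs]
    with t ht hnear hm ψ hψ
  have hg := F.g_pos s hs
  have hρ := F.ρ_nonneg s hs
  by_contra! hlt
  set φ := F.R t ψ with hφ
  set c : ℂ := (F.c s : ℂ) with hc
  have hPP : ∀ x, F.P t (F.P t x) = F.P t x := fun x =>
    congrArg (fun A : E →L[ℂ] E => A x) (F.P_mul_P t ht)
  have hfin : ∀ u ∈ S, FiniteDimensional ℂ (LinearMap.range (F.P u : E →ₗ[ℂ] E)) := fun u hu => by
    refine Module.rank_lt_aleph0_iff.1 ?_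
    have : Module.rank ℂ (LinearMap.range (F.P u : E →ₗ[ℂ] E)) = (N : Cardinal) := F.rank_P u hu
    rw [this]
    exact Cardinal.natCast_lt_aleph0
  have hfr : ∀ u ∈ S, Module.finrank ℂ (LinearMap.range (F.P u : E →ₗ[ℂ] E)) = N := fun u hu =>
    Module.finrank_eq_of_rank_eq (F.rank_P u hu)
  have hf1 := hfin s hs
  have hf2 := hfin t ht
  -- The range of `P t` together with a violating vector `φ` has dimension `N + 1`, one more than
  -- the range of `P s`. So some nonzero `p + a φ` is killed by `P s`, and `lower_bound_of_near`
  -- applies to it.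
  let f : (LinearMap.range (F.P t : E →ₗ[ℂ] E)) × ℂ →ₗ[ℂ] LinearMap.range (F.P s : E →ₗ[ℂ] E) :=
    ((F.P s : E →ₗ[ℂ] E).rangeRestrict).comp
      (LinearMap.coprod (LinearMap.range (F.P t : E →ₗ[ℂ] E)).subtype
        (LinearMap.toSpanSingleton ℂ E φ))
  have hf : ∀ p a, (f (p, a) : E) = F.P s ((p : E) + a • φ) := fun p a => by simp [f]
  have hker : LinearMap.ker f ≠ ⊥ := by
    refine LinearMap.ker_ne_bot_of_finrank_lt ?_
    rw [Module.finrank_prod, hfr s hs, hfr t ht, Module.finrank_self]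
    omega
  obtain ⟨⟨⟨p, hp⟩, a⟩, hx, hx0⟩ := Submodule.exists_mem_ne_zero_of_ne_bot hker
  have hx' : F.P s (p + a • φ) = 0 := by
    rw [← hf ⟨p, hp⟩ a, LinearMap.mem_ker.1 hx]; rfl
  have hpP : F.P t p = p := by
    obtain ⟨y, rfl⟩ := hp
    exact hPP y
  have hRm : F.R t (F.m t p) = p := by
    have := congrArg (fun A : E →L[ℂ] E => A p) (F.R_mul_m t ht)
    exact this.trans hpP
  have hχ : F.R t (F.m t p + a • ψ) = p + a • φ := by rw [map_add, map_smul, hRm]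
  have h1 := hnear (F.m t p + a • ψ) (by rw [hχ]; exact hx')
  rw [hχ] at h1
  have h2 : F.m t p + a • ψ - c • (p + a • φ) = (F.m t p - c • p) + a • (ψ - c • φ) := by
    module
  rw [h2] at h1
  have hadj : ∀ x y, inner ℂ (F.P t x) y = inner ℂ x (F.P t y) := fun x y => by
    have := F.star_P t ht
    rw [ContinuousLinearMap.star_eq_adjoint] at this
    conv_lhs => rw [← this]
    exact ContinuousLinearMap.adjoint_inner_left _ _ _
  have hPψ : F.P t ψ = 0 := by
    have h3 : F.m t (F.R t ψ) = F.P t ψ := congrArg (fun A : E →L[ℂ] E => A ψ) (F.m_mul_R ht)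
    have h4 : F.m t (F.P t (F.R t ψ)) = F.m t (F.R t ψ) :=
      congrArg (fun A : E →L[ℂ] E => A (F.R t ψ)) (F.m_mul_P t ht)
    rw [← h3, ← h4, hψ, map_zero]
  have hPmp : F.P t (F.m t p - c • p) = F.m t p - c • p := by
    have h3 : F.P t (F.m t p) = F.m t p := congrArg (fun A : E →L[ℂ] E => A p) (F.P_mul_m ht)
    rw [map_sub, map_smul, h3, hpP]
  -- By Pythagoras, `H(t) - c` expands `p + a φ` by less than `ρ + g / 2`: its factor is at most `ρ
  -- + g / 4` on `p` and less than `ρ + g / 2` on `φ`. This contradicts `lower_bound_of_near`.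
  have horth1 : inner ℂ (F.m t p - c • p) (a • (ψ - c • φ)) = 0 := by
    rw [← hPmp, hadj, map_smul, map_sub, map_smul, hPψ, hψ]
    simp
  have horth2 : inner ℂ p (a • φ) = 0 := by
    rw [← hpP, hadj, map_smul, hψ]
    simp
  have h3 := norm_add_sq_eq_norm_sq_add_norm_sq_of_inner_eq_zero _ _ horth1
  have h4 := norm_add_sq_eq_norm_sq_add_norm_sq_of_inner_eq_zero _ _ horth2
  have h5 : ‖F.m t p - c • p‖ ≤ (F.ρ s + F.g s / 4) * ‖p‖ := by
    have := (F.m t - c • F.P t).le_of_opNorm_le hm p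
    rwa [sub_apply, smul_apply, hpP] at this
  rw [norm_smul] at h3 h4
  set A := ‖F.m t p - c • p‖
  set B := ‖ψ - c • φ‖
  have h6 : (F.ρ s + F.g s / 2) * (F.ρ s + F.g s / 2) * (‖p‖ * ‖p‖ + ‖a‖ * ‖φ‖ * (‖a‖ * ‖φ‖))
      ≤ A * A + ‖a‖ * B * (‖a‖ * B) := by
    rw [← h3, ← h4]
    have := mul_self_le_mul_self (by positivity) h1
    linarith
  have h7 : A * A ≤ ((F.ρ s + F.g s / 4) * ‖p‖) * ((F.ρ s + F.g s / 4) * ‖p‖) :=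
    mul_self_le_mul_self (norm_nonneg _) h5
  have h8 : B * B < ((F.ρ s + F.g s / 2) * ‖φ‖) * ((F.ρ s + F.g s / 2) * ‖φ‖) :=
    mul_self_lt_mul_self (norm_nonneg _) hlt
  have h9 : (F.ρ s + F.g s / 4) * (F.ρ s + F.g s / 4)
      < (F.ρ s + F.g s / 2) * (F.ρ s + F.g s / 2) :=
    mul_self_lt_mul_self (by positivity) (by linarith)
  by_cases ha : a = 0
  · have hp0 : p ≠ 0 := by
      rintro rfl
      apply hx0
      rw [ha]
      rfl
    have h10 : 0 < ‖p‖ * ‖p‖ := by positivity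
    rw [ha, norm_zero] at h6
    nlinarith
  · have h10 : 0 < ‖a‖ * ‖a‖ := by positivity
    have h11 : 0 ≤ ‖p‖ * ‖p‖ := by positivity
    have h12 := mul_lt_mul_of_pos_left h8 h10
    have h13 := mul_le_mul_of_nonneg_right h9.le h11
    nlinarith

end SpectralFamily

/-! ### The Sylvester solution and the first derivatives of `P` and `H P`. -/

namespace SpectralFamily

variable {E : Type*} [NormedAddCommGroup E] [InnerProductSpace ℂ E] [CompleteSpace E]
  {n : ℕ} {α : ℕ → ℝ} {M : ℝ} {N : ℕ} {S : Set ℝ} (F : SpectralFamily E n α M N S) {s t : ℝ}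

theorem exists_Z (hs : s ∈ S) :
    ∃ Z : (E →L[ℂ] E) →L[ℂ] (E →L[ℂ] E), ∀ B, F.P s * Z B = 0 ∧ Z B * F.P s = Z B ∧
      Z B = F.R s * ((1 - F.P s) * B * F.P s + Z B * F.m s) :=
  exists_sylvester (F.norm_m_sub s hs) (F.norm_Sr s hs)
    (add_pos_of_nonneg_of_pos (F.ρ_nonneg s hs) (F.g_pos s hs))
    (lt_add_of_pos_right _ (F.g_pos s hs)) (F.P_mul_P s hs) (F.m_mul_P s hs) (F.P_mul_Sr s hs)
    (F.Sr_eq s hs)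

open Classical in
/-- The solution `Z` of the Sylvester equation `H Z - Z H = (1 - P) B P`, `Z = (1 - P) Z P`. -/
noncomputable def Z (s : ℝ) : (E →L[ℂ] E) →L[ℂ] (E →L[ℂ] E) :=
  if hs : s ∈ S then (F.exists_Z hs).choose else 0

/-- The product `H Z`. -/
noncomputable def Y (s : ℝ) (B : E →L[ℂ] E) : E →L[ℂ] E :=
  (1 - F.P s) * B * F.P s + F.Z s B * F.m s

include F

variable (A B : E →L[ℂ] E)

theorem P_mul_Z (hs : s ∈ S) : F.P s * F.Z s B = 0 := by
  rw [Z, dif_pos hs]; exact ((F.exists_Z hs).choose_spec B).1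

theorem Z_mul_P (hs : s ∈ S) : F.Z s B * F.P s = F.Z s B := by
  rw [Z, dif_pos hs]; exact ((F.exists_Z hs).choose_spec B).2.1

theorem R_mul_Y (hs : s ∈ S) : F.R s * F.Y s B = F.Z s B := by
  rw [Y, Z, dif_pos hs]; exact ((F.exists_Z hs).choose_spec B).2.2.symm

theorem Y_mul_P (hs : s ∈ S) : F.Y s B * F.P s = F.Y s B := by
  rw [Y, add_mul, mul_assoc _ (F.P s), F.P_mul_P s hs, mul_assoc _ (F.m s), F.m_mul_P s hs]

theorem Y_sub_Z_mul_m : F.Y s B - F.Z s B * F.m s = (1 - F.P s) * B * F.P s := by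
  rw [Y]; abel

theorem Q_mul_Q (hs : s ∈ S) : (1 - F.P s) * (1 - F.P s) = 1 - F.P s := by
  rw [mul_sub, mul_one, sub_mul, one_mul, F.P_mul_P s hs, sub_self, sub_zero]

theorem P_mul_Q (hs : s ∈ S) : F.P s * (1 - F.P s) = 0 := by
  rw [mul_sub, mul_one, F.P_mul_P s hs, sub_self]

theorem Q_mul_P (hs : s ∈ S) : (1 - F.P s) * F.P s = 0 := by
  rw [sub_mul, one_mul, F.P_mul_P s hs, sub_self]

theorem Q_mul_Z (hs : s ∈ S) : (1 - F.P s) * F.Z s B = F.Z s B := by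
  rw [sub_mul, one_mul, F.P_mul_Z B hs, sub_zero]

theorem norm_Q_mul_P_le (hs : s ∈ S) : ‖(1 - F.P s) * B * F.P s‖ ≤ ‖B‖ := by
  calc ‖(1 - F.P s) * B * F.P s‖ ≤ ‖1 - F.P s‖ * ‖B‖ * ‖F.P s‖ :=
        (norm_mul_le _ _).trans (mul_le_mul_of_nonneg_right (norm_mul_le _ _) (norm_nonneg _))
    _ ≤ 1 * ‖B‖ * 1 := by
        gcongr
        · exact F.norm_Q hs
        · exact F.norm_P hs
    _ = ‖B‖ := by ring

theorem norm_Z_apply_le (hs : s ∈ S) : ‖F.Z s B‖ ≤ ‖B‖ / F.g s := by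
  have h1 := sylvester_apriori (add_pos_of_nonneg_of_pos (F.ρ_nonneg s hs) (F.g_pos s hs))
    (F.lower_bound hs) (F.norm_m_sub s hs) (F.R_mul_Y B hs).symm (F.P_mul_Z B hs)
    (F.Z_mul_P B hs)
  rw [F.Y_sub_Z_mul_m B, add_sub_cancel_left] at h1
  rw [le_div_iff₀ (F.g_pos s hs), mul_comm]
  exact h1.trans (F.norm_Q_mul_P_le B hs)

/-- Uniqueness for the Sylvester equation. -/
theorem eq_Z_of_eq (hs : s ∈ S) {X Y : E →L[ℂ] E} (h1 : X = F.R s * Y) (h2 : F.P s * X = 0)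
    (h3 : X * F.P s = X) (h4 : Y - X * F.m s = (1 - F.P s) * B * F.P s) : X = F.Z s B := by
  have h5 := sylvester_apriori (X := X - F.Z s B) (Y := Y - F.Y s B)
    (add_pos_of_nonneg_of_pos (F.ρ_nonneg s hs) (F.g_pos s hs))
    (F.lower_bound hs) (F.norm_m_sub s hs) (by rw [mul_sub, F.R_mul_Y B hs, h1])
    (by rw [mul_sub, F.P_mul_Z B hs, h2, sub_zero]) (by rw [sub_mul, F.Z_mul_P B hs, h3])
  have h6 : Y - F.Y s B - (X - F.Z s B) * F.m s = 0 := by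
    rw [sub_mul, sub_sub_sub_comm, h4, F.Y_sub_Z_mul_m B, sub_self]
  rw [h6, norm_zero, add_sub_cancel_left] at h5
  have h7 : ‖X - F.Z s B‖ ≤ 0 := by nlinarith [F.g_pos s hs, norm_nonneg (X - F.Z s B)]
  exact sub_eq_zero.1 (norm_le_zero_iff.1 h7)

/-- The left factor lives at time `t` and the right one at time `s`. The margin is `(ρ + g / 2) -
ρ`. -/
theorem eventually_apriori (hs : s ∈ S) : ∀ᶠ t in 𝓝[S] s, ∀ X Y : E →L[ℂ] E,
    X = F.R t * Y → F.P t * X = 0 → X * F.P s = X → F.g s / 2 * ‖X‖ ≤ ‖Y - X * F.m s‖ := by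
  filter_upwards [F.lower_bound_stable hs] with t ht X Y h1 h2 h3
  have hg := F.g_pos s hs
  have hρ := F.ρ_nonneg s hs
  have := sylvester_apriori (by positivity) ht (F.norm_m_sub s hs) h1 h2 h3
  rwa [add_sub_cancel_left] at this

/-- The times are exchanged; the margin is `(ρ + g) - (ρ + g / 4)`, more than is needed. -/
theorem eventually_apriori' (hs : s ∈ S) : ∀ᶠ t in 𝓝[S] s, ∀ X Y : E →L[ℂ] E,
    X = F.R s * Y → F.P s * X = 0 → X * F.P t = X → F.g s / 2 * ‖X‖ ≤ ‖Y - X * F.m t‖ := by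
  filter_upwards [F.eventually_norm_m_sub_le hs] with t ht X Y h1 h2 h3
  have hg := F.g_pos s hs
  have := sylvester_apriori (add_pos_of_nonneg_of_pos (F.ρ_nonneg s hs) hg) (F.lower_bound hs) ht
    h1 h2 h3
  refine le_trans ?_ this
  gcongr
  linarith

/-- With both factors at time `t` but the centre frozen at time `s`, the margin is `(ρ + g / 2) - (ρ
+ g / 4) = g / 4`. -/
theorem eventually_norm_Z_le (hs : s ∈ S) : ∀ᶠ t in 𝓝[S] s, ‖F.Z t‖ ≤ 4 / F.g s := by
  have hg := F.g_pos s hs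
  have hρ := F.ρ_nonneg s hs
  filter_upwards [self_mem_nhdsWithin, F.lower_bound_stable hs, F.eventually_norm_m_sub_le hs]
    with t ht h1 h2
  refine ContinuousLinearMap.opNorm_le_bound _ (by positivity) fun B => ?_
  have h3 := sylvester_apriori (by positivity) h1 h2 (F.R_mul_Y B ht).symm (F.P_mul_Z B ht)
    (F.Z_mul_P B ht)
  rw [F.Y_sub_Z_mul_m B] at h3
  have h4 := h3.trans (F.norm_Q_mul_P_le B ht)
  rw [div_mul_eq_mul_div, le_div_iff₀ hg]
  linarith

/-- This exhibits `Q(t) P(s)` as `R(t)` times a bounded operator, as the mixed a priori bound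
requires; by `Q_mul_P_residual` the residual is then `O(|t - s|)`. -/
theorem Q_mul_P_eq (hs : s ∈ S) (ht : t ∈ S) :
    (1 - F.P t) * F.P s = F.R t * ((1 - F.P t) * (F.W t s * F.m s)) := by
  have h1 : F.R t * (1 - F.P t) = (1 - F.P t) * F.R t := by
    rw [mul_sub, sub_mul, F.P_mul_R ht]; simp
  rw [← mul_assoc, h1, mul_assoc, ← mul_assoc (F.R t), F.R_mul_W s hs t ht, F.R_mul_m s hs]

theorem Q_mul_P_residual (hs : s ∈ S) :
    (1 - F.P t) * (F.W t s * F.m s) - (1 - F.P t) * F.P s * F.m s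
      = (1 - F.P t) * ((F.W t s - 1) * F.m s) := by
  rw [mul_assoc, F.P_mul_m hs, ← mul_sub, sub_mul (F.W t s), one_mul]

/-- `P(t) - P(s) = (Q(s) P(t))* - Q(t) P(s)`, and each block is `O(|t - s|)` by a mixed a priori
bound. -/
theorem eventually_norm_P_sub_le (hs : s ∈ S) :
    ∃ C, ∀ᶠ t in 𝓝[S] s, ‖F.P t - F.P s‖ ≤ C * |t - s| := by
  have hg := F.g_pos s hs
  have hM := F.M_nonneg
  set K := 2 / F.g s * (2 * α 1 * M) with hK
  refine ⟨K + K, ?_⟩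
  filter_upwards [self_mem_nhdsWithin, F.eventually_apriori hs, F.eventually_apriori' hs,
    F.eventually_norm_W_le hs] with t ht h1 h2 hW
  have bound : ∀ X : E →L[ℂ] E, F.g s / 2 * ‖X‖ ≤ 2 * α 1 * |t - s| * M → ‖X‖ ≤ K * |t - s| := by
    intro X hX
    rw [hK]
    have : ‖X‖ ≤ (2 * α 1 * |t - s| * M) / (F.g s / 2) := by
      rw [le_div_iff₀ (by positivity)]; linarith
    refine this.trans (le_of_eq ?_)
    field_simp
  have res : ∀ u ∈ S, ∀ v ∈ S, ‖F.W u v - 1‖ ≤ 2 * α 1 * |t - s| →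
      ‖(1 - F.P u) * ((F.W u v - 1) * F.m v)‖ ≤ 2 * α 1 * |t - s| * M := by
    intro u hu v hv huv
    calc ‖(1 - F.P u) * ((F.W u v - 1) * F.m v)‖
        ≤ ‖1 - F.P u‖ * (‖F.W u v - 1‖ * ‖F.m v‖) := (norm_mul_le _ _).trans
          (mul_le_mul_of_nonneg_left (norm_mul_le _ _) (norm_nonneg _))
      _ ≤ 1 * (2 * α 1 * |t - s| * M) := by
          have h3 : 0 ≤ 2 * α 1 * |t - s| := (norm_nonneg _).trans huv
          exact mul_le_mul (F.norm_Q hu) (mul_le_mul huv (F.norm_m v hv) (norm_nonneg _) h3)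
            (by positivity) zero_le_one
      _ = _ := one_mul _
  have h3 : ‖(1 - F.P t) * F.P s‖ ≤ K * |t - s| := by
    refine bound _ ((h1 _ _ (F.Q_mul_P_eq hs ht) ?_ ?_).trans ?_)
    · rw [← mul_assoc, F.P_mul_Q ht, zero_mul]
    · rw [mul_assoc, F.P_mul_P s hs]
    · rw [F.Q_mul_P_residual hs]
      exact res t ht s hs hW.1
  have h4 : ‖(1 - F.P s) * F.P t‖ ≤ K * |t - s| := by
    refine bound _ ((h2 _ _ (F.Q_mul_P_eq ht hs) ?_ ?_).trans ?_)
    · rw [← mul_assoc, F.P_mul_Q hs, zero_mul]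
    · rw [mul_assoc, F.P_mul_P t ht]
    · rw [F.Q_mul_P_residual ht]
      exact res s hs t ht hW.2
  have h5 : F.P t - F.P s = star ((1 - F.P s) * F.P t) - (1 - F.P t) * F.P s := by
    rw [star_mul, star_sub, star_one, F.star_P s hs, F.star_P t ht]
    noncomm_ring
  rw [h5]
  refine (norm_sub_le _ _).trans ?_
  rw [norm_star]
  linarith

theorem tendsto_P (hs : s ∈ S) : Tendsto F.P (𝓝[S] s) (𝓝 (F.P s)) := by
  obtain ⟨C, hC⟩ := F.eventually_norm_P_sub_le hs
  rw [tendsto_iff_norm_sub_tendsto_zero]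
  have h1 := (tendsto_abs_sub_nhdsWithin S s).const_mul C
  rw [mul_zero] at h1
  exact squeeze_zero' (Eventually.of_forall fun _ => norm_nonneg _) hC h1

theorem hasDerivWithinAt_W_mul (hs : s ∈ S) (hA : IsCompactOperator A) :
    HasDerivWithinAt (fun t => F.W t s * A) (F.T 1 s * A) S s := by
  rw [hasDerivWithinAt_iff_tendsto_slope]
  have hle : 𝓝[S \ {s}] s ≤ 𝓝[S] s := nhdsWithin_mono _ sdiff_subset
  have h1 : Tendsto (fun t => ((t - s)⁻¹ • (F.W t s - 1)).comp A) (𝓝[S \ {s}] s)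
      (𝓝 ((F.T 1 s).comp A)) := by
    refine tendsto_comp_of_isCompactOperator hA ⟨2 * α 1, ?_⟩ fun φ => ?_
    · filter_upwards [hle (F.eventually_norm_W_le hs), self_mem_nhdsWithin] with t ht hts
      have hne : 0 < |t - s| := abs_pos.2 (sub_ne_zero.2 hts.2)
      rw [norm_smul, norm_inv, Real.norm_eq_abs, inv_mul_eq_div, div_le_iff₀ hne]
      exact ht.1
    · have h2 := hasDerivWithinAt_iff_tendsto_slope.1 (F.hasDerivWithinAt_W s hs φ)
      refine h2.congr fun t => ?_
      rw [slope_def_module, F.W_self hs]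
      rfl
  refine h1.congr fun t => ?_
  rw [slope_def_module, F.W_self hs, ← sub_mul, ← smul_mul_assoc]
  rfl

/-- Continuous dependence on the data. The comparison operator is `Q(t) Z(s) B`, which satisfies the
constraint `P(t) X = 0` exactly and whose residual has the same limit; the mixed a priori bound
controls the difference. -/
theorem tendsto_of_residual {X Y : ℝ → E →L[ℂ] E} {B : E →L[ℂ] E} {l : Filter ℝ}
    (hl : l ≤ 𝓝[S] s) (hs : s ∈ S)
    (hX : ∀ᶠ t in l, X t = F.R t * Y t ∧ F.P t * X t = 0 ∧ X t * F.P s = X t)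
    (hB : Tendsto (fun t => Y t - X t * F.m s) l (𝓝 ((1 - F.P s) * B * F.P s))) :
    Tendsto X l (𝓝 (F.Z s B)) := by
  have hg := F.g_pos s hs
  have hQ : Tendsto (fun t => 1 - F.P t) l (𝓝 (1 - F.P s)) :=
    tendsto_const_nhds.sub ((F.tendsto_P hs).mono_left hl)
  have hV : Tendsto (fun t => (1 - F.P t) * F.Z s B) l (𝓝 (F.Z s B)) := by
    have := hQ.mul_const (F.Z s B)
    rwa [F.Q_mul_Z B hs] at this
  have hres : Tendsto (fun t => (1 - F.P t) * ((F.W t s - 1) * F.Y s B) +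
      (1 - F.P t) * ((1 - F.P s) * B * F.P s)) l (𝓝 ((1 - F.P s) * B * F.P s)) := by
    have h1 : Tendsto (fun t => F.W t s - 1) l (𝓝 0) := by
      simpa using ((F.tendsto_norm_W hs).mono_left hl).sub_const 1
    have h2 := (hQ.mul (h1.mul_const (F.Y s B))).add (hQ.mul_const ((1 - F.P s) * B * F.P s))
    rwa [zero_mul, mul_zero, zero_add, ← mul_assoc, ← mul_assoc, F.Q_mul_Q hs] at h2
  have hdiff := hB.sub hres
  rw [sub_self] at hdiff
  have hlim : Tendsto (fun t => X t - (1 - F.P t) * F.Z s B) l (𝓝 0) := by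
    have h1 := (hdiff.norm.const_mul (2 / F.g s))
    rw [norm_zero, mul_zero] at h1
    refine squeeze_zero_norm' ?_ h1
    filter_upwards [hX, hl (F.eventually_apriori hs), hl self_mem_nhdsWithin]
      with t ⟨h2, h3, h4⟩ h5 ht
    have hQR : F.R t * (1 - F.P t) = (1 - F.P t) * F.R t := by
      rw [mul_sub, sub_mul, F.P_mul_R ht]; simp
    have h6 := h5 (X t - (1 - F.P t) * F.Z s B)
      (Y t - (1 - F.P t) * (F.W t s * F.Y s B)) ?_ ?_ ?_
    · have h7 : Y t - (1 - F.P t) * (F.W t s * F.Y s B)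
          - (X t - (1 - F.P t) * F.Z s B) * F.m s
          = (Y t - X t * F.m s) - ((1 - F.P t) * ((F.W t s - 1) * F.Y s B) +
            (1 - F.P t) * ((1 - F.P s) * B * F.P s)) := by
        rw [← F.Y_sub_Z_mul_m B]
        noncomm_ring
      rw [h7] at h6
      rw [div_mul_eq_mul_div, le_div_iff₀ hg]
      linarith
    · rw [mul_sub, ← h2, ← mul_assoc, hQR, mul_assoc, ← mul_assoc (F.R t), F.R_mul_W s hs t ht,
        F.R_mul_Y B hs]
    · rw [mul_sub, h3, ← mul_assoc, F.P_mul_Q ht, zero_mul, sub_zero]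
    · rw [sub_mul, h4, mul_assoc, F.Z_mul_P B hs]
  simpa using hlim.add hV

theorem hasDerivWithinAt_of_residual {X Y : ℝ → E →L[ℂ] E} {B : E →L[ℂ] E} (hs : s ∈ S)
    (hX : ∀ t ∈ S, X t = F.R t * Y t ∧ F.P t * X t = 0 ∧ X t * F.P s = X t)
    (hX0 : X s = 0) {L : ℝ → E →L[ℂ] E} (hL0 : L s = 0)
    (hL : ∀ t ∈ S, Y t - X t * F.m s = L t)
    (hB : HasDerivWithinAt L ((1 - F.P s) * B * F.P s) S s) :
    HasDerivWithinAt X (F.Z s B) S s := by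
  have hle : 𝓝[S \ {s}] s ≤ 𝓝[S] s := nhdsWithin_mono _ sdiff_subset
  rw [hasDerivWithinAt_iff_tendsto_slope] at hB ⊢
  have h1 := F.tendsto_of_residual (X := fun t => (t - s)⁻¹ • X t) (Y := fun t => (t - s)⁻¹ • Y t)
    (B := B) hle hs ?_ ?_
  · refine h1.congr fun t => ?_
    rw [slope_def_module, hX0, sub_zero]
  · filter_upwards [hle self_mem_nhdsWithin] with t ht
    obtain ⟨h2, h3, h4⟩ := hX t ht
    exact ⟨by rw [mul_smul_comm, ← h2], by rw [mul_smul_comm, h3, smul_zero],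
      by rw [smul_mul_assoc, h4]⟩
  · refine hB.congr' ?_
    filter_upwards [hle self_mem_nhdsWithin] with t ht
    rw [slope_def_module, hL0, sub_zero, ← hL t ht, smul_sub, smul_mul_assoc]

/-- The derivative of the spectral projector. -/
noncomputable def P' (s : ℝ) : E →L[ℂ] E :=
  -(F.Z s (F.T 1 s * F.m s) + star (F.Z s (F.T 1 s * F.m s)))

theorem isCompactOperator_m (hs : s ∈ S) : IsCompactOperator (F.m s) :=
  F.isCompactOperator_of_mul_P hs (F.m_mul_P s hs)

theorem isCompactOperator_Y (hs : s ∈ S) : IsCompactOperator (F.Y s A) :=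
  F.isCompactOperator_of_mul_P hs (F.Y_mul_P A hs)

/-- `P(t) = P(s) - (Q(t) P(s) + adjoint) + (P(t) - P(s))²`. The square is `O(|t - s|²)`, and `Q(t)
P(s)` is differentiated through its residual. -/
theorem hasDerivWithinAt_P (hs : s ∈ S) : HasDerivWithinAt F.P (F.P' s) S s := by
  have hX : HasDerivWithinAt (fun t => (1 - F.P t) * F.P s) (F.Z s (F.T 1 s * F.m s)) S s := by
    refine F.hasDerivWithinAt_of_residual hs (Y := fun t => (1 - F.P t) * (F.W t s * F.m s))
      (L := fun t => (1 - F.P t) * ((F.W t s - 1) * F.m s)) ?_ (F.Q_mul_P hs) ?_ ?_ ?_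
    · refine fun t ht => ⟨F.Q_mul_P_eq hs ht, ?_, ?_⟩
      · rw [← mul_assoc, F.P_mul_Q ht, zero_mul]
      · rw [mul_assoc, F.P_mul_P s hs]
    · simp [F.W_self hs]
    · exact fun t ht => F.Q_mul_P_residual hs
    · have h1 : HasDerivWithinAt (fun t => (F.W t s - 1) * F.m s) (F.T 1 s * F.m s) S s := by
        have := (F.hasDerivWithinAt_W_mul (F.m s) hs (F.isCompactOperator_m hs)).sub_const (F.m s)
        simpa only [sub_mul, one_mul] using this
      -- The second factor vanishes at `t = s`, so mere continuity of the first one suffices and `d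
      -- = 0`.
      have h2 := HasDerivWithinAt.clm_apply_of_strong
        (F := fun t => ContinuousLinearMap.mul ℂ (E →L[ℂ] E) (1 - F.P t))
        (v := fun t => (F.W t s - 1) * F.m s) (d := 0) (S := S) (s := s)
        (by simpa [F.W_self hs] using hasDerivWithinAt_const s S (0 : E →L[ℂ] E))
        ⟨1, by
          filter_upwards [self_mem_nhdsWithin] with t ht
          exact (ContinuousLinearMap.opNorm_mul_apply_le _ _ _).trans (F.norm_Q ht)⟩
        (((tendsto_const_nhds.sub (F.tendsto_P hs))).mul_const _) h1
      rw [zero_add] at h2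
      rw [mul_assoc, mul_assoc, F.m_mul_P s hs]
      exact h2
  obtain ⟨C, hC⟩ := F.eventually_norm_P_sub_le hs
  have hsq : HasDerivWithinAt (fun t => (F.P t - F.P s) * (F.P t - F.P s)) 0 S s := by
    rw [hasDerivWithinAt_iff_isLittleO, Asymptotics.isLittleO_iff]
    intro ε hε
    have h1 := (tendsto_abs_sub_nhdsWithin S s).const_mul (C * C)
    rw [mul_zero] at h1
    filter_upwards [hC, h1.eventually (ge_mem_nhds hε)] with t h2 h3
    simp only [sub_self, zero_mul, sub_zero, smul_zero, Real.norm_eq_abs]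
    calc ‖(F.P t - F.P s) * (F.P t - F.P s)‖ ≤ ‖F.P t - F.P s‖ * ‖F.P t - F.P s‖ := norm_mul_le _ _
      _ ≤ (C * |t - s|) * (C * |t - s|) :=
        mul_le_mul h2 h2 (norm_nonneg _) ((norm_nonneg _).trans h2)
      _ = (C * C * |t - s|) * |t - s| := by ring
      _ ≤ ε * |t - s| := by gcongr
  have hsum := ((hasDerivWithinAt_const s S (F.P s)).sub (hX.add hX.star)).add hsq
  rw [zero_sub, add_zero] at hsum
  refine hsum.congr_of_mem (fun t ht => ?_) hs
  simp only [Pi.add_apply, Pi.sub_apply, star_mul, star_sub, star_one, F.star_P s hs, F.star_P t ht]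
  have h1 := F.P_mul_P s hs
  have h2 := F.P_mul_P t ht
  simp only [mul_sub, sub_mul, mul_one, one_mul, h1, h2]
  abel

/-- The derivative of `m = H P`. -/
noncomputable def m' (s : ℝ) : E →L[ℂ] E :=
  F.P' s * F.m s + F.P s * (F.T 1 s * F.m s) + F.m s * (F.P' s * (1 - F.P s))

/-- In this splitting the unknown `m t` on the right is multiplied by a factor that vanishes at `t =
s`. Boundedness of `m` then gives its continuity, and continuity gives differentiability. -/
theorem m_eq (hs : s ∈ S) (ht : t ∈ S) :
    F.m t = F.P t * (F.W t s * F.m s) + F.m t * ((F.P t - F.P s) * (1 - F.P s)) := by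
  have h1 : F.P t * (F.W t s * F.m s) = F.m t * F.P s := by
    rw [← F.m_mul_R ht, mul_assoc, ← mul_assoc (F.R t), F.R_mul_W s hs t ht, F.R_mul_m s hs]
  rw [h1, sub_mul, F.P_mul_Q hs, sub_zero, ← mul_assoc, F.m_mul_P t ht, mul_sub, mul_one]
  abel

theorem hasDerivWithinAt_P_sub_mul (hs : s ∈ S) :
    HasDerivWithinAt (fun t => (F.P t - F.P s) * (1 - F.P s)) (F.P' s * (1 - F.P s)) S s :=
  ((F.hasDerivWithinAt_P hs).sub_const _).mul_const _

theorem eventually_norm_mul_m_le :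
    ∀ᶠ t in 𝓝[S] s, ‖ContinuousLinearMap.mul ℂ (E →L[ℂ] E) (F.m t)‖ ≤ M := by
  filter_upwards [self_mem_nhdsWithin] with t ht
  exact (ContinuousLinearMap.opNorm_mul_apply_le _ _ _).trans (F.norm_m t ht)

theorem hasDerivWithinAt_P_mul_W (hs : s ∈ S) :
    HasDerivWithinAt (fun t => F.P t * (F.W t s * F.m s))
      (F.P' s * F.m s + F.P s * (F.T 1 s * F.m s)) S s := by
  have := (F.hasDerivWithinAt_P hs).mul
    (F.hasDerivWithinAt_W_mul (F.m s) hs (F.isCompactOperator_m hs))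
  rwa [F.W_self hs, one_mul] at this

theorem tendsto_m (hs : s ∈ S) : Tendsto F.m (𝓝[S] s) (𝓝 (F.m s)) := by
  have h1 := (F.hasDerivWithinAt_P_mul_W hs).continuousWithinAt
  have h2 : Tendsto (fun t => F.m t * ((F.P t - F.P s) * (1 - F.P s))) (𝓝[S] s) (𝓝 0) := by
    have h3 := (F.hasDerivWithinAt_P_sub_mul hs).continuousWithinAt.tendsto
    rw [sub_self, zero_mul] at h3
    exact tendsto_clm_apply_of_pointwise
      (F := fun t => ContinuousLinearMap.mul ℂ (E →L[ℂ] E) (F.m t))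
      ⟨M, F.eventually_norm_mul_m_le⟩ (by simpa using tendsto_const_nhds) h3
  have h4 := h1.tendsto.add h2
  rw [F.W_self hs, one_mul, F.P_mul_m hs, add_zero] at h4
  refine h4.congr' ?_
  filter_upwards [self_mem_nhdsWithin] with t ht
  exact (F.m_eq hs ht).symm

theorem hasDerivWithinAt_m (hs : s ∈ S) : HasDerivWithinAt F.m (F.m' s) S s := by
  have h1 := HasDerivWithinAt.clm_apply_of_strong
    (F := fun t => ContinuousLinearMap.mul ℂ (E →L[ℂ] E) (F.m t))
    (v := fun t => (F.P t - F.P s) * (1 - F.P s)) (d := 0) (S := S) (s := s)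
    (by simpa using hasDerivWithinAt_const s S (0 : E →L[ℂ] E))
    ⟨M, F.eventually_norm_mul_m_le⟩ ((F.tendsto_m hs).mul_const _)
    (F.hasDerivWithinAt_P_sub_mul hs)
  rw [zero_add] at h1
  exact ((F.hasDerivWithinAt_P_mul_W hs).add h1).congr_of_mem (fun t ht => F.m_eq hs ht) hs

end SpectralFamily

/-! ### The first derivative of the Sylvester solution. -/

namespace SpectralFamily

variable {E : Type*} [NormedAddCommGroup E] [InnerProductSpace ℂ E] [CompleteSpace E]
  {n : ℕ} {α : ℕ → ℝ} {M : ℝ} {N : ℕ} {S : Set ℝ} (F : SpectralFamily E n α M N S) {s t : ℝ}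
  (A B : E →L[ℂ] E)

include F

theorem P_mul_P' (hs : s ∈ S) : F.P s * F.P' s * F.P s = 0 := by
  rw [P', mul_neg, neg_mul, mul_add, F.P_mul_Z _ hs, zero_add, mul_assoc]
  have := congrArg star (F.P_mul_Z (F.T 1 s * F.m s) hs)
  rw [star_mul, F.star_P s hs, star_zero] at this
  rw [this, mul_zero, neg_zero]

theorem P_mul_m'_mul_P (hs : s ∈ S) :
    F.P s * F.m' s * F.P s = F.P s * (F.T 1 s * F.m s) := by
  have h1 : F.P s * (F.P' s * F.m s) * F.P s = 0 := by
    rw [← F.P_mul_m hs, ← mul_assoc (F.P' s), ← mul_assoc (F.P s), ← mul_assoc (F.P s),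
      F.P_mul_P' hs, zero_mul, zero_mul]
  have h2 : F.P s * (F.m s * (F.P' s * (1 - F.P s))) * F.P s = 0 := by
    simp only [mul_assoc]
    rw [F.Q_mul_P hs]
    simp
  rw [m', mul_add, mul_add, add_mul, add_mul, h1, h2, zero_add, add_zero, ← mul_assoc,
    F.P_mul_P s hs, mul_assoc, mul_assoc, F.m_mul_P s hs]

theorem Z_mul_m'_mul_P (hs : s ∈ S) :
    F.Z s A * (F.m' s * F.P s) = F.Z s A * (F.T 1 s * F.m s) := by
  rw [← F.Z_mul_P A hs, mul_assoc, ← mul_assoc (F.P s), F.P_mul_m'_mul_P hs, mul_assoc]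

theorem eventually_norm_mul_Z_le (hs : s ∈ S) :
    ∀ᶠ t in 𝓝[S] s, ‖ContinuousLinearMap.mul ℂ (E →L[ℂ] E) (F.Z t A)‖ ≤ 4 / F.g s * ‖A‖ := by
  filter_upwards [F.eventually_norm_Z_le hs] with t ht
  exact (ContinuousLinearMap.opNorm_mul_apply_le _ _ _).trans ((F.Z t).le_of_opNorm_le ht A)

/-- The residual in the Sylvester equation satisfied by `(1 - P t) (Z t - Z s) P s`. -/
noncomputable def residualZ (s t : ℝ) : E →L[ℂ] E :=
  (1 - F.P t) * A * ((F.P t - F.P s) * F.P s) - (F.P t - F.P s) * (F.P s * A * F.P s)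
    + F.Z t A * ((F.m t - F.m s) * F.P s) - (1 - F.P t) * ((F.W t s - 1) * F.Y s A)

/-- Each term of the residual has a factor that vanishes at `t = s`. Hence it tends to `0` when `Z t
A` is only known to be bounded, and it is differentiable at `s` once `Z t A` is continuous there. -/
theorem residualZ_eq (hs : s ∈ S) :
    (F.Y t A * F.P s - (1 - F.P t) * (F.W t s * F.Y s A))
      - (F.Z t A * F.P s - (1 - F.P t) * F.Z s A) * F.m s = F.residualZ A s t := by
  have h1 : F.Y s A = (1 - F.P s) * A * F.P s + F.Z s A * F.m s := rfl
  have h2 : F.Z s A * F.m s = F.Y s A - (1 - F.P s) * A * F.P s := by rw [h1]; abel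
  have h3 : F.Y t A = (1 - F.P t) * A * F.P t + F.Z t A * F.m t := rfl
  have h4 := F.P_mul_P s hs
  have h5 := F.m_mul_P s hs
  have h6 := F.P_mul_m hs
  rw [residualZ, sub_mul (F.Z t A * F.P s), mul_assoc (1 - F.P t) (F.Z s A), h2, h3]
  simp only [mul_sub, sub_mul, add_mul, one_mul, mul_assoc, h4, h5, h6]
  have h7 : F.P s * (F.P s * (A * F.P s)) = F.P s * (A * F.P s) := by rw [← mul_assoc, h4]
  rw [h7]
  abel

theorem residualZ_self (hs : s ∈ S) : F.residualZ A s s = 0 := by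
  simp [residualZ, F.W_self hs]

theorem Z_sub_residual (hs : s ∈ S) (ht : t ∈ S) :
    F.Z t A * F.P s - (1 - F.P t) * F.Z s A
      = F.R t * (F.Y t A * F.P s - (1 - F.P t) * (F.W t s * F.Y s A)) ∧
    F.P t * (F.Z t A * F.P s - (1 - F.P t) * F.Z s A) = 0 ∧
    (F.Z t A * F.P s - (1 - F.P t) * F.Z s A) * F.P s
      = F.Z t A * F.P s - (1 - F.P t) * F.Z s A := by
  have hQR : F.R t * (1 - F.P t) = (1 - F.P t) * F.R t := by
    rw [mul_sub, sub_mul, F.P_mul_R ht]; simp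
  refine ⟨?_, ?_, ?_⟩
  · rw [mul_sub, ← mul_assoc, F.R_mul_Y A ht, ← mul_assoc (F.R t), hQR, mul_assoc (1 - F.P t),
      ← mul_assoc (F.R t), F.R_mul_W s hs t ht, F.R_mul_Y A hs]
  · rw [mul_sub, ← mul_assoc, F.P_mul_Z A ht, ← mul_assoc, F.P_mul_Q ht, zero_mul, zero_mul,
      sub_zero]
  · rw [sub_mul, mul_assoc, F.P_mul_P s hs, mul_assoc, F.Z_mul_P A hs]

/-- The bracket is handled by its residual, the middle term by the derivative of `P`, and the last
term has a factor that vanishes at `t = s`. -/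
theorem Z_eq_add (hs : s ∈ S) (ht : t ∈ S) :
    F.Z t A = (F.Z t A * F.P s - (1 - F.P t) * F.Z s A) + (1 - F.P t) * F.Z s A
      + F.Z t A * ((F.P t - F.P s) * (1 - F.P s)) := by
  rw [sub_mul (F.P t), F.P_mul_Q hs, sub_zero, ← mul_assoc, F.Z_mul_P A ht, mul_sub, mul_one]
  abel

theorem tendsto_Z_apply (hs : s ∈ S) : Tendsto (fun t => F.Z t A) (𝓝[S] s) (𝓝 (F.Z s A)) := by
  have hP := F.tendsto_P hs
  have hQ : Tendsto (fun t => 1 - F.P t) (𝓝[S] s) (𝓝 (1 - F.P s)) := tendsto_const_nhds.sub hP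
  have hP0 : Tendsto (fun t => F.P t - F.P s) (𝓝[S] s) (𝓝 0) := by simpa using hP.sub_const (F.P s)
  have hm0 : Tendsto (fun t => F.m t - F.m s) (𝓝[S] s) (𝓝 0) := by
    simpa using (F.tendsto_m hs).sub_const (F.m s)
  have hW0 : Tendsto (fun t => F.W t s - 1) (𝓝[S] s) (𝓝 0) := by
    simpa using (F.tendsto_norm_W hs).sub_const 1
  have hZ : ∀ {v : ℝ → E →L[ℂ] E}, Tendsto v (𝓝[S] s) (𝓝 0) →
      Tendsto (fun t => F.Z t A * v t) (𝓝[S] s) (𝓝 0) := fun {v} hv =>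
    tendsto_clm_apply_of_pointwise
      (F := fun t => ContinuousLinearMap.mul ℂ (E →L[ℂ] E) (F.Z t A))
      ⟨_, F.eventually_norm_mul_Z_le A hs⟩ (by simpa using tendsto_const_nhds) hv
  have hres : Tendsto (F.residualZ A s) (𝓝[S] s) (𝓝 0) := by
    have := ((((hQ.mul_const A).mul (hP0.mul_const (F.P s))).sub
      (hP0.mul_const (F.P s * A * F.P s))).add
      (hZ (v := fun t => (F.m t - F.m s) * F.P s) (by simpa using hm0.mul_const (F.P s)))).sub
      (hQ.mul (hW0.mul_const (F.Y s A)))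
    simp only [zero_mul, mul_zero, sub_zero, add_zero] at this
    exact this
  have h1 : Tendsto (fun t => F.Z t A * F.P s - (1 - F.P t) * F.Z s A) (𝓝[S] s) (𝓝 0) := by
    have := F.tendsto_of_residual (B := 0) le_rfl hs
      (X := fun t => F.Z t A * F.P s - (1 - F.P t) * F.Z s A)
      (Y := fun t => F.Y t A * F.P s - (1 - F.P t) * (F.W t s * F.Y s A)) ?_ ?_
    · rwa [map_zero] at this
    · filter_upwards [self_mem_nhdsWithin] with t ht
      exact F.Z_sub_residual A hs ht
    · rw [mul_zero, zero_mul]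
      refine hres.congr' ?_
      filter_upwards [self_mem_nhdsWithin] with t ht
      exact (F.residualZ_eq A hs).symm
  have h2 := (h1.add (hQ.mul_const (F.Z s A))).add
    (hZ (v := fun t => (F.P t - F.P s) * (1 - F.P s)) (by simpa using hP0.mul_const (1 - F.P s)))
  rw [F.Q_mul_Z A hs, zero_add, add_zero] at h2
  refine h2.congr' ?_
  filter_upwards [self_mem_nhdsWithin] with t ht
  exact (F.Z_eq_add A hs ht).symm

/-- The derivative of `s ↦ Z s A`. -/
noncomputable def Z' (s : ℝ) (A : E →L[ℂ] E) : E →L[ℂ] E :=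
  F.Z s (A * F.P' s - F.P' s * (F.P s * A) + F.Z s A * (F.T 1 s * F.m s) - F.T 1 s * F.Y s A)
    - F.P' s * F.Z s A + F.Z s A * (F.P' s * (1 - F.P s))

theorem hasDerivWithinAt_Z_apply (hs : s ∈ S) :
    HasDerivWithinAt (fun t => F.Z t A) (F.Z' s A) S s := by
  have hP := F.hasDerivWithinAt_P hs
  have hP0 : HasDerivWithinAt (fun t => F.P t - F.P s) (F.P' s) S s := hP.sub_const _
  have hm0 : HasDerivWithinAt (fun t => F.m t - F.m s) (F.m' s) S s :=
    (F.hasDerivWithinAt_m hs).sub_const _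
  have hQ : HasDerivWithinAt (fun t => 1 - F.P t) (-F.P' s) S s := hP.const_sub _
  have hW0 : HasDerivWithinAt (fun t => (F.W t s - 1) * F.Y s A) (F.T 1 s * F.Y s A) S s := by
    have := (F.hasDerivWithinAt_W_mul (F.Y s A) hs (F.isCompactOperator_Y A hs)).sub_const (F.Y s A)
    simpa only [sub_mul, one_mul] using this
  have hZ : ∀ {v : ℝ → E →L[ℂ] E} {v' : E →L[ℂ] E}, v s = 0 → HasDerivWithinAt v v' S s →
      HasDerivWithinAt (fun t => F.Z t A * v t) (F.Z s A * v') S s := fun {v v'} hv0 hv => by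
    have := HasDerivWithinAt.clm_apply_of_strong
      (F := fun t => ContinuousLinearMap.mul ℂ (E →L[ℂ] E) (F.Z t A)) (d := 0)
      (by simpa [hv0] using hasDerivWithinAt_const s S (0 : E →L[ℂ] E))
      ⟨_, F.eventually_norm_mul_Z_le A hs⟩ ((F.tendsto_Z_apply A hs).mul_const _) hv
    rwa [zero_add] at this
  have hres := ((((hQ.mul_const A).mul (hP0.mul_const (F.P s))).sub
    (hP0.mul_const (F.P s * A * F.P s))).add
    (hZ (v := fun t => (F.m t - F.m s) * F.P s) (by simp) (hm0.mul_const (F.P s)))).sub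
    (hQ.mul hW0)
  have h1 := F.hasDerivWithinAt_of_residual hs
    (B := A * F.P' s - F.P' s * (F.P s * A) + F.Z s A * (F.T 1 s * F.m s) - F.T 1 s * F.Y s A)
    (X := fun t => F.Z t A * F.P s - (1 - F.P t) * F.Z s A)
    (Y := fun t => F.Y t A * F.P s - (1 - F.P t) * (F.W t s * F.Y s A))
    (L := F.residualZ A s) (fun t ht => F.Z_sub_residual A hs ht)
    (by rw [F.Z_mul_P A hs, F.Q_mul_Z A hs, sub_self]) (F.residualZ_self A hs)
    (fun t ht => F.residualZ_eq A hs) ?_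
  · have h2 := (h1.add (hQ.mul_const (F.Z s A))).add
      (hZ (v := fun t => (F.P t - F.P s) * (1 - F.P s)) (by simp)
        (F.hasDerivWithinAt_P_sub_mul hs))
    refine (h2.congr_of_mem (fun t ht => F.Z_eq_add A hs ht) hs).congr_deriv ?_
    rw [Z', neg_mul, ← sub_eq_add_neg]
  · refine hres.congr_deriv ?_
    rw [F.Z_mul_m'_mul_P A hs]
    have h3 : (1 - F.P s) * F.Z s A * (F.T 1 s * F.m s) = F.Z s A * (F.T 1 s * F.m s) := by
      rw [F.Q_mul_Z A hs]
    have h4 : F.Y s A * F.P s = F.Y s A := F.Y_mul_P A hs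
    have h5 : F.m s * F.P s = F.m s := F.m_mul_P s hs
    have h6 : F.P s * (F.P' s * F.P s) = 0 := by rw [← mul_assoc]; exact F.P_mul_P' hs
    have h6' : ∀ X, F.P s * (F.P' s * (F.P s * X)) = 0 := fun X => by
      rw [← mul_assoc (F.P' s), ← mul_assoc, h6, zero_mul]
    simp only [sub_mul, one_mul, mul_assoc] at h3
    simp only [mul_sub, sub_mul, mul_add, add_mul, one_mul, mul_assoc, h4, h5, h6',
      F.W_self hs, sub_self, mul_zero, zero_mul, zero_add, sub_zero, neg_mul]
    rw [h3]

end SpectralFamily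

/-! ### Products of strongly differentiable families with compact ones. -/

section CompactDerivatives

variable {E : Type*} [NormedAddCommGroup E] [NormedSpace ℂ E]

theorem isCompactOperator_of_hasDerivWithinAt [CompleteSpace E] {X : ℝ → E →L[ℂ] E}
    {X' : E →L[ℂ] E} {S : Set ℝ} {s : ℝ} (hS : UniqueDiffWithinAt ℝ S s) (hs : s ∈ S)
    (hX : ∀ t ∈ S, IsCompactOperator (X t)) (h : HasDerivWithinAt X X' S s) :
    IsCompactOperator X' := by
  have : (𝓝[S \ {s}] s).NeBot :=
    accPt_principal_iff_nhdsWithin.1 (uniqueDiffWithinAt_iff_accPt.1 hS)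
  refine isCompactOperator_of_tendsto (hasDerivWithinAt_iff_tendsto_slope.1 h) ?_
  filter_upwards [self_mem_nhdsWithin] with t ht
  rw [slope_def_module, ← Complex.coe_smul]
  exact ((hX t ht.1).sub (hX s hs)).smul ((t - s)⁻¹ : ℝ)

theorem hasDerivWithinAt_mul_of_isCompactOperator {G G' : ℝ → E →L[ℂ] E} {K : E →L[ℂ] E}
    {S : Set ℝ} {C : ℝ} (hS : Convex ℝ S)
    (hG : ∀ u ∈ S, ∀ x, HasDerivWithinAt (fun t => G t x) (G' u x) S u)
    (hC : ∀ u ∈ S, ‖G' u‖ ≤ C) {s : ℝ} (hs : s ∈ S) (hK : IsCompactOperator K) :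
    HasDerivWithinAt (fun t => G t * K) (G' s * K) S s := by
  rw [hasDerivWithinAt_iff_tendsto_slope]
  have h1 : Tendsto (fun t => (slope G s t).comp K) (𝓝[S \ {s}] s) (𝓝 ((G' s).comp K)) := by
    refine tendsto_comp_of_isCompactOperator hK ⟨C, ?_⟩ fun φ => ?_
    · filter_upwards [self_mem_nhdsWithin] with t ht
      have hne : 0 < |t - s| := abs_pos.2 (sub_ne_zero.2 ht.2)
      rw [slope_def_module, norm_smul, norm_inv, Real.norm_eq_abs, inv_mul_eq_div, div_le_iff₀ hne]
      exact norm_sub_le_of_pointwise_hasDerivWithinAt hS hG hC hs ht.1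
    · refine (hasDerivWithinAt_iff_tendsto_slope.1 (hG s hs φ)).congr fun t => ?_
      rw [slope_def_module, slope_def_module]
      rfl
  refine h1.congr fun t => ?_
  rw [slope_def_module, slope_def_module, ← sub_mul, ← smul_mul_assoc]
  rfl

theorem norm_mulLeft_le (A : E →L[ℂ] E) : ‖ContinuousLinearMap.mul ℂ (E →L[ℂ] E) A‖ ≤ ‖A‖ :=
  ContinuousLinearMap.opNorm_mul_apply_le _ _ _

theorem IsCompactOperator.mul_left {K : E →L[ℂ] E} (hK : IsCompactOperator K) (A : E →L[ℂ] E) :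
    IsCompactOperator (A * K : E →L[ℂ] E) :=
  hK.clm_comp A

theorem IsCompactOperator.mul_right {K : E →L[ℂ] E} (hK : IsCompactOperator K) (A : E →L[ℂ] E) :
    IsCompactOperator (K * A : E →L[ℂ] E) :=
  hK.comp_clm A

theorem tendsto_mul_of_isCompactOperator {G : ℝ → E →L[ℂ] E} {K : E →L[ℂ] E} {l : Filter ℝ}
    {G₀ : E →L[ℂ] E} (hb : ∃ C, ∀ᶠ t in l, ‖G t‖ ≤ C)
    (hG : ∀ x, Tendsto (fun t => G t x) l (𝓝 (G₀ x))) (hK : IsCompactOperator K) :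
    Tendsto (fun t => G t * K) l (𝓝 (G₀ * K)) :=
  tendsto_comp_of_isCompactOperator hK hb hG

end CompactDerivatives

/-- Constants for the products of the operators `H^{(i)} H⁻¹` with smooth families. -/
noncomputable def mulConst (A : ℝ) : ℕ → ℝ
  | 0 => A
  | k + 1 => 2 * mulConst A k + mulConst A k * mulConst A k + A

theorem mulConst_nonneg {A : ℝ} (hA : 0 ≤ A) : ∀ k, 0 ≤ mulConst A k
  | 0 => hA
  | k + 1 => by
    have := mulConst_nonneg hA k
    simp only [mulConst]
    positivity

theorem mulConst_mono {A : ℝ} (hA : 0 ≤ A) : Monotone (mulConst A) := by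
  refine monotone_nat_of_le_succ fun k => ?_
  have := mulConst_nonneg hA k
  simp only [mulConst]
  nlinarith

theorem le_mulConst {A : ℝ} (hA : 0 ≤ A) (k : ℕ) : A ≤ mulConst A k :=
  mulConst_mono hA (Nat.zero_le k)

namespace SpectralFamily

variable {E : Type*} [NormedAddCommGroup E] [InnerProductSpace ℂ E] [CompleteSpace E]
  {n : ℕ} {α : ℕ → ℝ} {M : ℝ} {N : ℕ} {S : Set ℝ} (F : SpectralFamily E n α M N S) {s t : ℝ}

/-- A common bound for the operators `H^{(i)} H⁻¹`. -/
noncomputable def bound (n : ℕ) (α : ℕ → ℝ) : ℝ := 1 + ∑ i ∈ Finset.range (n + 1), α i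

include F

theorem le_bound {i : ℕ} (hi : i ≤ n) : α i ≤ bound n α := by
  have := Finset.single_le_sum (f := α) (fun i _ => F.α_nonneg i)
    (Finset.mem_range.2 (Nat.lt_succ_of_le hi))
  rw [bound]
  linarith

theorem one_le_bound : 1 ≤ bound n α := by
  have := Finset.sum_nonneg (f := α) (s := Finset.range (n + 1)) (fun i _ => F.α_nonneg i)
  rw [bound]
  linarith

theorem norm_T_le {i : ℕ} (h1 : 1 ≤ i) (hi : i ≤ n) (hs : s ∈ S) : ‖F.T i s‖ ≤ bound n α :=
  (F.norm_T i h1 hi s hs).trans (F.le_bound hi)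

theorem norm_T_mul_T_le {i j : ℕ} (h1 : 1 ≤ i) (hi : i ≤ n) (h2 : 1 ≤ j) (hj : j ≤ n) (hs : s ∈ S) :
    ‖F.T i s * F.T j s‖ ≤ bound n α * bound n α := by
  have := F.one_le_bound
  exact (norm_mul_le _ _).trans (mul_le_mul (F.norm_T_le h1 hi hs) (F.norm_T_le h2 hj hs)
    (norm_nonneg _) (by linarith))

theorem tendsto_T_apply {i : ℕ} (h1 : 1 ≤ i) (hi : i ≤ n) (hs : s ∈ S) (φ : E) :
    Tendsto (fun t => F.T i t φ) (𝓝[S] s) (𝓝 (F.T i s φ)) := by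
  rcases hi.lt_or_eq with hi | rfl
  · exact (F.hasDerivWithinAt_T i h1 hi s hs φ).continuousWithinAt
  · exact F.T_cont φ s hs

theorem hasDerivWithinAt_T_mul {i : ℕ} (h1 : 1 ≤ i) (hi : i < n) (hs : s ∈ S) {K : E →L[ℂ] E}
    (hK : IsCompactOperator K) :
    HasDerivWithinAt (fun t => F.T i t * K) ((F.T (i + 1) s - F.T i s * F.T 1 s) * K) S s :=
  hasDerivWithinAt_mul_of_isCompactOperator (G := F.T i)
    (G' := fun s => F.T (i + 1) s - F.T i s * F.T 1 s)
    F.convex (F.hasDerivWithinAt_T i h1 hi)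
    (fun _ hu => (norm_sub_le _ _).trans (add_le_add (F.norm_T_le (by omega) hi hu)
      (F.norm_T_mul_T_le h1 hi.le le_rfl F.one_le hu))) hs hK

theorem hasDerivWithinAt_R_mul (hs : s ∈ S) {K : E →L[ℂ] E} (hK : IsCompactOperator K) :
    HasDerivWithinAt (fun t => F.R t * K) (-(F.R s * F.T 1 s) * K) S s :=
  hasDerivWithinAt_mul_of_isCompactOperator (G := F.R)
    (G' := fun s => -(F.R s * F.T 1 s)) (C := 1 * bound n α)
    F.convex F.hasDerivWithinAt_R
    (fun u hu => by
      rw [norm_neg]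
      exact (norm_mul_le _ _).trans (mul_le_mul (F.norm_R u hu) (F.norm_T_le le_rfl F.one_le hu)
        (norm_nonneg _) zero_le_one)) hs hK

variable {X : ℝ → E →L[ℂ] E} {k a : ℕ} {C : ℝ}

theorem eventually_norm_T_le {i : ℕ} (h1 : 1 ≤ i) (hi : i ≤ n) :
    ∀ᶠ t in 𝓝[S] s, ‖F.T i t‖ ≤ bound n α := by
  filter_upwards [self_mem_nhdsWithin] with t ht
  exact F.norm_T_le h1 hi ht

theorem exists_eventually_norm_mul_T_le {i : ℕ} (h1 : 1 ≤ i) (hi : i ≤ n) :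
    ∃ C, ∀ᶠ t in 𝓝[S] s, ‖ContinuousLinearMap.mul ℂ (E →L[ℂ] E) (F.T i t)‖ ≤ C :=
  ⟨_, (F.eventually_norm_T_le h1 hi).mono fun _ ht => (norm_mulLeft_le _).trans ht⟩

theorem tendsto_T_mul {i : ℕ} (h1 : 1 ≤ i) (hi : i ≤ n) (hs : s ∈ S) {K : E →L[ℂ] E}
    (hK : IsCompactOperator K) : Tendsto (fun t => F.T i t * K) (𝓝[S] s) (𝓝 (F.T i s * K)) :=
  tendsto_mul_of_isCompactOperator ⟨_, F.eventually_norm_T_le h1 hi⟩ (F.tendsto_T_apply h1 hi hs) hK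

/-- Compactness of `X` passes to its derivatives, so the strong derivatives of `T i` are norm
derivatives of the product at every order. Taking `k` of them involves `T i` up to `T (i + k)`,
whence `i + k ≤ n`. -/
theorem derivBound_T_mul (hC : 0 ≤ C) {i : ℕ} (h1 : 1 ≤ i) (hi : i + k ≤ n)
    (hX : DerivBound S F.g k a C X) (hK : ∀ s ∈ S, IsCompactOperator (X s)) :
    DerivBound S F.g k a (mulConst (bound n α) k * C) (fun s => F.T i s * X s) := by
  have hA : 0 ≤ bound n α := zero_le_one.trans F.one_le_bound
  have hi' : i ≤ n := by omega
  have hle : ∀ s ∈ S, ‖F.T i s * X s‖ ≤ mulConst (bound n α) k * C / F.g s ^ a := fun s hs => by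
    have hg := F.g_pos s hs
    rw [mul_div_assoc]
    exact (norm_mul_le _ _).trans (mul_le_mul
      ((F.norm_T_le h1 hi' hs).trans (le_mulConst hA k)) (hX.norm_le hs) (norm_nonneg _)
      (mulConst_nonneg hA k))
  induction k generalizing i a C X with
  | zero =>
    refine ⟨fun s hs => ?_, hle⟩
    exact tendsto_clm_apply_of_pointwise
      (F := fun t => ContinuousLinearMap.mul ℂ (E →L[ℂ] E) (F.T i t))
      (F.exists_eventually_norm_mul_T_le h1 hi') (F.tendsto_T_mul h1 hi' hs (hK s hs))
      (hX.continuousOn s hs)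
  | succ k ih =>
    obtain ⟨h0, X', hX', hd⟩ := hX
    have hX0 : DerivBound S F.g k a C X := DerivBound.of_succ ⟨h0, X', hX', hd⟩
    have hK' : ∀ s ∈ S, IsCompactOperator (X' s) := fun s hs =>
      isCompactOperator_of_hasDerivWithinAt (F.uniqueDiff s hs) hs hK (hX' s hs)
    have ih' : ∀ {i : ℕ} {a : ℕ} {C : ℝ} {X : ℝ → E →L[ℂ] E}, 0 ≤ C → 1 ≤ i → i + k ≤ n →
        DerivBound S F.g k a C X → (∀ s ∈ S, IsCompactOperator (X s)) →
        DerivBound S F.g k a (mulConst (bound n α) k * C) (fun s => F.T i s * X s) := by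
      intro i a C X hC h1 hi hX hK
      refine ih hC h1 hi hX hK (by omega) fun s hs => ?_
      have hg := F.g_pos s hs
      rw [mul_div_assoc]
      exact (norm_mul_le _ _).trans (mul_le_mul
        ((F.norm_T_le h1 (by omega) hs).trans (le_mulConst hA k)) (hX.norm_le hs)
        (norm_nonneg _) (mulConst_nonneg hA k))
    have hk := mulConst_nonneg hA k
    have hg1 := F.g_le_one
    -- The derivative of `T i X` is `T (i + 1) X - T i T 1 X + T i X'`; these are `t1`, `t2`, `t3`,
    -- and the recursion of `mulConst` leaves room for their sum.
    have t1 := (ih' hC (i := i + 1) (by omega) (by omega) hX0 hK).weaken (by positivity) F.g_pos hg1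
      (Nat.le_succ a)
    have t2 := (ih' (by positivity) h1 (by omega) (ih' hC (i := 1) le_rfl (by omega) hX0 hK)
      (fun s hs => (hK s hs).mul_left _)).weaken (by positivity) F.g_pos hg1 (Nat.le_succ a)
    have t3 := ih' hC h1 (by omega) hd hK'
    refine ⟨hle, _, fun s hs => ?_, ((t1.sub t2).add t3).mono F.g_pos ?_⟩
    · have := HasDerivWithinAt.clm_apply_of_strong
        (F := fun t => ContinuousLinearMap.mul ℂ (E →L[ℂ] E) (F.T i t))
        (F.hasDerivWithinAt_T_mul h1 (by omega) hs (hK s hs))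
        (F.exists_eventually_norm_mul_T_le h1 hi') (F.tendsto_T_mul h1 hi' hs (hK' s hs)) (hX' s hs)
      refine this.congr_deriv ?_
      rw [sub_mul, mul_assoc]
      rfl
    · simp only [mulConst]
      nlinarith

/-- The derivative of `R X`, for a family `X` of compact operators, is again of this form. -/
theorem exists_hasDerivWithinAt_R_mul (hC : 0 ≤ C) (hk : k + 1 ≤ n)
    (hX : DerivBound S F.g (k + 1) a C X) (hK : ∀ s ∈ S, IsCompactOperator (X s)) :
    ∃ X' : ℝ → E →L[ℂ] E, DerivBound S F.g k (a + 1) ((1 + mulConst (bound n α) n) * C) X' ∧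
      (∀ s ∈ S, IsCompactOperator (X' s)) ∧
      ∀ s ∈ S, HasDerivWithinAt (fun t => F.R t * X t) (F.R s * X' s) S s := by
  have hA : 0 ≤ bound n α := zero_le_one.trans F.one_le_bound
  have hn := mulConst_nonneg hA k
  have hkn := mulConst_mono hA (by omega : k ≤ n)
  have hX0 := hX.of_succ
  obtain ⟨h0, X', hX', hd⟩ := hX
  have hK' : ∀ s ∈ S, IsCompactOperator (X' s) := fun s hs =>
    isCompactOperator_of_hasDerivWithinAt (F.uniqueDiff s hs) hs hK (hX' s hs)
  have t1 := (F.derivBound_T_mul hC le_rfl (by omega) hX0 hK).weaken (by positivity) F.g_pos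
    F.g_le_one (Nat.le_succ a)
  refine ⟨fun s => X' s - F.T 1 s * X s, (hd.sub t1).mono F.g_pos (by nlinarith),
    fun s hs => (hK' s hs).sub ((hK s hs).mul_left _), fun s hs => ?_⟩
  have hb : ∀ᶠ t in 𝓝[S] s, ‖F.R t‖ ≤ 1 := by
    filter_upwards [self_mem_nhdsWithin] with t ht using F.norm_R t ht
  have := HasDerivWithinAt.clm_apply_of_strong
    (F := fun t => ContinuousLinearMap.mul ℂ (E →L[ℂ] E) (F.R t))
    (F.hasDerivWithinAt_R_mul hs (hK s hs))
    ⟨1, hb.mono fun t ht => (norm_mulLeft_le _).trans ht⟩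
    (tendsto_mul_of_isCompactOperator ⟨1, hb⟩
      (fun φ => (F.hasDerivWithinAt_R s hs φ).continuousWithinAt) (hK' s hs)) (hX' s hs)
  refine this.congr_deriv ?_
  rw [mul_sub, neg_mul, mul_assoc]
  exact neg_add_eq_sub _ _

/-- Iterating `(R X)' = R (X' - T 1 X)` keeps the factor `R` on the left, so that `H` times the
`l`-th derivative is the bounded operator `Y`. -/
theorem exists_iteratedDerivWithin_R_mul {l : ℕ} (hC : 0 ≤ C) (hk : k ≤ n) (hl : l ≤ k)
    (hX : DerivBound S F.g k a C X) (hK : ∀ s ∈ S, IsCompactOperator (X s)) :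
    ∃ Y : ℝ → E →L[ℂ] E,
      DerivBound S F.g (k - l) (a + l) ((1 + mulConst (bound n α) n) ^ l * C) Y ∧
      EqOn (iteratedDerivWithin l (fun t => F.R t * X t) S) (fun s => F.R s * Y s) S := by
  have hA : 0 ≤ bound n α := zero_le_one.trans F.one_le_bound
  have hn := mulConst_nonneg hA n
  induction l generalizing k a C X with
  | zero => exact ⟨X, by simpa using hX, fun s _ => by simp⟩
  | succ l ih =>
    obtain ⟨k, rfl⟩ : ∃ k', k = k' + 1 := ⟨k - 1, by omega⟩
    obtain ⟨X', h1, h2, h3⟩ := F.exists_hasDerivWithinAt_R_mul hC hk hX hK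
    obtain ⟨Y, h4, h5⟩ := ih (by positivity) (by omega) (by omega : l ≤ k) h1 h2
    refine ⟨Y, ?_, fun s hs => ?_⟩
    · rw [show k + 1 - (l + 1) = k - l by omega, show a + (l + 1) = a + 1 + l by ring,
        pow_succ, mul_assoc]
      exact h4
    · rw [iteratedDerivWithin_succ', ← h5 hs]
      exact iteratedDerivWithin_congr (fun t ht => (h3 t ht).derivWithin (F.uniqueDiff t ht)) hs

end SpectralFamily

/-! ### Induction for the derivatives of all orders and their constants. -/

namespace SpectralFamily

variable {E : Type*} [NormedAddCommGroup E] [InnerProductSpace ℂ E] [CompleteSpace E]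
  {n : ℕ} {α : ℕ → ℝ} {M : ℝ} {N : ℕ} {S : Set ℝ} (F : SpectralFamily E n α M N S) {s t : ℝ}
  {k a : ℕ} {C c : ℝ}

/-- Bounds for `k` derivatives of `P`, of `m = H P` and of the solution of the Sylvester equation. -/
structure RegBound (k : ℕ) (C : ℝ) : Prop where
  P : DerivBound S F.g k 0 C F.P
  m : DerivBound S F.g k 0 C F.m
  Z : ∀ (b : ℕ) (c : ℝ) (B : ℝ → E →L[ℂ] E), 0 ≤ c → DerivBound S F.g k b c B →
    DerivBound S F.g k (b + 1) (C * c) (fun s => F.Z s (B s))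

/-- The constant for the derivative of `P`. -/
def constP' (K C : ℝ) : ℝ := C * (K * C) + C * (K * C)

/-- The constant for the derivative of `m`. -/
def constM' (K p C : ℝ) : ℝ :=
  p * (constP' K C * C) + p * (C * (K * C)) + p * (C * (p * (constP' K C * (1 + C))))

/-- The constant for the products `H Z`. -/
def constY (p C : ℝ) : ℝ := p * (p * ((1 + C) * 1) * C) + p * (C * 1 * C)

/-- The constant for the derivative of the solution of the Sylvester equation. -/
def constZ' (K p C : ℝ) : ℝ :=
  C * (p * (1 * constP' K C) + p * (constP' K C * (p * (C * 1))) + p * (C * 1 * (K * C))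
    + K * constY p C) + p * (constP' K C * (C * 1)) + p * (C * 1 * (p * (constP' K C * (1 + C))))
    + C * 1

/-- The constants in the bounds for the derivatives. -/
noncomputable def regConst (K M : ℝ) : ℕ → ℝ
  | 0 => 1 + M
  | k + 1 => regConst K M k + constP' K (regConst K M k) + constM' K (2 ^ k) (regConst K M k)
      + constZ' K (2 ^ k) (regConst K M k)

theorem constP'_nonneg {K C : ℝ} (hK : 0 ≤ K) (hC : 0 ≤ C) : 0 ≤ constP' K C := by
  rw [constP']; positivity

theorem constM'_nonneg {K p C : ℝ} (hK : 0 ≤ K) (hp : 0 ≤ p) (hC : 0 ≤ C) :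
    0 ≤ constM' K p C := by
  have := constP'_nonneg hK hC
  rw [constM']; positivity

theorem constY_nonneg {p C : ℝ} (hp : 0 ≤ p) (hC : 0 ≤ C) : 0 ≤ constY p C := by
  rw [constY]; positivity

theorem constZ'_nonneg {K p C : ℝ} (hK : 0 ≤ K) (hp : 0 ≤ p) (hC : 0 ≤ C) :
    0 ≤ constZ' K p C := by
  have := constP'_nonneg hK hC
  have := constY_nonneg hp hC
  rw [constZ']; positivity

theorem regConst_nonneg {K M : ℝ} (hK : 0 ≤ K) (hM : 0 ≤ M) : ∀ k, 0 ≤ regConst K M k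
  | 0 => by simp only [regConst]; positivity
  | k + 1 => by
    have h := regConst_nonneg hK hM k
    have h1 := constP'_nonneg hK h
    have h2 := constM'_nonneg (p := 2 ^ k) hK (by positivity) h
    have h3 := constZ'_nonneg (p := 2 ^ k) hK (by positivity) h
    simp only [regConst]; positivity

/-- The constant `mulConst` for the largest number of derivatives. -/
noncomputable def opConst (n : ℕ) (α : ℕ → ℝ) : ℝ := mulConst (bound n α) n

include F

theorem opConst_nonneg : 0 ≤ opConst n α :=
  mulConst_nonneg (zero_le_one.trans F.one_le_bound) n

theorem derivBound_T_one_mul {X : ℝ → E →L[ℂ] E} (hC : 0 ≤ C) (hk : k + 1 ≤ n)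
    (hX : DerivBound S F.g k a C X) (hK : ∀ s ∈ S, IsCompactOperator (X s)) :
    DerivBound S F.g k a (opConst n α * C) (fun s => F.T 1 s * X s) :=
  (F.derivBound_T_mul hC le_rfl (by omega) hX hK).mono F.g_pos
    (mul_le_mul_of_nonneg_right
      (mulConst_mono (zero_le_one.trans F.one_le_bound) (by omega)) hC)

theorem derivBound_one :
    DerivBound S F.g k 0 1 (fun _ => (1 : E →L[ℂ] E)) := by
  refine DerivBound.const 1 ?_ F.g_pos
  rw [ContinuousLinearMap.one_def]
  exact ContinuousLinearMap.norm_id_le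

theorem tendsto_Z_of_tendsto {B : ℝ → E →L[ℂ] E} (hs : s ∈ S)
    (hB : Tendsto B (𝓝[S] s) (𝓝 (B s))) :
    Tendsto (fun t => F.Z t (B t)) (𝓝[S] s) (𝓝 (F.Z s (B s))) :=
  tendsto_clm_apply_of_pointwise ⟨_, F.eventually_norm_Z_le hs⟩ (F.tendsto_Z_apply _ hs) hB

theorem hasDerivWithinAt_Z {B : ℝ → E →L[ℂ] E} {B' : E →L[ℂ] E} (hs : s ∈ S)
    (hB : HasDerivWithinAt B B' S s) :
    HasDerivWithinAt (fun t => F.Z t (B t)) (F.Z' s (B s) + F.Z s B') S s :=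
  HasDerivWithinAt.clm_apply_of_strong (F.hasDerivWithinAt_Z_apply _ hs)
    ⟨_, F.eventually_norm_Z_le hs⟩ (F.tendsto_Z_apply _ hs) hB

theorem regBound_zero : F.RegBound 0 (1 + M) := by
  have hM := F.M_nonneg
  refine ⟨⟨fun s hs => F.tendsto_P hs, fun s hs => ?_⟩, ⟨fun s hs => F.tendsto_m hs, fun s hs => ?_⟩,
    fun b c B hc hB => ⟨fun s hs => F.tendsto_Z_of_tendsto hs (hB.1 s hs), fun s hs => ?_⟩⟩
  · rw [pow_zero, div_one]
    linarith [F.norm_P hs]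
  · rw [pow_zero, div_one]
    linarith [F.norm_m s hs]
  · have hg := F.g_pos s hs
    refine (F.norm_Z_apply_le (B s) hs).trans ?_
    rw [pow_succ, ← div_div]
    gcongr
    refine (hB.2 s hs).trans ?_
    gcongr
    nlinarith

theorem derivBound_Y (h : F.RegBound k C) (hC : 0 ≤ C) {b : ℕ} {B : ℝ → E →L[ℂ] E} (hc : 0 ≤ c)
    (hB : DerivBound S F.g k b c B) :
    DerivBound S F.g k (b + 1) (constY (2 ^ k) C * c) (fun s => F.Y s (B s)) := by
  have h1 := ((((F.derivBound_one).sub h.P).mul hB (by positivity) hc F.g_pos).mul h.P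
    (by positivity) hC F.g_pos).weaken (b := b + 1) (by positivity) F.g_pos F.g_le_one (by omega)
  have h2 := (h.Z b c B hc hB).mul h.m (by positivity) hC F.g_pos
  exact (h1.add h2).mono F.g_pos (le_of_eq (by rw [constY]; ring))

theorem derivBound_P' (h : F.RegBound k C) (hC : 0 ≤ C) (hk : k + 1 ≤ n) :
    DerivBound S F.g k 1 (constP' (opConst n α) C) F.P' := by
  have hK := F.opConst_nonneg
  have h1 := h.Z 0 _ _ (by positivity)
    (F.derivBound_T_one_mul hC hk h.m fun s hs => F.isCompactOperator_m hs)
  exact (h1.add h1.star).neg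

theorem derivBound_m' (h : F.RegBound k C) (hC : 0 ≤ C) (hk : k + 1 ≤ n) :
    DerivBound S F.g k 1 (constM' (opConst n α) (2 ^ k) C) F.m' := by
  have hK := F.opConst_nonneg
  have hC' := constP'_nonneg hK hC
  have hP' := F.derivBound_P' h hC hk
  have h1 := hP'.mul h.m hC' hC F.g_pos
  have h2 := (h.P.mul (F.derivBound_T_one_mul hC hk h.m fun s hs => F.isCompactOperator_m hs) hC
    (by positivity) F.g_pos).weaken (b := 1) (by positivity) F.g_pos F.g_le_one (by omega)
  have h3 := h.m.mul (hP'.mul ((F.derivBound_one).sub h.P) hC' (by positivity) F.g_pos) hC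
    (by positivity) F.g_pos
  exact (h1.add h2).add h3

theorem derivBound_Z' (h : F.RegBound k C) (hC : 0 ≤ C) (hk : k + 1 ≤ n) {b : ℕ}
    {B B' : ℝ → E →L[ℂ] E} (hc : 0 ≤ c) (hB : DerivBound S F.g k b c B)
    (hB' : DerivBound S F.g k (b + 1) c B') :
    DerivBound S F.g k (b + 2) (constZ' (opConst n α) (2 ^ k) C * c)
      (fun s => F.Z' s (B s) + F.Z s (B' s)) := by
  have hK := F.opConst_nonneg
  have hC' := constP'_nonneg hK hC
  have hY := constY_nonneg (p := 2 ^ k) (by positivity) hC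
  have hP' := F.derivBound_P' h hC hk
  have hZ := h.Z b c B hc hB
  have h1 := hB.mul hP' hc hC' F.g_pos
  have h2 := hP'.mul (h.P.mul hB hC hc F.g_pos) hC' (by positivity) F.g_pos
  rw [zero_add, add_comm] at h2
  have h3 := hZ.mul (F.derivBound_T_one_mul hC hk h.m fun s hs => F.isCompactOperator_m hs)
    (by positivity) (by positivity) F.g_pos
  have h4 := F.derivBound_T_one_mul (by positivity) hk (F.derivBound_Y h hC hc hB)
    fun s hs => F.isCompactOperator_Y _ hs
  have h5 := h.Z (b + 1) _ _ (by positivity) (((h1.sub h2).add h3).sub h4)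
  have h6 := hP'.mul hZ hC' (by positivity) F.g_pos
  rw [show 1 + (b + 1) = b + 2 by ring] at h6
  have h7 := hZ.mul (hP'.mul ((F.derivBound_one).sub h.P) hC' (by positivity) F.g_pos)
    (by positivity) (by positivity) F.g_pos
  exact (((h5.sub h6).add h7).add (h.Z (b + 1) c B' hc hB')).mono F.g_pos
    (le_of_eq (by rw [constZ']; ring))

/-- `P'`, `m'` and the derivative of `Z B` are polynomials in quantities that already have `k`
derivatives. `RegBound.Z` is quantified over all families `B` because that derivative applies `Z` to
other families, such as `T 1` times `Y B`. -/
theorem RegBound.succ (h : F.RegBound k C) (hC : 0 ≤ C) (hk : k + 1 ≤ n) :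
    F.RegBound (k + 1) (C + constP' (opConst n α) C + constM' (opConst n α) (2 ^ k) C
      + constZ' (opConst n α) (2 ^ k) C) := by
  have hK := F.opConst_nonneg
  have h1 := constP'_nonneg hK hC
  have h2 := constM'_nonneg (p := 2 ^ k) hK (by positivity) hC
  have h3 := constZ'_nonneg (p := 2 ^ k) hK (by positivity) hC
  have hg := F.g_pos
  refine ⟨⟨fun s hs => ?_, F.P', fun s hs => F.hasDerivWithinAt_P hs,
    (F.derivBound_P' h hC hk).mono hg ?_⟩, ⟨fun s hs => ?_, F.m', fun s hs => F.hasDerivWithinAt_m hs,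
    (F.derivBound_m' h hC hk).mono hg ?_⟩, fun b c B hc hB => ?_⟩
  · exact (h.P.mono (D := C + constP' (opConst n α) C + constM' (opConst n α) (2 ^ k) C
      + constZ' (opConst n α) (2 ^ k) C) hg (by linarith)).norm_le hs
  · linarith
  · exact (h.m.mono (D := C + constP' (opConst n α) C + constM' (opConst n α) (2 ^ k) C
      + constZ' (opConst n α) (2 ^ k) C) hg (by linarith)).norm_le hs
  · linarith
  · have hB0 := hB.of_succ
    obtain ⟨-, B', hB', hd⟩ := hB
    have hle : ∀ x : ℝ, x ≤ C + constP' (opConst n α) C + constM' (opConst n α) (2 ^ k) C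
      + constZ' (opConst n α) (2 ^ k) C → x * c ≤ (C + constP' (opConst n α) C +
        constM' (opConst n α) (2 ^ k) C + constZ' (opConst n α) (2 ^ k) C) * c := fun x hx =>
      mul_le_mul_of_nonneg_right hx hc
    exact ⟨fun s hs => ((h.Z b c B hc hB0).mono hg (hle _ (by linarith))).norm_le hs, _,
      fun s hs => F.hasDerivWithinAt_Z hs (hB' s hs),
      (F.derivBound_Z' h hC hk hc hB0 hd).mono hg (hle _ (by linarith))⟩

theorem regBound (hk : k ≤ n) : F.RegBound k (regConst (opConst n α) M k) := by
  have hK := F.opConst_nonneg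
  induction k with
  | zero => exact F.regBound_zero
  | succ k ih =>
    exact (ih (by omega)).succ F (regConst_nonneg hK F.M_nonneg k) hk

end SpectralFamily

/-! ### The partial inverse of the Liouvillian: formulas, bounds and rank. -/

namespace SpectralFamily

variable {E : Type*} [NormedAddCommGroup E] [InnerProductSpace ℂ E] [CompleteSpace E]
  {n : ℕ} {α : ℕ → ℝ} {M : ℝ} {N : ℕ} {S : Set ℝ} (F : SpectralFamily E n α M N S) {s t : ℝ}
  (A B : E →L[ℂ] E)

/-- The superoperator `A ↦ (Z A*)*`. -/
noncomputable def conjStar (Z : (E →L[ℂ] E) →L[ℂ] (E →L[ℂ] E)) :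
    (E →L[ℂ] E) →L[ℂ] (E →L[ℂ] E) :=
  ((starL ℂ : (E →L[ℂ] E) ≃L⋆[ℂ] (E →L[ℂ] E)) : (E →L[ℂ] E) →L⋆[ℂ] (E →L[ℂ] E)).comp
    (Z.comp ((starL ℂ : (E →L[ℂ] E) ≃L⋆[ℂ] (E →L[ℂ] E)) : (E →L[ℂ] E) →L⋆[ℂ] (E →L[ℂ] E)))

theorem conjStar_apply (Z : (E →L[ℂ] E) →L[ℂ] (E →L[ℂ] E)) (A : E →L[ℂ] E) :
    conjStar Z A = star (Z (star A)) := rfl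

/-- The partial inverse of the Liouvillian. -/
noncomputable def K (s : ℝ) : (E →L[ℂ] E) →L[ℂ] (E →L[ℂ] E) :=
  F.Z s - conjStar (F.Z s)

theorem K_apply : F.K s A = F.Z s A - star (F.Z s (star A)) := rfl

/-- The product of `H` and the partial inverse of the Liouvillian. -/
noncomputable def HK (s : ℝ) (A : E →L[ℂ] E) : E →L[ℂ] E :=
  F.Y s A - F.m s * star (F.Z s (star A))

include F

theorem P_mul_star_Z (hs : s ∈ S) : F.P s * star (F.Z s B) = star (F.Z s B) := by
  have := congrArg star (F.Z_mul_P B hs)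
  rwa [star_mul, F.star_P s hs] at this

theorem star_Z_mul_P (hs : s ∈ S) : star (F.Z s B) * F.P s = 0 := by
  have := congrArg star (F.P_mul_Z B hs)
  rwa [star_mul, F.star_P s hs, star_zero] at this

theorem R_mul_HK (hs : s ∈ S) : F.R s * F.HK s A = F.K s A := by
  rw [HK, mul_sub, F.R_mul_Y A hs, ← mul_assoc, F.R_mul_m s hs, F.P_mul_star_Z _ hs, F.K_apply]

theorem isCompactOperator_star_Z (hs : s ∈ S) : IsCompactOperator (star (F.Z s B) : E →L[ℂ] E) := by
  rw [← F.P_mul_star_Z B hs]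
  exact (F.isCompactOperator_P hs).mul_right _

theorem isCompactOperator_HK (hs : s ∈ S) : IsCompactOperator (F.HK s A) :=
  (F.isCompactOperator_Y A hs).sub ((F.isCompactOperator_star_Z _ hs).mul_left _)

theorem Z_eq_zero (hs : s ∈ S) (hB : (1 - F.P s) * B * F.P s = 0) : F.Z s B = 0 :=
  (F.eq_Z_of_eq B hs (X := 0) (Y := 0) (by simp) (by simp) (by simp) (by simp [hB])).symm

/-- The argument represents `[P, H']`, since `H' P = T 1 m`. The term `(T 1 m)* = P (T 1 m)*` has no
`Q · P` block and is killed by `Z`. -/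
theorem P'_eq_K (hs : s ∈ S) :
    F.P' s = F.K s (star (F.T 1 s * F.m s) - F.T 1 s * F.m s) := by
  have h : F.Z s (star (F.T 1 s * F.m s)) = 0 := by
    refine F.Z_eq_zero _ hs ?_
    rw [star_mul, F.star_m s hs, ← F.P_mul_m hs, ← mul_assoc, ← mul_assoc, F.Q_mul_P hs]
    simp
  rw [K_apply, star_sub, star_star, map_sub, map_sub, h, P']
  simp only [sub_zero, zero_sub]
  abel

theorem rank_K_le (hs : s ∈ S) :
    LinearMap.rank (F.K s A : E →ₗ[ℂ] E) ≤ ((2 * N : ℕ) : Cardinal) := by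
  have h1 : LinearMap.rank (F.Z s A : E →ₗ[ℂ] E) ≤ N := by
    rw [← F.Z_mul_P A hs, ← F.rank_P s hs]
    exact LinearMap.rank_comp_le_right (F.P s : E →ₗ[ℂ] E) (F.Z s A : E →ₗ[ℂ] E)
  have h2 : LinearMap.rank ((-star (F.Z s (star A)) : E →L[ℂ] E) : E →ₗ[ℂ] E) ≤ N := by
    rw [← F.P_mul_star_Z _ hs, ← F.rank_P s hs, ← mul_neg]
    exact LinearMap.rank_comp_le_left ((-star (F.Z s (star A)) : E →L[ℂ] E) : E →ₗ[ℂ] E) (F.P s : E →ₗ[ℂ] E)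
  have h3 := LinearMap.rank_add_le (F.Z s A : E →ₗ[ℂ] E)
    ((-star (F.Z s (star A)) : E →L[ℂ] E) : E →ₗ[ℂ] E)
  rw [K_apply, sub_eq_add_neg]
  refine h3.trans ((add_le_add h1 h2).trans (le_of_eq ?_))
  push_cast
  ring

theorem derivBound_HK {k : ℕ} (hk : k ≤ n) :
    DerivBound S F.g k 1 ((constY (2 ^ k) (regConst (opConst n α) M k) +
      2 ^ k * (regConst (opConst n α) M k * regConst (opConst n α) M k)) * ‖A‖)
      (fun s => F.HK s A) := by
  have hC := regConst_nonneg F.opConst_nonneg F.M_nonneg k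
  have h := F.regBound hk
  have h1 := F.derivBound_Y h hC (norm_nonneg A) (DerivBound.const A le_rfl F.g_pos)
  have h2 := h.Z 0 ‖A‖ _ (norm_nonneg A) (DerivBound.const (star A) (norm_star A).le F.g_pos)
  have h3 := h.m.mul h2.star hC (by positivity) F.g_pos
  exact (h1.sub h3).mono F.g_pos (le_of_eq (by ring))

theorem contDiffOn_P : ContDiffOn ℝ n F.P S :=
  (F.regBound le_rfl).P.contDiffOn F.uniqueDiff

theorem contDiffOn_K_apply : ContDiffOn ℝ n (fun s => F.K s A) S := by
  have h := F.regBound (le_refl n)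
  have h1 := h.Z 0 ‖A‖ _ (norm_nonneg A) (DerivBound.const A le_rfl F.g_pos)
  have h2 := h.Z 0 ‖A‖ _ (norm_nonneg A) (DerivBound.const (star A) (norm_star A).le F.g_pos)
  exact (h1.sub h2.star).contDiffOn F.uniqueDiff

/-- The constant in the final bounds. -/
noncomputable def finalConst (n : ℕ) (α : ℕ → ℝ) (M : ℝ) (l : ℕ) : ℝ :=
  (1 + opConst n α) ^ l * (regConst (opConst n α) M n +
    (constY (2 ^ n) (regConst (opConst n α) M n) +
      2 ^ n * (regConst (opConst n α) M n * regConst (opConst n α) M n)))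

omit F in
theorem finalConst_nonneg {n : ℕ} {α : ℕ → ℝ} {M : ℝ} (hα : ∀ i, 0 ≤ α i) (hM : 0 ≤ M) (l : ℕ) :
    0 ≤ finalConst n α M l := by
  have h0 : 0 ≤ bound n α := by
    rw [bound]
    exact add_nonneg zero_le_one (Finset.sum_nonneg fun i _ => hα i)
  have h1 : 0 ≤ opConst n α := mulConst_nonneg h0 n
  have h2 := regConst_nonneg h1 hM n
  have h3 := constY_nonneg (p := 2 ^ n) (by positivity) h2
  rw [finalConst]
  positivity

/-- Here `P = R m`, and `m` starts at power `0` of `1 / g`, so the power `l` would do. It is raised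
to `l + 1` using `g ≤ 1`. -/
theorem exists_iteratedDerivWithin_P {l : ℕ} (hl : l ≤ n) (hs : s ∈ S) :
    ∃ Y : E →L[ℂ] E, ‖Y‖ ≤ finalConst n α M l / F.g s ^ (l + 1) ∧
      iteratedDerivWithin l F.P S s = F.R s * Y := by
  have hα := F.opConst_nonneg
  have hC := regConst_nonneg F.opConst_nonneg F.M_nonneg n
  have h3 := constY_nonneg (p := 2 ^ n) (by positivity) hC
  obtain ⟨Y, h1, h2⟩ := F.exists_iteratedDerivWithin_R_mul hC le_rfl hl (F.regBound le_rfl).m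
    fun s hs => F.isCompactOperator_m hs
  refine ⟨Y s, (((h1.weaken (b := l + 1) (by positivity) F.g_pos F.g_le_one (by omega)).mono
    (D := finalConst n α M l) F.g_pos ?_).norm_le hs), ?_⟩
  · rw [finalConst]
    refine mul_le_mul_of_nonneg_left ?_ (by positivity)
    have : 0 ≤ 2 ^ n * (regConst (opConst n α) M n * regConst (opConst n α) M n) := by positivity
    linarith
  · have h4 := h2 hs
    simp only at h4
    rw [← h4]
    exact iteratedDerivWithin_congr (fun t ht => (F.R_mul_m t ht).symm) hs

theorem exists_iteratedDerivWithin_K {l : ℕ} (hl : l ≤ n) (hs : s ∈ S) :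
    ∃ Y : E →L[ℂ] E, ‖Y‖ ≤ finalConst n α M l / F.g s ^ (l + 3) * ‖A‖ ∧
      iteratedDerivWithin l (fun t => F.K t A) S s = F.R s * Y := by
  have hα := F.opConst_nonneg
  have hC := regConst_nonneg F.opConst_nonneg F.M_nonneg n
  have h3 := constY_nonneg (p := 2 ^ n) (by positivity) hC
  obtain ⟨Y, h1, h2⟩ := F.exists_iteratedDerivWithin_R_mul (by positivity) le_rfl hl
    (F.derivBound_HK A le_rfl) fun s hs => F.isCompactOperator_HK A hs
  refine ⟨Y s, ?_, ?_⟩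
  · rw [div_mul_eq_mul_div]
    refine (((h1.weaken (b := l + 3) (by positivity) F.g_pos F.g_le_one (by omega)).mono
      (D := finalConst n α M l * ‖A‖) F.g_pos ?_).norm_le hs)
    rw [finalConst, ← mul_assoc]
    refine mul_le_mul_of_nonneg_right (mul_le_mul_of_nonneg_left ?_ (by positivity)) (norm_nonneg A)
    rw [opConst] at hC
    exact le_add_of_nonneg_left hC
  · have h4 := h2 hs
    simp only at h4
    rw [← h4]
    exact iteratedDerivWithin_congr (fun t ht => (F.R_mul_HK A ht).symm) hs

end SpectralFamily

/-! ### Regularity of the partial inverse in superoperator norm. -/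

theorem contDiffOn_succ_of_pointwise {X Y : Type*} [NormedAddCommGroup X] [NormedSpace ℂ X]
    [NormedAddCommGroup Y] [NormedSpace ℂ Y] {F F' : ℝ → X →L[ℂ] Y} {S : Set ℝ}
    (hS : Convex ℝ S) (hu : UniqueDiffOn ℝ S)
    (hF : ∀ u ∈ S, ∀ x, HasDerivWithinAt (fun t => F t x) (F' u x) S u) {k : ℕ}
    (hF' : ContDiffOn ℝ k F' S) : ContDiffOn ℝ (k + 1 : ℕ) F S := by
  have hd : ∀ s ∈ S, HasDerivWithinAt F (F' s) S s := fun s hs =>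
    hasDerivWithinAt_of_pointwise hS hF hs (hF'.continuousOn s hs)
  have : ((k + 1 : ℕ) : WithTop ℕ∞) = (k : WithTop ℕ∞) + 1 := by push_cast; rfl
  rw [this, contDiffOn_succ_iff_derivWithin hu]
  refine ⟨fun s hs => (hd s hs).differentiableWithinAt, by simp, ?_⟩
  exact hF'.congr fun s hs => (hd s hs).derivWithin (hu s hs)

theorem ContinuousLinearMap.contDiffOn_comp {V W : Type*} [NormedAddCommGroup V] [NormedSpace ℂ V]
    [NormedAddCommGroup W] [NormedSpace ℂ W] (L : V →L[ℂ] W) {X : ℝ → V} {S : Set ℝ} {k : ℕ}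
    (h : ContDiffOn ℝ k X S) : ContDiffOn ℝ k (fun s => L (X s)) S :=
  (L.restrictScalars ℝ).contDiff.comp_contDiffOn h

theorem ContinuousLinearMap.isBigO_one_comp {V W : Type*} [NormedAddCommGroup V] [NormedSpace ℂ V]
    [NormedAddCommGroup W] [NormedSpace ℂ W] (L : V →L[ℂ] W) {X : ℝ → V} {l : Filter ℝ}
    (h : X =O[l] fun _ => (1 : ℝ)) : (fun s => L (X s)) =O[l] fun _ => (1 : ℝ) :=
  (L.isBigO_comp X l).trans h

section Superoperators

variable {E : Type*} [NormedAddCommGroup E] [NormedSpace ℂ E] {S : Set ℝ} {k : ℕ}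

/-- Left multiplication, as a superoperator. -/
noncomputable abbrev mulL (A : E →L[ℂ] E) : (E →L[ℂ] E) →L[ℂ] (E →L[ℂ] E) :=
  ContinuousLinearMap.mul ℂ (E →L[ℂ] E) A

/-- Right multiplication, as a bounded linear map into the superoperators. -/
noncomputable def mulRight : (E →L[ℂ] E) →L[ℂ] (E →L[ℂ] E) →L[ℂ] (E →L[ℂ] E) :=
  (ContinuousLinearMap.mul ℂ (E →L[ℂ] E)).flip

/-- Right multiplication, as a superoperator. -/
noncomputable abbrev mulR (A : E →L[ℂ] E) : (E →L[ℂ] E) →L[ℂ] (E →L[ℂ] E) :=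
  mulRight A

theorem contDiffOn_mulL {X : ℝ → E →L[ℂ] E} (h : ContDiffOn ℝ k X S) :
    ContDiffOn ℝ k (fun s => mulL (X s)) S :=
  ContinuousLinearMap.contDiffOn_comp (V := E →L[ℂ] E)
    (W := (E →L[ℂ] E) →L[ℂ] (E →L[ℂ] E))
    (ContinuousLinearMap.mul ℂ _) h

theorem contDiffOn_mulR {X : ℝ → E →L[ℂ] E} (h : ContDiffOn ℝ k X S) :
    ContDiffOn ℝ k (fun s => mulR (X s)) S :=
  ContinuousLinearMap.contDiffOn_comp (V := E →L[ℂ] E)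
    (W := (E →L[ℂ] E) →L[ℂ] (E →L[ℂ] E))
    mulRight h

theorem isBigO_mulL {X : ℝ → E →L[ℂ] E} {l : Filter ℝ} (h : X =O[l] fun _ => (1 : ℝ)) :
    (fun s => mulL (X s)) =O[l] fun _ => (1 : ℝ) :=
  ContinuousLinearMap.isBigO_one_comp (V := E →L[ℂ] E)
    (W := (E →L[ℂ] E) →L[ℂ] (E →L[ℂ] E))
    (ContinuousLinearMap.mul ℂ _) h

theorem isBigO_mulR {X : ℝ → E →L[ℂ] E} {l : Filter ℝ} (h : X =O[l] fun _ => (1 : ℝ)) :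
    (fun s => mulR (X s)) =O[l] fun _ => (1 : ℝ) :=
  ContinuousLinearMap.isBigO_one_comp (V := E →L[ℂ] E)
    (W := (E →L[ℂ] E) →L[ℂ] (E →L[ℂ] E))
    mulRight h

end Superoperators

namespace SpectralFamily

variable {E : Type*} [NormedAddCommGroup E] [InnerProductSpace ℂ E] [CompleteSpace E]
  {n : ℕ} {α : ℕ → ℝ} {M : ℝ} {N : ℕ} {S : Set ℝ} (F : SpectralFamily E n α M N S) {s t : ℝ}
  (A B : E →L[ℂ] E) {k : ℕ}

/-- The superoperator `A ↦ H Z A`. -/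
noncomputable def superY (s : ℝ) : (E →L[ℂ] E) →L[ℂ] (E →L[ℂ] E) :=
  mulL (1 - F.P s) * mulR (F.P s) + mulR (F.m s) * F.Z s

/-- The derivative of `Z`, as a superoperator. -/
noncomputable def superZ' (s : ℝ) : (E →L[ℂ] E) →L[ℂ] (E →L[ℂ] E) :=
  F.Z s * (mulR (F.P' s) - mulL (F.P' s) * mulL (F.P s) + mulR (F.T 1 s * F.m s) * F.Z s)
    - (mulL (1 - F.P s) * mulR (F.P s) + mulR (F.m s) * F.Z s) *
      (mulL (F.R s * F.T 1 s) * F.superY s)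
    - mulL (F.P' s) * F.Z s + mulR (F.P' s * (1 - F.P s)) * F.Z s

include F

/-- `R` commutes with `H` and `P`, so `R Z(B) = Z(R B)` and `Z(B) = H Z(R B)`. Only `R B` enters,
which lets `superZ'` replace `T 1` on the left by `R T 1`, a family with better norm regularity. -/
theorem Z_eq_of_R_mul (hs : s ∈ S) :
    F.Z s B = (1 - F.P s) * (F.R s * B) * F.P s + F.Z s (F.R s * B) * F.m s := by
  have hQR : F.R s * (1 - F.P s) = (1 - F.P s) * F.R s := by
    rw [mul_sub, sub_mul, F.P_mul_R hs]; simp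
  refine (F.eq_Z_of_eq B hs (Y := (1 - F.P s) * B * F.P s + F.Y s (F.R s * B) * F.m s)
    ?_ ?_ ?_ ?_).symm
  · rw [mul_add, ← mul_assoc (F.R s) (F.Y s _), F.R_mul_Y _ hs]
    congr 1
    simp only [← mul_assoc, hQR]
  · rw [mul_add, ← mul_assoc (F.P s) (F.Z s _), F.P_mul_Z _ hs, ← mul_assoc, ← mul_assoc, F.P_mul_Q hs]
    simp
  · rw [add_mul, mul_assoc _ (F.P s), F.P_mul_P s hs, mul_assoc _ (F.m s), F.m_mul_P s hs]
  · have : F.Y s (F.R s * B) = (1 - F.P s) * (F.R s * B) * F.P s + F.Z s (F.R s * B) * F.m s := rfl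
    rw [← this, add_sub_cancel_right]

theorem superZ'_apply (hs : s ∈ S) : F.superZ' s A = F.Z' s A := by
  have h : F.superZ' s A = F.Z s (A * F.P' s - F.P' s * (F.P s * A) + F.Z s A * (F.T 1 s * F.m s))
    - ((1 - F.P s) * (F.R s * F.T 1 s * ((1 - F.P s) * (A * F.P s) + F.Z s A * F.m s) * F.P s)
      + F.Z s (F.R s * F.T 1 s * ((1 - F.P s) * (A * F.P s) + F.Z s A * F.m s)) * F.m s)
    - F.P' s * F.Z s A + F.Z s A * (F.P' s * (1 - F.P s)) := rfl
  rw [h, Z', map_sub (F.Z s) (_ + _), F.Z_eq_of_R_mul (F.T 1 s * F.Y s A) hs, Y]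
  simp only [mul_assoc]

theorem hasDerivWithinAt_Z_apply_superZ' (hs : s ∈ S) :
    HasDerivWithinAt (fun t => F.Z t A) (F.superZ' s A) S s := by
  rw [F.superZ'_apply A hs]
  exact F.hasDerivWithinAt_Z_apply A hs

theorem contDiffOn_m : ContDiffOn ℝ n F.m S :=
  (F.regBound le_rfl).m.contDiffOn F.uniqueDiff

theorem contDiffOn_P' (hk : k + 1 ≤ n) : ContDiffOn ℝ k F.P' S :=
  (F.derivBound_P' (F.regBound (by omega)) (regConst_nonneg F.opConst_nonneg F.M_nonneg k)
    hk).contDiffOn F.uniqueDiff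

theorem contDiffOn_T_mul_m (hk : k + 1 ≤ n) : ContDiffOn ℝ k (fun s => F.T 1 s * F.m s) S :=
  (F.derivBound_T_one_mul (regConst_nonneg F.opConst_nonneg F.M_nonneg k) hk
    (F.regBound (by omega)).m fun s hs => F.isCompactOperator_m hs).contDiffOn F.uniqueDiff

theorem contDiffOn_P_of_le (hk : k ≤ n) : ContDiffOn ℝ k F.P S :=
  F.contDiffOn_P.of_le (by exact_mod_cast hk)

theorem contDiffOn_m_of_le (hk : k ≤ n) : ContDiffOn ℝ k F.m S :=
  F.contDiffOn_m.of_le (by exact_mod_cast hk)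

theorem isBigO_superZ' (hs : s ∈ S) : F.superZ' =O[𝓝[S] s] fun _ => (1 : ℝ) := by
  have hc : ∀ {X : ℝ → E →L[ℂ] E}, ContDiffOn ℝ (0 : ℕ) X S → X =O[𝓝[S] s] fun _ => (1 : ℝ) :=
    fun hX => Tendsto.isBigO_one ℝ (hX.continuousOn s hs)
  have hmul : ∀ {X Y : ℝ → (E →L[ℂ] E) →L[ℂ] (E →L[ℂ] E)}, X =O[𝓝[S] s] (fun _ => (1 : ℝ)) →
      Y =O[𝓝[S] s] (fun _ => (1 : ℝ)) → (fun s => X s * Y s) =O[𝓝[S] s] fun _ => (1 : ℝ) :=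
    fun hX hY => by simpa using hX.mul hY
  have hn := F.one_le
  have hP := hc (F.contDiffOn_P_of_le (Nat.zero_le n))
  have hm := isBigO_mulR (hc (F.contDiffOn_m_of_le (Nat.zero_le n)))
  have hQ := hc ((contDiffOn_const (c := (1 : E →L[ℂ] E))).sub (F.contDiffOn_P_of_le (Nat.zero_le n)))
  have hP' := hc (F.contDiffOn_P' (k := 0) (by omega))
  have hP'Q := hc ((F.contDiffOn_P' (k := 0) (by omega)).mul
    ((contDiffOn_const (c := (1 : E →L[ℂ] E))).sub (F.contDiffOn_P_of_le (Nat.zero_le n))))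
  have hT := hc (F.contDiffOn_T_mul_m (k := 0) (by omega))
  have hZ : F.Z =O[𝓝[S] s] fun _ => (1 : ℝ) :=
    Asymptotics.IsBigO.of_bound (4 / F.g s)
      ((F.eventually_norm_Z_le hs).mono fun t ht => by simpa using ht)
  have hV : (fun s => F.R s * F.T 1 s) =O[𝓝[S] s] fun _ => (1 : ℝ) := by
    refine Asymptotics.IsBigO.of_bound (1 * bound n α) ?_
    filter_upwards [self_mem_nhdsWithin] with t ht
    rw [norm_one, mul_one]
    exact (norm_mul_le _ _).trans (mul_le_mul (F.norm_R t ht) (F.norm_T_le le_rfl hn ht)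
      (norm_nonneg _) zero_le_one)
  have hY := (hmul (isBigO_mulL hQ) (isBigO_mulR hP)).add (hmul hm hZ)
  exact (((hmul hZ (((isBigO_mulR hP').sub (hmul (isBigO_mulL hP') (isBigO_mulL hP))).add
    (hmul (isBigO_mulR hT) hZ))).sub (hmul hY (hmul (isBigO_mulL hV) hY))).sub
    (hmul (isBigO_mulL hP') hZ)).add (hmul (isBigO_mulR hP'Q) hZ)

/-- The derivative of `Z` is a polynomial in `Z` itself and families already under control, so
regularity bootstraps. It starts from norm continuity, for which a locally bounded pointwise
derivative is enough. -/
theorem contDiffOn_Z (hk : k ≤ n)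
    (hV : ∀ j, j + 1 ≤ k → ContDiffOn ℝ j (fun s => F.R s * F.T 1 s) S) :
    ContDiffOn ℝ k F.Z S := by
  induction k with
  | zero =>
    rw [Nat.cast_zero, contDiffOn_zero]
    refine fun s hs => continuousWithinAt_of_pointwise_hasDerivWithinAt F.convex
      (fun u hu A => F.hasDerivWithinAt_Z_apply_superZ' A hu) hs ?_
    simpa using (F.isBigO_superZ' hs).bound
  | succ k ih =>
    have hZ := ih (by omega) fun j hj => hV j (by omega)
    refine contDiffOn_succ_of_pointwise F.convex F.uniqueDiff
      (fun u hu A => F.hasDerivWithinAt_Z_apply_superZ' A hu) ?_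
    have hP := F.contDiffOn_P_of_le (k := k) (by omega)
    have hm := contDiffOn_mulR (F.contDiffOn_m_of_le (k := k) (by omega))
    have hQ := (contDiffOn_const (c := (1 : E →L[ℂ] E))).sub hP
    have hP' := F.contDiffOn_P' hk
    have hT := contDiffOn_mulR (F.contDiffOn_T_mul_m hk)
    have hY := ((contDiffOn_mulL hQ).mul (contDiffOn_mulR hP)).add (hm.mul hZ)
    exact (((hZ.mul (((contDiffOn_mulR hP').sub ((contDiffOn_mulL hP').mul (contDiffOn_mulL hP))).add
      (hT.mul hZ))).sub (hY.mul ((contDiffOn_mulL (hV k le_rfl)).mul hY))).sub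
      ((contDiffOn_mulL hP').mul hZ)).add ((contDiffOn_mulR (hP'.mul hQ)).mul hZ)

/-- `conjStar`, as a bounded real-linear map. -/
noncomputable def conjStarL :
    ((E →L[ℂ] E) →L[ℂ] (E →L[ℂ] E)) →L[ℝ] ((E →L[ℂ] E) →L[ℂ] (E →L[ℂ] E)) :=
  LinearMap.mkContinuous
    { toFun := conjStar
      map_add' := fun Z Z' => by ext1 A; simp [conjStar_apply]
      map_smul' := fun r Z => by
        ext1 A
        simp only [conjStar_apply, smul_apply, star_smul, star_trivial, RingHom.id_apply] }
    1 fun Z => by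
      rw [one_mul]
      refine ContinuousLinearMap.opNorm_le_bound _ (norm_nonneg _) fun A => ?_
      have := Z.le_opNorm (star A)
      rw [norm_star] at this
      exact (norm_star (Z (star A))).le.trans this

theorem contDiffOn_K (hZ : ContDiffOn ℝ k F.Z S) : ContDiffOn ℝ k F.K S :=
  hZ.sub ((conjStarL (E := E)).contDiff.comp_contDiffOn hZ)

/-- The inequality `i + k < n` is strict because `T n` is only strongly continuous; a strong
derivative bounded in norm gives norm continuity one order below. -/
theorem contDiffOn_T {i : ℕ} (h1 : 1 ≤ i) (hi : i + k < n) : ContDiffOn ℝ k (F.T i) S := by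
  induction k generalizing i with
  | zero =>
    rw [Nat.cast_zero, contDiffOn_zero]
    refine fun s hs => continuousWithinAt_of_pointwise_hasDerivWithinAt F.convex
      (F' := fun u => F.T (i + 1) u - F.T i u * F.T 1 u)
      (fun u hu => F.hasDerivWithinAt_T i h1 (by omega) u hu) hs
      ⟨bound n α + bound n α * bound n α, ?_⟩
    filter_upwards [self_mem_nhdsWithin] with t ht
    exact (norm_sub_le _ _).trans (add_le_add (F.norm_T_le (by omega) (by omega) ht)
      (F.norm_T_mul_T_le h1 (by omega) le_rfl F.one_le ht))
  | succ k ih =>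
    exact contDiffOn_succ_of_pointwise F.convex F.uniqueDiff
      (F' := fun u => F.T (i + 1) u - F.T i u * F.T 1 u)
      (fun u hu => F.hasDerivWithinAt_T i h1 (by omega) u hu)
      ((ih (by omega) (by omega)).sub ((ih h1 (by omega)).mul (ih le_rfl (by omega))))

theorem continuousOn_R : ContinuousOn F.R S := fun s hs =>
  continuousWithinAt_of_pointwise_hasDerivWithinAt F.convex
    (F' := fun u => -(F.R u * F.T 1 u)) (fun u hu => F.hasDerivWithinAt_R u hu) hs
    ⟨1 * bound n α, by
      filter_upwards [self_mem_nhdsWithin] with t ht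
      rw [norm_neg]
      exact (norm_mul_le _ _).trans (mul_le_mul (F.norm_R t ht) (F.norm_T_le le_rfl F.one_le ht)
        (norm_nonneg _) zero_le_one)⟩

theorem contDiffOn_R_succ (hV : ContDiffOn ℝ k (fun s => F.R s * F.T 1 s) S) :
    ContDiffOn ℝ (k + 1 : ℕ) F.R S :=
  contDiffOn_succ_of_pointwise F.convex F.uniqueDiff
    (F' := fun u => -(F.R u * F.T 1 u)) (fun u hu => F.hasDerivWithinAt_R u hu) hV.neg

theorem contDiffOn_R (hk : k < n) : ContDiffOn ℝ k F.R S := by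
  induction k with
  | zero => rw [Nat.cast_zero, contDiffOn_zero]; exact F.continuousOn_R
  | succ k ih =>
    exact F.contDiffOn_R_succ ((ih (by omega)).mul (F.contDiffOn_T le_rfl (by omega)))

theorem contDiffOn_K_of_lt (hk : k < n) : ContDiffOn ℝ k F.K S :=
  F.contDiffOn_K (F.contDiffOn_Z (by omega) fun j hj =>
    (F.contDiffOn_R (by omega)).mul (F.contDiffOn_T le_rfl (by omega)))

section CompactResolvent

variable (hcomp : ∀ s ∈ S, IsCompactOperator (F.R s))
  (hsymm : ∀ s ∈ S, star (F.R s * F.T n s) = F.R s * F.T n s)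
include hcomp hsymm

/-- By symmetry `R T n = (T n)* R`. The adjoints `(T n)*` converge strongly: first on the range of
`R s`, where `(T n)* R = R T n` helps, then everywhere by density and boundedness. Compactness of `R
s` makes the convergence of the product one in norm. -/
theorem continuousOn_R_mul_T : ContinuousOn (fun s => F.R s * F.T n s) S := by
  intro s hs
  have hR := F.continuousOn_R s hs
  have hn := F.one_le
  have hbd : ∀ᶠ t in 𝓝[S] s, ‖star (F.T n t)‖ ≤ bound n α := by
    filter_upwards [self_mem_nhdsWithin] with t ht
    rw [norm_star]
    exact F.norm_T_le hn le_rfl ht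
  have hstar : ∀ t ∈ S, star (F.T n t) * F.R t = F.R t * F.T n t := fun t ht => by
    rw [← hsymm t ht, star_mul, F.star_R t ht]
  have hRs0 : Tendsto (fun t => F.R t - F.R s) (𝓝[S] s) (𝓝 0) := by
    simpa using hR.tendsto.sub_const (F.R s)
  have h0 : Tendsto (fun t => star (F.T n t) * (F.R t - F.R s)) (𝓝[S] s) (𝓝 0) :=
    tendsto_clm_apply_of_pointwise (F := fun t => mulL (star (F.T n t)))
      ⟨_, hbd.mono fun t ht => (norm_mulLeft_le _).trans ht⟩ (by simpa using tendsto_const_nhds) hRs0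
  have hRT : ∀ φ, Tendsto (fun t => F.R t (F.T n t φ)) (𝓝[S] s) (𝓝 (F.R s (F.T n s φ))) := fun φ =>
    tendsto_clm_apply_of_pointwise ⟨1, by
      filter_upwards [self_mem_nhdsWithin] with t ht using F.norm_R t ht⟩
      (F.hasDerivWithinAt_R s hs _).continuousWithinAt (F.T_cont φ s hs)
  have hrange : ∀ φ, Tendsto (fun t => star (F.T n t) (F.R s φ)) (𝓝[S] s)
      (𝓝 (star (F.T n s) (F.R s φ))) := by
    intro φ
    have h1 := (hRT φ).sub (((ContinuousLinearMap.apply ℂ E φ).continuous.tendsto _).comp h0)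
    have h2 : F.R s (F.T n s φ) = star (F.T n s) (F.R s φ) :=
      (congrArg (fun A : E →L[ℂ] E => A φ) (hstar s hs)).symm
    rw [map_zero, sub_zero, h2] at h1
    refine h1.congr' ?_
    filter_upwards [self_mem_nhdsWithin] with t ht
    have h3 : star (F.T n t) (F.R t φ) = F.R t (F.T n t φ) :=
      congrArg (fun A : E →L[ℂ] E => A φ) (hstar t ht)
    rw [← h3]
    simp
  have hdense : DenseRange (F.R s) := by
    have h1 : (LinearMap.range (F.R s : E →ₗ[ℂ] E)).topologicalClosure = ⊤ := by
      rw [Submodule.topologicalClosure_eq_top_iff, Submodule.eq_bot_iff]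
      intro x hx
      have h2 : F.R s x = 0 := by
        rw [← inner_self_eq_zero (𝕜 := ℂ)]
        have h3 : inner ℂ (F.R s (F.R s x)) x = 0 := hx _ ⟨F.R s x, rfl⟩
        have h4 := F.star_R s hs
        rw [ContinuousLinearMap.star_eq_adjoint] at h4
        rw [← ContinuousLinearMap.adjoint_inner_left, h4]
        exact h3
      exact F.R_inj s hs (h2.trans (map_zero _).symm)
    have h2 := (Submodule.dense_iff_topologicalClosure_eq_top.2 h1)
    exact h2
  have hstrong : ∀ ψ, Tendsto (fun t => star (F.T n t) ψ) (𝓝[S] s) (𝓝 (star (F.T n s) ψ)) := by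
    intro ψ
    have hb0 := (zero_le_one.trans F.one_le_bound)
    rw [Metric.tendsto_nhds]
    intro ε hε
    obtain ⟨φ, hφ⟩ := Metric.denseRange_iff.1 hdense ψ (ε / (3 * (bound n α + 1))) (by positivity)
    have hs' : ‖star (F.T n s)‖ ≤ bound n α := by
      rw [norm_star]; exact F.norm_T_le hn le_rfl hs
    have hbase : ∀ A : E →L[ℂ] E, ‖A‖ ≤ bound n α → ‖A (ψ - F.R s φ)‖ ≤ ε / 3 := by
      intro A hA
      rw [dist_eq_norm] at hφ
      refine (A.le_of_opNorm_le hA _).trans ?_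
      calc bound n α * ‖ψ - F.R s φ‖ ≤ (bound n α + 1) * (ε / (3 * (bound n α + 1))) := by
            gcongr
            linarith
        _ = ε / 3 := by field_simp
    filter_upwards [hbd, Metric.tendsto_nhds.1 (hrange φ) (ε / 3) (by positivity)] with t h1 h2
    rw [dist_eq_norm] at h2 ⊢
    have h3 := hbase _ h1
    have h4 := hbase _ hs'
    have h5 : star (F.T n t) ψ - star (F.T n s) ψ = star (F.T n t) (ψ - F.R s φ)
        - star (F.T n s) (ψ - F.R s φ)
        + (star (F.T n t) (F.R s φ) - star (F.T n s) (F.R s φ)) := by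
      rw [map_sub, map_sub]; abel
    rw [h5]
    have h6 := norm_add_le (star (F.T n t) (ψ - F.R s φ) - star (F.T n s) (ψ - F.R s φ))
      (star (F.T n t) (F.R s φ) - star (F.T n s) (F.R s φ))
    have h7 := norm_sub_le (star (F.T n t) (ψ - F.R s φ)) (star (F.T n s) (ψ - F.R s φ))
    linarith
  have hlim := (tendsto_mul_of_isCompactOperator ⟨_, hbd⟩ hstrong (hcomp s hs)).add h0
  rw [add_zero, hstar s hs] at hlim
  refine hlim.congr' ?_
  filter_upwards [self_mem_nhdsWithin] with t ht
  rw [← mul_add, add_sub_cancel, hstar t ht]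

/-- Compared with `contDiffOn_T` one derivative is gained, because the induction may start at `i =
n`. -/
theorem contDiffOn_R_mul_T {i : ℕ} (h1 : 1 ≤ i) (hi : i + k ≤ n) :
    ContDiffOn ℝ k (fun s => F.R s * F.T i s) S := by
  induction k generalizing i with
  | zero =>
    rw [Nat.cast_zero, contDiffOn_zero]
    rcases (by omega : i < n ∨ i = n) with hin | rfl
    · have := F.contDiffOn_T (k := 0) h1 (by omega)
      exact F.continuousOn_R.mul this.continuousOn
    · exact F.continuousOn_R_mul_T hcomp hsymm
  | succ k ih =>
    refine contDiffOn_succ_of_pointwise F.convex F.uniqueDiff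
      (F' := fun u => F.R u * F.T (i + 1) u - F.R u * F.T i u * F.T 1 u
        - F.R u * F.T 1 u * F.T i u) (fun s hs φ => ?_)
      (((ih (by omega) (by omega)).sub ((ih h1 (by omega)).mul (F.contDiffOn_T le_rfl (by omega)))).sub
        ((ih le_rfl (by omega)).mul (F.contDiffOn_T h1 (by omega))))
    have h2 := HasDerivWithinAt.clm_apply_of_strong (F.hasDerivWithinAt_R s hs (F.T i s φ))
      ⟨1, by filter_upwards [self_mem_nhdsWithin] with t ht using F.norm_R t ht⟩
      (F.hasDerivWithinAt_R s hs _).continuousWithinAt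
      (F.hasDerivWithinAt_T i h1 (by omega) s hs φ)
    refine h2.congr_deriv ?_
    rw [map_sub, neg_add_eq_sub]
    rfl

theorem contDiffOn_K_of_isCompactOperator : ContDiffOn ℝ n F.K S :=
  F.contDiffOn_K (F.contDiffOn_Z le_rfl fun j hj =>
    F.contDiffOn_R_mul_T hcomp hsymm le_rfl (by omega))

end CompactResolvent

end SpectralFamily

/-! ### From the family `H(s)` to bounded operators. -/

/-- A family of self-adjoint operators `H(s) ≥ 1`, `s ∈ S`, with common domain `D`, of class `C^n`
on `D` and with bounds for the operators `H^{(i)} H⁻¹`. -/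
structure HamiltonianFamily {E : Type*} [NormedAddCommGroup E] [InnerProductSpace ℂ E]
    [CompleteSpace E] {D : Submodule ℂ E} (H : ℝ → D →ₗ[ℂ] E) (n : ℕ) (α : ℕ → ℝ) (S : Set ℝ) :
    Prop where
  convex : Convex ℝ S
  uniqueDiff : UniqueDiffOn ℝ S
  one_le : 1 ≤ n
  α_nonneg : ∀ i, 0 ≤ α i
  isSelfAdjoint : ∀ s ∈ S, IsSelfAdjoint (⟨D, H s⟩ : E →ₗ.[ℂ] E)
  sq_norm_le : ∀ s ∈ S, ∀ φ : D, ‖(φ : E)‖ ^ 2 ≤ (inner ℂ (φ : E) (H s φ)).re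
  contDiffOn : ∀ φ : D, ContDiffOn ℝ n (fun s => H s φ) S
  norm_le : ∀ i, 1 ≤ i → i ≤ n → ∀ s ∈ S, ∀ φ : D,
    ‖iteratedDerivWithin i (fun t => H t φ) S s‖ ≤ α i * ‖H s φ‖

namespace HamiltonianFamily

variable {E : Type*} [NormedAddCommGroup E] [InnerProductSpace ℂ E] [CompleteSpace E]
  {D : Submodule ℂ E} {H : ℝ → D →ₗ[ℂ] E} {n : ℕ} {α : ℕ → ℝ} {S : Set ℝ}
  (hH : HamiltonianFamily H n α S) {s t : ℝ} {i : ℕ}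

include hH

theorem norm_le_norm_apply (hs : s ∈ S) (φ : D) : ‖(φ : E)‖ ≤ ‖H s φ‖ := by
  have h1 := hH.sq_norm_le s hs φ
  have h2 := (Complex.re_le_norm _).trans (norm_inner_le_norm (𝕜 := ℂ) (φ : E) (H s φ))
  rcases (norm_nonneg (φ : E)).eq_or_lt with h3 | h3
  · rw [← h3]; exact norm_nonneg _
  · nlinarith

theorem inner_left (hs : s ∈ S) (φ ψ : D) :
    inner ℂ (H s φ) (ψ : E) = inner ℂ (φ : E) (H s ψ) :=
  UnboundedOp.inner_apply_left (hH.isSelfAdjoint s hs) φ ψ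

theorem exists_inverse (hs : s ∈ S) :
    ∃ R : E →ₗ[ℂ] D, (∀ φ, H s (R φ) = φ) ∧ ∀ φ, R (H s φ) = φ := by
  have hb : ∀ ψ : D, 1 * ‖(ψ : E)‖ ≤ ‖(0 : ℂ) • (ψ : E) - H s ψ‖ := fun ψ => by
    rw [zero_smul, zero_sub, norm_neg, one_mul]
    exact hH.norm_le_norm_apply hs ψ
  -- The resolvent at `0` is `-H⁻¹`, whence the signs below.
  obtain ⟨R, hR⟩ := UnboundedOp.exists_isResolvent (hH.isSelfAdjoint s hs) (z := 0) zero_lt_one hb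
    (by rw [map_zero]; exact hb)
  have h1 : ∀ φ, H s ⟨R φ, hR.mem φ⟩ = -φ := fun φ => by
    have := hR.apply_eq φ
    rw [zero_smul, zero_sub] at this
    exact this
  have h2 : ∀ φ : D, R (H s φ) = -φ := fun φ => by
    have := hR.apply_smul_sub φ
    rw [zero_smul, zero_sub, map_neg, neg_eq_iff_eq_neg] at this
    exact this
  refine ⟨-((R : E →ₗ[ℂ] E).codRestrict D hR.mem), fun φ => ?_, fun φ => ?_⟩
  · rw [LinearMap.neg_apply, map_neg, neg_eq_iff_eq_neg]
    exact h1 φ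
  · rw [LinearMap.neg_apply, neg_eq_iff_eq_neg]
    exact Subtype.ext (h2 φ)

omit hH

open Classical in
/-- The inverse of `H`, as a map to the domain. -/
noncomputable def Rd (hH : HamiltonianFamily H n α S) (s : ℝ) : E →ₗ[ℂ] D :=
  if hs : s ∈ S then (hH.exists_inverse hs).choose else 0

include hH

theorem H_Rd (hs : s ∈ S) (φ : E) : H s (hH.Rd s φ) = φ := by
  rw [Rd, dif_pos hs]; exact (hH.exists_inverse hs).choose_spec.1 φ

theorem Rd_H (hs : s ∈ S) (φ : D) : hH.Rd s (H s φ) = φ := by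
  rw [Rd, dif_pos hs]; exact (hH.exists_inverse hs).choose_spec.2 φ

theorem Rd_of_notMem (hs : s ∉ S) : hH.Rd s = 0 := by
  rw [Rd, dif_neg hs]

theorem norm_Rd_le (s : ℝ) (φ : E) : ‖(hH.Rd s φ : E)‖ ≤ 1 * ‖φ‖ := by
  by_cases hs : s ∈ S
  · have := hH.norm_le_norm_apply hs (hH.Rd s φ)
    rwa [hH.H_Rd hs, ← one_mul ‖φ‖] at this
  · rw [hH.Rd_of_notMem hs]
    simp

omit hH

/-- The inverse of `H`. -/
noncomputable def R (hH : HamiltonianFamily H n α S) (s : ℝ) : E →L[ℂ] E :=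
  LinearMap.mkContinuous (D.subtype ∘ₗ hH.Rd s) 1 (hH.norm_Rd_le s)

include hH

theorem R_apply (s : ℝ) (φ : E) : hH.R s φ = hH.Rd s φ := rfl

theorem norm_R (s : ℝ) : ‖hH.R s‖ ≤ 1 := LinearMap.mkContinuous_norm_le _ zero_le_one _

theorem R_H (hs : s ∈ S) (φ : D) : hH.R s (H s φ) = φ := by
  rw [hH.R_apply, hH.Rd_H hs]

theorem star_R (hs : s ∈ S) : star (hH.R s) = hH.R s := by
  rw [ContinuousLinearMap.star_eq_adjoint]
  symm
  rw [ContinuousLinearMap.eq_adjoint_iff]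
  intro x y
  have := hH.inner_left hs (hH.Rd s x) (hH.Rd s y)
  rw [hH.H_Rd hs, hH.H_Rd hs] at this
  exact this.symm

theorem R_inj (hs : s ∈ S) : Function.Injective (hH.R s) := fun x y hxy => by
  have : hH.Rd s x = hH.Rd s y := Subtype.ext hxy
  rw [← hH.H_Rd hs x, this, hH.H_Rd hs]

/-- By the closed graph theorem: `H(t)`, being self-adjoint, is closed. -/
theorem exists_W (s : ℝ) (ht : t ∈ S) : ∃ W : E →L[ℂ] E, ∀ φ, W φ = H t (hH.Rd s φ) := by
  have hcont : Continuous (H t ∘ₗ hH.Rd s) := by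
    refine LinearMap.continuous_of_seq_closed_graph _ fun u x y hu hgu => ?_
    obtain ⟨h1, h2⟩ := UnboundedOp.exists_apply_eq_of_inner (hH.isSelfAdjoint t ht)
      (y := hH.R s x) (w := y) fun x' => by
        have h3 : Tendsto (fun k => inner ℂ ((H t ∘ₗ hH.Rd s) (u k)) (x' : E)) atTop
            (𝓝 (inner ℂ y (x' : E))) := hgu.inner tendsto_const_nhds
        have h4 : Tendsto (fun k => inner ℂ (hH.R s (u k)) (H t x')) atTop
            (𝓝 (inner ℂ (hH.R s x) (H t x'))) :=
          (((hH.R s).continuous.tendsto x).comp hu).inner tendsto_const_nhds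
        exact tendsto_nhds_unique h3 (h4.congr fun k => (hH.inner_left ht _ _).symm)
    exact h2.symm
  exact ⟨⟨_, hcont⟩, fun φ => rfl⟩

omit hH

open Classical in
/-- The bounded operator `H(t) H(s)⁻¹`. -/
noncomputable def W (hH : HamiltonianFamily H n α S) (t s : ℝ) : E →L[ℂ] E :=
  if h : s ∈ S ∧ t ∈ S then (hH.exists_W s h.2).choose else 0

/-- The derivative `H^{(i)}`, on the domain of `H`. -/
noncomputable def Hd (_ : HamiltonianFamily H n α S) (i : ℕ) (s : ℝ) (φ : D) : E :=
  iteratedDerivWithin i (fun t => H t φ) S s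

include hH

theorem W_apply (hs : s ∈ S) (ht : t ∈ S) (φ : E) : hH.W t s φ = H t (hH.Rd s φ) := by
  rw [W, dif_pos ⟨hs, ht⟩]; exact (hH.exists_W s ht).choose_spec φ

theorem Hd_zero (s : ℝ) (φ : D) : hH.Hd 0 s φ = H s φ := by
  rw [Hd, iteratedDerivWithin_zero]

theorem hasDerivWithinAt_Hd (hi : i < n) (hs : s ∈ S) (φ : D) :
    HasDerivWithinAt (fun t => hH.Hd i t φ) (hH.Hd (i + 1) s φ) S s := by
  have := ((hH.contDiffOn φ).differentiableOn_iteratedDerivWithin (m := i) (by exact_mod_cast hi)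
    hH.uniqueDiff s hs).hasDerivWithinAt
  rw [Hd, iteratedDerivWithin_succ]
  exact this

theorem continuousOn_Hd (hi : i ≤ n) (φ : D) : ContinuousOn (fun t => hH.Hd i t φ) S :=
  (hH.contDiffOn φ).continuousOn_iteratedDerivWithin (by exact_mod_cast hi) hH.uniqueDiff

theorem Hd_add (hi : i ≤ n) (hs : s ∈ S) (φ ψ : D) :
    hH.Hd i s (φ + ψ) = hH.Hd i s φ + hH.Hd i s ψ := by
  have h : ∀ φ : D, ContDiffWithinAt ℝ i (fun t => H t φ) S s := fun φ =>
    ((hH.contDiffOn φ).of_le (by exact_mod_cast hi)) s hs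
  simp only [Hd, map_add]
  exact iteratedDerivWithin_fun_add hs hH.uniqueDiff (h φ) (h ψ)

theorem Hd_smul (c : ℂ) (φ : D) : hH.Hd i s (c • φ) = c • hH.Hd i s φ := by
  simp only [Hd, map_smul]
  exact iteratedDerivWithin_fun_const_smul_field c _

theorem norm_Hd_le (h1 : 1 ≤ i) (hi : i ≤ n) (hs : s ∈ S) (φ : D) :
    ‖hH.Hd i s φ‖ ≤ α i * ‖H s φ‖ := hH.norm_le i h1 hi s hs φ

/-- The symmetry relation of `H(s)` is differentiated `i` times. -/
theorem Hd_inner_left (hi : i ≤ n) (hs : s ∈ S) (φ ψ : D) :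
    inner ℂ (hH.Hd i s φ) (ψ : E) = inner ℂ (φ : E) (hH.Hd i s ψ) := by
  induction i generalizing s with
  | zero => rw [hH.Hd_zero, hH.Hd_zero]; exact hH.inner_left hs φ ψ
  | succ i ih =>
    have h1 := (hH.hasDerivWithinAt_Hd (i := i) (by omega) hs φ).inner ℂ (hasDerivWithinAt_const s S (ψ : E))
    have h2 := (hasDerivWithinAt_const s S (φ : E)).inner ℂ (hH.hasDerivWithinAt_Hd (i := i) (by omega) hs ψ)
    have h3 := h1.congr_of_mem (fun t ht => (ih (by omega) ht).symm) hs
    have := (hH.uniqueDiff s hs).eq_deriv _ h3 h2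
    simpa using this

theorem exists_T (h1 : 1 ≤ i) (hi : i ≤ n) (hs : s ∈ S) :
    ∃ T : E →L[ℂ] E, ‖T‖ ≤ α i ∧ ∀ φ, T φ = hH.Hd i s (hH.Rd s φ) := by
  let T : E →ₗ[ℂ] E :=
    { toFun := fun φ => hH.Hd i s (hH.Rd s φ)
      map_add' := fun φ ψ => by rw [map_add, hH.Hd_add hi hs]
      map_smul' := fun c φ => by rw [map_smul, hH.Hd_smul]; rfl }
  refine ⟨T.mkContinuous (α i) fun φ => ?_, T.mkContinuous_norm_le (hH.α_nonneg i) _, fun φ => rfl⟩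
  have := hH.norm_Hd_le h1 hi hs (hH.Rd s φ)
  rwa [hH.H_Rd hs] at this

omit hH

open Classical in
/-- The bounded operator `H^{(i)} H⁻¹`. -/
noncomputable def T (hH : HamiltonianFamily H n α S) (i : ℕ) (s : ℝ) : E →L[ℂ] E :=
  if h : (1 ≤ i ∧ i ≤ n) ∧ s ∈ S then (hH.exists_T h.1.1 h.1.2 h.2).choose else 0

include hH

theorem T_apply (h1 : 1 ≤ i) (hi : i ≤ n) (hs : s ∈ S) (φ : E) :
    hH.T i s φ = hH.Hd i s (hH.Rd s φ) := by
  rw [T, dif_pos ⟨⟨h1, hi⟩, hs⟩]; exact (hH.exists_T h1 hi hs).choose_spec.2 φ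

theorem norm_T (h1 : 1 ≤ i) (hi : i ≤ n) (hs : s ∈ S) : ‖hH.T i s‖ ≤ α i := by
  rw [T, dif_pos ⟨⟨h1, hi⟩, hs⟩]; exact (hH.exists_T h1 hi hs).choose_spec.1

theorem R_mul_W (hs : s ∈ S) (ht : t ∈ S) : hH.R t * hH.W t s = hH.R s := by
  ext φ
  rw [mul_apply_eq_comp, hH.W_apply hs ht, hH.R_H ht, hH.R_apply]

theorem W_self (hs : s ∈ S) : hH.W s s = 1 := by
  ext φ
  rw [hH.W_apply hs hs, hH.H_Rd hs]
  rfl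

theorem W_mul_W (hs : s ∈ S) (ht : t ∈ S) : hH.W t s * hH.W s t = 1 := by
  ext φ
  rw [mul_apply_eq_comp, hH.W_apply hs ht, hH.W_apply ht hs, hH.Rd_H hs,
    hH.H_Rd ht]
  rfl

theorem hasDerivWithinAt_W (hs : s ∈ S) (φ : E) :
    HasDerivWithinAt (fun t => hH.W t s φ) (hH.T 1 s φ) S s := by
  have h1 := hH.hasDerivWithinAt_Hd (i := 0) (by have := hH.one_le; omega) hs (hH.Rd s φ)
  rw [← hH.T_apply le_rfl hH.one_le hs] at h1
  refine h1.congr_of_mem (fun t ht => ?_) hs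
  rw [hH.W_apply hs ht, hH.Hd_zero]

/-- The derivative at `u` is bounded by `‖H u φ‖` at the same `u`. At a maximum point `v` of this
norm on the segment, the mean value inequality and the smallness of `α 1 * |t - s|` give `‖H v φ‖ ≤
2 ‖H s φ‖`, whence the factor `2`. -/
theorem norm_H_sub_le (hs : s ∈ S) (ht : t ∈ S) (hst : α 1 * |t - s| ≤ 1 / 2) (φ : D) :
    ‖H t φ - H s φ‖ ≤ 2 * α 1 * |t - s| * ‖H s φ‖ := by
  have hα := hH.α_nonneg 1
  have hseg : segment ℝ s t ⊆ S := hH.convex.segment_subset hs ht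
  have hcompact : IsCompact (segment ℝ s t) := by
    rw [segment_eq_image_lineMap]
    exact isCompact_Icc.image (by fun_prop)
  have hd : ∀ u ∈ S, HasDerivWithinAt (fun t => H t φ) (hH.Hd 1 u φ) S u := fun u hu =>
    (hH.hasDerivWithinAt_Hd (i := 0) (by have := hH.one_le; omega) hu φ).congr_of_mem
      (fun t _ => (hH.Hd_zero t φ).symm) hu
  have hcont : ContinuousOn (fun u => ‖H u φ‖) (segment ℝ s t) := fun u hu =>
    ((hd u (hseg hu)).continuousWithinAt.mono hseg).norm
  obtain ⟨v, hv, hmax⟩ := hcompact.exists_isMaxOn ⟨s, left_mem_segment ℝ s t⟩ hcont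
  have hlip : ∀ u ∈ segment ℝ s t, ‖H u φ - H s φ‖ ≤ α 1 * ‖H v φ‖ * |u - s| := fun u hu =>
    (convex_segment s t).norm_image_sub_le_of_norm_hasDerivWithin_le
      (f := fun t => H t φ) (f' := fun u => hH.Hd 1 u φ)
      (fun w hw => (hd w (hseg hw)).mono hseg)
      (fun w hw => (hH.norm_Hd_le le_rfl hH.one_le (hseg hw) φ).trans
        (mul_le_mul_of_nonneg_left (hmax hw) hα)) (left_mem_segment ℝ s t) hu
  have hvs : |v - s| ≤ |t - s| := by
    rw [segment_eq_uIcc] at hv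
    exact abs_sub_left_of_mem_uIcc hv
  have h1 := hlip v hv
  have h2 : α 1 * ‖H v φ‖ * |v - s| ≤ 1 / 2 * ‖H v φ‖ := by
    have := mul_le_mul_of_nonneg_left hvs hα
    have := mul_le_mul_of_nonneg_right (this.trans hst) (norm_nonneg (H v φ))
    linarith
  have h3 := norm_sub_norm_le (H v φ) (H s φ)
  have h4 : ‖H v φ‖ ≤ 2 * ‖H s φ‖ := by linarith
  refine (hlip t (right_mem_segment ℝ s t)).trans ?_
  calc α 1 * ‖H v φ‖ * |t - s| ≤ α 1 * (2 * ‖H s φ‖) * |t - s| := by gcongr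
    _ = 2 * α 1 * |t - s| * ‖H s φ‖ := by ring

theorem norm_W_sub_one_le (hs : s ∈ S) (ht : t ∈ S) (hst : α 1 * |t - s| ≤ 1 / 2) :
    ‖hH.W t s - 1‖ ≤ 2 * α 1 * |t - s| := by
  have hα := hH.α_nonneg 1
  refine ContinuousLinearMap.opNorm_le_bound _ (by positivity) fun φ => ?_
  have := hH.norm_H_sub_le hs ht hst (hH.Rd s φ)
  rwa [hH.H_Rd hs, ← hH.W_apply hs ht] at this

theorem eventually_norm_W_sub_one_le (hs : s ∈ S) : ∀ᶠ t in 𝓝[S] s,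
    ‖hH.W t s - 1‖ ≤ 2 * α 1 * |t - s| ∧ ‖hH.W s t - 1‖ ≤ 2 * α 1 * |t - s| ∧
      2 * α 1 * |t - s| ≤ 1 := by
  have h1 : Tendsto (fun t => α 1 * |t - s|) (𝓝[S] s) (𝓝 (α 1 * 0)) :=
    (tendsto_abs_sub_nhdsWithin S s).const_mul _
  rw [mul_zero] at h1
  filter_upwards [self_mem_nhdsWithin, h1.eventually (ge_mem_nhds (by norm_num : (0 : ℝ) < 1 / 2))]
    with t ht h2
  refine ⟨hH.norm_W_sub_one_le hs ht h2, ?_, by linarith⟩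
  have h3 := hH.norm_W_sub_one_le ht hs (by rwa [abs_sub_comm])
  rwa [abs_sub_comm s t] at h3

theorem eventually_norm_W_le (hs : s ∈ S) : ∀ᶠ t in 𝓝[S] s, ‖hH.W t s‖ ≤ 2 ∧ ‖hH.W s t‖ ≤ 2 := by
  have h1 : ∀ A : E →L[ℂ] E, ‖A - 1‖ ≤ 1 → ‖A‖ ≤ 2 := fun A hA => by
    have h2 := norm_add_le (A - 1) 1
    have h3 : ‖(1 : E →L[ℂ] E)‖ ≤ 1 := ContinuousLinearMap.norm_id_le
    rw [sub_add_cancel] at h2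
    linarith
  filter_upwards [hH.eventually_norm_W_sub_one_le hs] with t ht
  exact ⟨h1 _ (ht.1.trans ht.2.2), h1 _ (ht.2.1.trans ht.2.2)⟩

/-- From `R(t) = R(s) - R(t) (W(t, s) - 1)`: boundedness of `R` gives strong continuity, and this
gives the strong derivative. -/
theorem hasDerivWithinAt_R (hs : s ∈ S) (φ : E) :
    HasDerivWithinAt (fun t => hH.R t φ) (-(hH.R s (hH.T 1 s φ))) S s := by
  have hb : ∃ C, ∀ᶠ t in 𝓝[S] s, ‖hH.R t‖ ≤ C := ⟨1, Eventually.of_forall hH.norm_R⟩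
  have hR : ∀ t ∈ S, ∀ v, hH.R t v = hH.R s v - hH.R t (hH.W t s v - v) := fun t ht v => by
    rw [map_sub, ← mul_apply_eq_comp, hH.R_mul_W hs ht]; abel
  have hv : ∀ v, HasDerivWithinAt (fun t => hH.W t s v - v) (hH.T 1 s v) S s := fun v =>
    (hH.hasDerivWithinAt_W hs v).sub_const v
  have hv0 : ∀ v, hH.W s s v - v = 0 := fun v => by rw [hH.W_self hs]; exact sub_self v
  have hcont : ∀ v, Tendsto (fun t => hH.R t v) (𝓝[S] s) (𝓝 (hH.R s v)) := fun v => by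
    have h1 := tendsto_clm_apply_of_pointwise (F := hH.R) (v₀ := 0) (y := 0) hb
      (by simpa only [map_zero] using tendsto_const_nhds)
      (by simpa only [hv0] using (hv v).continuousWithinAt.tendsto)
    have h2 := h1.const_sub (hH.R s v)
    rw [sub_zero] at h2
    refine h2.congr' ?_
    filter_upwards [self_mem_nhdsWithin] with t ht
    exact (hR t ht v).symm
  have h1 := HasDerivWithinAt.clm_apply_of_strong (F := hH.R) (d := 0)
    (by simpa only [hv0, map_zero] using hasDerivWithinAt_const s S (0 : E)) hb (hcont _) (hv φ)
  rw [zero_add] at h1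
  exact (h1.const_sub (hH.R s φ)).congr_of_mem (fun t ht => hR t ht φ) hs

theorem tendsto_W_apply (hs : s ∈ S) (φ : E) :
    Tendsto (fun t => hH.W s t φ) (𝓝[S] s) (𝓝 φ) := by
  have h1 := (tendsto_abs_sub_nhdsWithin S s).const_mul (2 * α 1)
  rw [mul_zero] at h1
  have h2 : Tendsto (fun t => hH.W s t) (𝓝[S] s) (𝓝 1) := by
    rw [tendsto_iff_norm_sub_tendsto_zero]
    exact squeeze_zero' (Eventually.of_forall fun _ => norm_nonneg _)
      ((hH.eventually_norm_W_sub_one_le hs).mono fun t h => h.2.1) h1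
  exact ((ContinuousLinearMap.apply ℂ E φ).continuous.tendsto _).comp h2

theorem hasDerivWithinAt_W_right (hs : s ∈ S) (φ : E) :
    HasDerivWithinAt (fun t => hH.W s t φ) (-(hH.T 1 s φ)) S s := by
  have hv : HasDerivWithinAt (fun t => hH.W t s φ - φ) (hH.T 1 s φ) S s :=
    (hH.hasDerivWithinAt_W hs φ).sub_const φ
  have hv0 : hH.W s s φ - φ = 0 := by rw [hH.W_self hs]; exact sub_self φ
  have h1 := HasDerivWithinAt.clm_apply_of_strong (F := fun t => hH.W s t) (d := 0)
    (by simpa only [hv0, map_zero] using hasDerivWithinAt_const s S (0 : E))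
    ⟨2, (hH.eventually_norm_W_le hs).mono fun t h => h.2⟩
    (by simpa only [hH.W_self hs, one_apply_eq_self] using hH.tendsto_W_apply hs (hH.T 1 s φ)) hv
  rw [hH.W_self hs, zero_add] at h1
  refine (h1.const_sub φ).congr_of_mem (fun t ht => ?_) hs
  rw [map_sub, ← mul_apply_eq_comp, hH.W_mul_W ht hs]
  simp

theorem T_mul_W_apply (h1 : 1 ≤ i) (hi : i ≤ n) (hs : s ∈ S) (ht : t ∈ S) (φ : E) :
    (hH.T i t * hH.W t s) φ = hH.Hd i t (hH.Rd s φ) := by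
  rw [mul_apply_eq_comp, hH.T_apply h1 hi ht, hH.W_apply hs ht, hH.Rd_H ht]

theorem T_eq (hs : s ∈ S) (ht : t ∈ S) (φ : E) :
    hH.T i t φ = (hH.T i t * hH.W t s) (hH.W s t φ) := by
  rw [← mul_apply_eq_comp, mul_assoc, hH.W_mul_W hs ht, mul_one]

theorem eventually_norm_T_mul_W_le (h1 : 1 ≤ i) (hi : i ≤ n) (hs : s ∈ S) :
    ∀ᶠ t in 𝓝[S] s, ‖hH.T i t * hH.W t s‖ ≤ α i * 2 := by
  filter_upwards [self_mem_nhdsWithin, hH.eventually_norm_W_le hs] with t ht h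
  exact (norm_mul_le _ _).trans (mul_le_mul (hH.norm_T h1 hi ht) h.1 (norm_nonneg _)
    (hH.α_nonneg i))

theorem tendsto_T_mul_W_apply (h1 : 1 ≤ i) (hi : i ≤ n) (hs : s ∈ S) (φ : E) :
    Tendsto (fun t => (hH.T i t * hH.W t s) φ) (𝓝[S] s) (𝓝 ((hH.T i s * hH.W s s) φ)) := by
  rw [hH.T_mul_W_apply h1 hi hs hs]
  refine (hH.continuousOn_Hd hi (hH.Rd s φ) s hs).tendsto.congr' ?_
  filter_upwards [self_mem_nhdsWithin] with t ht
  exact (hH.T_mul_W_apply h1 hi hs ht φ).symm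

/-- Write `T i t = (T i t W t s) W s t`. The bracket is `H^{(i)}(t) H(s)⁻¹`, differentiable in `t`
on each vector by assumption, and `W s t` contributes the term with `T 1`. -/
theorem hasDerivWithinAt_T (h1 : 1 ≤ i) (hi : i < n) (hs : s ∈ S) (φ : E) :
    HasDerivWithinAt (fun t => hH.T i t φ) (hH.T (i + 1) s φ - hH.T i s (hH.T 1 s φ)) S s := by
  have h2 := HasDerivWithinAt.clm_apply_of_strong (F := fun t => hH.T i t * hH.W t s)
    (v := fun t => hH.W s t φ) (d := hH.T (i + 1) s φ) ?_
    ⟨_, hH.eventually_norm_T_mul_W_le h1 hi.le hs⟩ (hH.tendsto_T_mul_W_apply h1 hi.le hs _)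
    (hH.hasDerivWithinAt_W_right hs φ)
  · refine (h2.congr_of_mem (fun t ht => hH.T_eq hs ht φ) hs).congr_deriv ?_
    rw [hH.W_self hs, mul_one, map_neg, sub_eq_add_neg]
  · rw [hH.W_self hs, hH.T_apply (by omega) (by omega) hs]
    exact (hH.hasDerivWithinAt_Hd hi hs _).congr_of_mem
      (fun t ht => hH.T_mul_W_apply h1 hi.le hs ht φ) hs

theorem continuousOn_T_apply (φ : E) : ContinuousOn (fun t => hH.T n t φ) S := fun s hs => by
  have h1 := tendsto_clm_apply_of_pointwise (F := fun t => hH.T n t * hH.W t s)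
    ⟨_, hH.eventually_norm_T_mul_W_le hH.one_le le_rfl hs⟩
    (hH.tendsto_T_mul_W_apply hH.one_le le_rfl hs φ) (hH.tendsto_W_apply hs φ)
  rw [hH.W_self hs, mul_one] at h1
  refine h1.congr' ?_
  filter_upwards [self_mem_nhdsWithin] with t ht
  exact (hH.T_eq hs ht φ).symm

theorem star_R_mul_T (h1 : 1 ≤ i) (hi : i ≤ n) (hs : s ∈ S) :
    star (hH.R s * hH.T i s) = hH.R s * hH.T i s := by
  rw [ContinuousLinearMap.star_eq_adjoint]
  symm
  rw [ContinuousLinearMap.eq_adjoint_iff]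
  intro x y
  have h2 := hH.star_R hs
  rw [ContinuousLinearMap.star_eq_adjoint] at h2
  rw [mul_apply_eq_comp, mul_apply_eq_comp]
  conv_lhs => rw [← h2, ContinuousLinearMap.adjoint_inner_left]
  conv_rhs => rw [← h2, ContinuousLinearMap.adjoint_inner_right]
  rw [hH.T_apply h1 hi hs, hH.T_apply h1 hi hs]
  exact hH.Hd_inner_left hi hs _ _

end HamiltonianFamily

namespace HamiltonianFamily

variable {E : Type*} [NormedAddCommGroup E] [InnerProductSpace ℂ E] [CompleteSpace E]
  {D : Submodule ℂ E} {H : ℝ → D →ₗ[ℂ] E} {n : ℕ} {α : ℕ → ℝ} {S : Set ℝ}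
  (hH : HamiltonianFamily H n α S) {s t : ℝ} {i : ℕ}

include hH

open UnboundedOp in
theorem exists_spectralFamily {M : ℝ} {am ap g : ℝ → ℝ} {P : ℝ → E →L[ℂ] E} {N : ℕ}
    (hM : 0 ≤ M) (ham : ContinuousOn am S) (hap : ContinuousOn ap S)
    (h0 : ∀ s ∈ S, 0 ≤ am s ∧ am s ≤ ap s ∧ ap s ≤ M)
    (hg : ∀ s, g s = gap ⟨D, H s⟩ (Icc (am s) (ap s))) (hg0 : ∀ s ∈ S, 0 < g s)
    (hP : ∀ s, P s = spectralProjector ⟨D, H s⟩ (Icc (am s) (ap s)))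
    (hN : ∀ s ∈ S, LinearMap.rank (P s : E →ₗ[ℂ] E) = (N : Cardinal)) :
    ∃ F : SpectralFamily E n α M N S, F.R = hH.R ∧ F.T = hH.T ∧ F.P = P ∧ F.g = g := by
  have hdata : ∀ s ∈ S, ∃ m Sr : E →L[ℂ] E, P s * P s = P s ∧ star (P s) = P s ∧ star m = m ∧
      star Sr = Sr ∧ m * P s = m ∧ P s * Sr = 0 ∧ ‖m‖ ≤ M ∧
      ‖m - (((am s + ap s) / 2 : ℝ) : ℂ) • P s‖ ≤ (ap s - am s) / 2 ∧
      ‖Sr‖ ≤ ((ap s - am s) / 2 + g s)⁻¹ ∧ hH.R s * m = P s ∧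
      Sr = hH.R s * (1 - P s + (((am s + ap s) / 2 : ℝ) : ℂ) • Sr) := by
    intro s hs
    obtain ⟨h1, h2, h3⟩ := h0 s hs
    obtain ⟨P', m, Sr, hPP', d1, d2, d3, d4, d5, d6, d7, d8, d9, d10, d11⟩ :=
      exists_spectralProjector_data (hH.isSelfAdjoint s hs) h2 h1 (by rw [← hg]; exact hg0 s hs)
    have hPs : P s = P' := (hP s).trans hPP'
    subst hPs
    refine ⟨m, Sr, d1, d2, d3, d4, d5, d6, d7.trans h3, by push_cast; exact d8,
      by rw [hg]; exact d9, ?_, ?_⟩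
    · ext φ
      obtain ⟨hφ, e⟩ := d10 φ
      have e' : H s ⟨P s φ, hφ⟩ = m φ := e
      rw [mul_apply_eq_comp, ← e', hH.R_H hs]
    · ext φ
      obtain ⟨hφ, e⟩ := d11 φ
      have e' : H s ⟨Sr φ, hφ⟩ = (1 - P s + (((am s + ap s) / 2 : ℝ) : ℂ) • Sr) φ := by
        refine Eq.trans e ?_
        push_cast
        rfl
      rw [mul_apply_eq_comp, ← e', hH.R_H hs]
  choose! m Sr hd using hdata
  have hc : ContinuousOn (fun s => (am s + ap s) / 2) S := (ham.add hap).div_const 2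
  have hρ : ContinuousOn (fun s => (ap s - am s) / 2) S := (hap.sub ham).div_const 2
  refine ⟨{
    R := hH.R, P := P, m := m, Sr := Sr, T := hH.T, W := hH.W
    c := fun s => (am s + ap s) / 2
    ρ := fun s => (ap s - am s) / 2
    g := g
    convex := hH.convex
    uniqueDiff := hH.uniqueDiff
    one_le := hH.one_le
    α_nonneg := hH.α_nonneg
    M_nonneg := hM
    g_pos := hg0
    g_le_one := fun s _ => by rw [hg]; exact gap_le_one _ _
    ρ_nonneg := fun s hs => by linarith [(h0 s hs).2.1]
    c_cont := hc
    ρ_cont := hρ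
    norm_R := fun s _ => hH.norm_R s
    star_R := fun s hs => hH.star_R hs
    R_inj := fun s hs => hH.R_inj hs
    R_mul_W := fun s hs t ht => hH.R_mul_W hs ht
    hasDerivWithinAt_W := fun s hs φ => hH.hasDerivWithinAt_W hs φ
    norm_W := fun s hs t ht h => hH.norm_W_sub_one_le hs ht h
    hasDerivWithinAt_R := fun s hs φ => hH.hasDerivWithinAt_R hs φ
    norm_T := fun i h1 hi s hs => hH.norm_T h1 hi hs
    hasDerivWithinAt_T := fun i h1 hi s hs φ => hH.hasDerivWithinAt_T h1 hi hs φ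
    T_cont := hH.continuousOn_T_apply
    P_mul_P := fun s hs => (hd s hs).1
    star_P := fun s hs => (hd s hs).2.1
    star_m := fun s hs => (hd s hs).2.2.1
    star_Sr := fun s hs => (hd s hs).2.2.2.1
    m_mul_P := fun s hs => (hd s hs).2.2.2.2.1
    P_mul_Sr := fun s hs => (hd s hs).2.2.2.2.2.1
    norm_m := fun s hs => (hd s hs).2.2.2.2.2.2.1
    norm_m_sub := fun s hs => (hd s hs).2.2.2.2.2.2.2.1
    norm_Sr := fun s hs => (hd s hs).2.2.2.2.2.2.2.2.1
    R_mul_m := fun s hs => (hd s hs).2.2.2.2.2.2.2.2.2.1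
    Sr_eq := fun s hs => (hd s hs).2.2.2.2.2.2.2.2.2.2
    rank_P := hN }, rfl, rfl, rfl, rfl⟩

variable {M : ℝ} {N : ℕ} {F : SpectralFamily E n α M N S}

theorem compNormLE_of_eq (hs : s ∈ S) {A Y : E →L[ℂ] E} {c : ℝ} (hY : ‖Y‖ ≤ c)
    (hA : A = hH.R s * Y) : UnboundedOp.CompNormLE ⟨D, H s⟩ A c := by
  refine ⟨(norm_nonneg _).trans hY, fun φ => ?_⟩
  have h1 : A φ = hH.Rd s (Y φ) := by rw [hA]; rfl
  have h2 : A φ ∈ D := by rw [h1]; exact (hH.Rd s (Y φ)).2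
  have h3 : H s ⟨A φ, h2⟩ = Y φ := by
    rw [← hH.H_Rd hs (Y φ)]
    congr 1
    exact Subtype.ext h1
  refine ⟨h2, ?_⟩
  have h4 := Y.le_of_opNorm_le hY φ
  rw [← h3] at h4
  exact h4

theorem isCompactOperator_R (hs : s ∈ S)
    (h : UnboundedOp.HasCompactResolvent (⟨D, H s⟩ : E →ₗ.[ℂ] E)) :
    IsCompactOperator (hH.R s) := by
  obtain ⟨z, Rz, hR, hc⟩ := h
  have : hH.R s = Rz * (z • hH.R s - 1) := by
    ext φ
    have h1 := hR.apply_smul_sub (hH.Rd s φ)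
    have h2 : (⟨D, H s⟩ : E →ₗ.[ℂ] E) (hH.Rd s φ) = φ := hH.H_Rd hs φ
    rw [h2] at h1
    exact h1.symm
  rw [this]
  exact hc.mul_right _

/-- The Liouvillian, in terms of bounded operators. -/
theorem isLiouvillian_iff (hs : s ∈ S) (A B : E →L[ℂ] E) :
    UnboundedOp.IsLiouvillian ⟨D, H s⟩ A B ↔
      A * hH.R s = hH.R s * (B * hH.R s + A) := by
  constructor
  · intro h
    ext φ
    obtain ⟨h1, h2⟩ := h (hH.Rd s φ)
    have h3 : H s ⟨A (hH.Rd s φ), h1⟩ - A (H s (hH.Rd s φ)) = B (hH.Rd s φ) := h2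
    rw [hH.H_Rd hs, sub_eq_iff_eq_add] at h3
    have h4 := hH.R_H hs ⟨A (hH.Rd s φ), h1⟩
    rw [h3] at h4
    exact h4.symm
  · intro h φ
    have h1 : A (φ : E) = hH.Rd s (B φ + A (H s φ)) := by
      have h2 := congrArg (fun X : E →L[ℂ] E => X (H s φ)) h
      simp only [mul_apply_eq_comp, add_apply, hH.R_H hs] at h2
      exact h2
    have h2 : A (φ : E) ∈ D := by rw [h1]; exact (hH.Rd s _).2
    refine ⟨h2, ?_⟩
    have h3 : H s ⟨A φ, h2⟩ = B φ + A (H s φ) := by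
      rw [← hH.H_Rd hs (B φ + A (H s φ))]
      congr 1
      exact Subtype.ext h1
    rw [sub_eq_iff_eq_add]
    exact h3

end HamiltonianFamily

/-! ### Identification of the partial inverse of the Liouvillian. -/

namespace SpectralFamily

variable {E : Type*} [NormedAddCommGroup E] [InnerProductSpace ℂ E] [CompleteSpace E]
  {n : ℕ} {α : ℕ → ℝ} {M : ℝ} {N : ℕ} {S : Set ℝ} (F : SpectralFamily E n α M N S) {s t : ℝ}
  {A B : E →L[ℂ] E}

include F

theorem Q_mul_R (hs : s ∈ S) : (1 - F.P s) * F.R s = F.R s * (1 - F.P s) := by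
  rw [mul_sub, sub_mul, F.P_mul_R hs]; simp

/-- A solution of the commutator equation solves the Sylvester equation. -/
theorem Q_mul_mul_P_eq_Z (hs : s ∈ S) (h : A * F.R s = F.R s * (B * F.R s + A)) :
    (1 - F.P s) * A * F.P s = F.Z s B := by
  have h1 : A * F.P s = F.R s * (B * F.P s + A * F.m s) := by
    have h2 := congrArg (fun X => X * F.m s) h
    simp only [mul_assoc, add_mul, F.R_mul_m s hs] at h2
    exact h2
  refine F.eq_Z_of_eq B hs (Y := (1 - F.P s) * (B * F.P s + A * F.m s)) ?_ ?_ ?_ ?_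
  · rw [mul_assoc, h1, ← mul_assoc, F.Q_mul_R hs, mul_assoc]
  · rw [← mul_assoc, ← mul_assoc, F.P_mul_Q hs, zero_mul, zero_mul]
  · rw [mul_assoc, F.P_mul_P s hs]
  · rw [mul_assoc _ (F.P s), F.P_mul_m hs, mul_add, ← mul_assoc, ← mul_assoc, add_sub_cancel_right]

theorem offDiagonal_eq_K (hs : s ∈ S) (hA : UnboundedOp.IsOffDiagonal (F.P s) A)
    (h : A * F.R s = F.R s * (B * F.R s + A)) : F.K s B = A := by
  have h1 := F.Q_mul_mul_P_eq_Z hs h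
  -- If `[H, A] = B` then `[H, A*] = -B*`, so the block `P A Q` is the adjoint of a Sylvester
  -- solution too.
  have h2 : star A * F.R s = F.R s * (-star B * F.R s + star A) := by
    have h3 := congrArg star h
    simp only [star_mul, star_add, F.star_R s hs, add_mul] at h3
    rw [mul_add, h3]
    noncomm_ring
  have h3 := F.Q_mul_mul_P_eq_Z hs h2
  rw [map_neg] at h3
  have h4 : F.P s * A * (1 - F.P s) = -star (F.Z s (star B)) := by
    rw [← star_neg, ← h3]
    simp only [star_mul, star_sub, star_one, star_star, F.star_P s hs, mul_assoc]
  rw [K_apply, sub_eq_add_neg, ← h1, ← h4]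
  obtain ⟨h5, h6⟩ := hA
  calc (1 - F.P s) * A * F.P s + F.P s * A * (1 - F.P s)
      = A - F.P s * A * F.P s - (1 - F.P s) * A * (1 - F.P s) := by noncomm_ring
    _ = A := by rw [h5, h6, sub_zero, sub_zero]

theorem isOffDiagonal_K (hs : s ∈ S) (A : E →L[ℂ] E) :
    UnboundedOp.IsOffDiagonal (F.P s) (F.K s A) := by
  have h1 : F.Z s A * (1 - F.P s) = 0 := by
    rw [mul_sub, mul_one, F.Z_mul_P A hs, sub_self]
  have h2 : (1 - F.P s) * star (F.Z s (star A)) = 0 := by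
    rw [sub_mul, one_mul, F.P_mul_star_Z _ hs, sub_self]
  constructor
  · rw [K_apply, mul_sub, F.P_mul_Z A hs, zero_sub, neg_mul, mul_assoc, F.star_Z_mul_P _ hs,
      mul_zero, neg_zero]
  · rw [K_apply, mul_sub (1 - F.P s) (F.Z s A), h2, sub_zero, mul_assoc, h1, mul_zero]

theorem K_mul_R (hs : s ∈ S) (A : E →L[ℂ] E) :
    F.K s A * F.R s
      = F.R s * (UnboundedOp.offDiagonalPart (F.P s) A * F.R s + F.K s A) := by
  have h : ∀ A, F.Z s A * F.R s = F.R s * ((1 - F.P s) * A * F.P s * F.R s + F.Z s A) := by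
    intro A
    conv_lhs => rw [← F.R_mul_Y A hs, Y]
    rw [mul_assoc, add_mul, mul_assoc (F.Z s A), F.m_mul_R hs, F.Z_mul_P A hs]
  have h1 := h A
  have h2 := congrArg star (h (star A))
  simp only [star_mul, star_add, star_sub, star_one, star_star, F.star_R s hs, F.star_P s hs] at h2
  have h3 : star (F.Z s (star A)) * F.R s
      = F.R s * star (F.Z s (star A)) - F.R s * (F.P s * (A * (1 - F.P s))) * F.R s := by
    rw [h2]; noncomm_ring
  rw [K_apply, sub_mul, h1, h3, UnboundedOp.offDiagonalPart]
  noncomm_ring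

theorem K_eq_zero (hs : s ∈ S) (hA : UnboundedOp.offDiagonalPart (F.P s) A = 0) : F.K s A = 0 := by
  rw [UnboundedOp.offDiagonalPart] at hA
  have h1 : (1 - F.P s) * A * F.P s = 0 := by
    have h2 := congrArg (fun X => (1 - F.P s) * X) hA
    simp only [mul_add, ← mul_assoc, F.Q_mul_P hs, F.Q_mul_Q hs, zero_mul, zero_add, mul_zero] at h2
    exact h2
  have h2 : (1 - F.P s) * star A * F.P s = 0 := by
    have h3 : F.P s * A * (1 - F.P s) = 0 := by rwa [h1, add_zero] at hA
    have h4 := congrArg star h3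
    simp only [star_mul, star_sub, star_one, F.star_P s hs, star_zero] at h4
    rw [mul_assoc]
    exact h4
  rw [K_apply, F.Z_eq_zero A hs h1, F.Z_eq_zero _ hs h2, star_zero, sub_zero]

end SpectralFamily

namespace UnboundedOp

variable {E : Type*} [NormedAddCommGroup E] [InnerProductSpace ℂ E] [CompleteSpace E]
  {h : E →ₗ.[ℂ] E} {I : Set ℝ} {K K' : (E →L[ℂ] E) →L[ℂ] (E →L[ℂ] E)}

/-- `K A` is off-diagonal and its commutator is the off-diagonal part of `A`, so `K'` sends that
part back to `K A`; the rest of `A` is diagonal and killed by `K'`. -/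
theorem IsPartialInverseLiouvillian.unique
    (hPP : spectralProjector h I * spectralProjector h I = spectralProjector h I)
    (hK : IsPartialInverseLiouvillian h I K) (hK' : IsPartialInverseLiouvillian h I K') :
    K = K' := by
  ext1 A
  set P := spectralProjector h I
  have h1 : ∀ X : E →L[ℂ] E, P * (P * X) = P * X := fun X => by rw [← mul_assoc, hPP]
  have hdiag : offDiagonalPart P (A - offDiagonalPart P A) = 0 := by
    simp only [offDiagonalPart, mul_add, add_mul, mul_sub, sub_mul, mul_one, one_mul, mul_assoc,
      h1, hPP]
    abel
  have h2 := hK'.2.2.1 _ (hK.1 A) _ (hK.2.1 A)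
  have h3 := hK'.2.2.2 _ hdiag
  rw [map_sub, sub_eq_zero] at h3
  rw [← h2, ← h3]

end UnboundedOp

/-! ### Assembly of the main theorem. -/

theorem eventually_add_mem_Ico {T s : ℝ} (hs : s ∈ Ico 0 T) :
    ∀ᶠ h in 𝓝[>] (0 : ℝ), s + h ∈ Ico 0 T := by
  filter_upwards [Ioo_mem_nhdsGT (sub_pos.2 hs.2)] with h hh
  exact ⟨add_nonneg hs.1 hh.1.le, by linarith [hh.2]⟩

/-- The constants `α`, indexed by the order of the derivative. -/
noncomputable def extendIndex {n : ℕ} (α : Fin n → ℝ) (i : ℕ) : ℝ :=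
  if h : i - 1 < n then |α ⟨i - 1, h⟩| else 0

theorem extendIndex_nonneg {n : ℕ} (α : Fin n → ℝ) (i : ℕ) : 0 ≤ extendIndex α i := by
  rw [extendIndex]
  split_ifs
  · exact abs_nonneg _
  · exact le_rfl

open UnboundedOp in
theorem proposition4 :
    -- the constants `c_l`, which depend only on `l`
    ∃ c : ℕ → ℕ, c 0 = 2 ∧ c 1 = 10 ∧
    ∀ (n : ℕ) (_ : 1 ≤ n) (α : Fin n → ℝ) (M : ℝ),
    -- the constants `C_l`, which depend only on `n`, `α_1, …, α_n` and `M`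
    ∃ C : ℕ → ℝ, (∀ l, 0 ≤ C l) ∧
    ∀ (E : Type*) [NormedAddCommGroup E] [InnerProductSpace ℂ E] [CompleteSpace E]
      (T : ℝ) (_ : 0 < T)
      -- the family of operators `H(s)`, `s ∈ [0, T)`, self-adjoint on the common domain `D`
      (D : Submodule ℂ E) (H : ℝ → D →ₗ[ℂ] E)
      (_ : ∀ s ∈ Ico 0 T, IsSelfAdjoint (⟨D, H s⟩ : E →ₗ.[ℂ] E))
      -- H1
      (_ : ∀ s ∈ Ico 0 T, ∀ φ : D, ‖(φ : E)‖ ^ 2 ≤ (inner ℂ (φ : E) (H s φ)).re)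
      -- H2; the second part says that the norm of `H^{(l+1)}(s) H(s)⁻¹` is at most `α l`
      (_ : ∀ φ : D, ContDiffOn ℝ n (fun s => H s φ) (Ico 0 T))
      (_ : ∀ l : Fin n, ∀ s ∈ Ico 0 T, ∀ φ : D,
        ‖iteratedDerivWithin (l + 1) (fun t => H t φ) (Ico 0 T) s‖ ≤ α l * ‖H s φ‖)
      -- H3
      (am ap : ℝ → ℝ) (_ : ContinuousOn am (Icc 0 T)) (_ : ContinuousOn ap (Icc 0 T))
      (_ : ∀ s ∈ Icc 0 T, 0 ≤ am s ∧ am s ≤ ap s ∧ ap s ≤ M)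
      (g : ℝ → ℝ) (_ : ∀ s, g s = gap ⟨D, H s⟩ (Icc (am s) (ap s)))
      (_ : ∀ s ∈ Ico 0 T, 0 < g s)
      (P : ℝ → E →L[ℂ] E) (_ : ∀ s, P s = spectralProjector ⟨D, H s⟩ (Icc (am s) (ap s)))
      (N : ℕ) (_ : 1 ≤ N)
      (_ : ∀ s ∈ Ico 0 T, LinearMap.rank (P s : E →ₗ[ℂ] E) = (N : Cardinal))
      -- the partial inverse of the Liouvillian
      (Lp : ℝ → (E →L[ℂ] E) →L[ℂ] (E →L[ℂ] E))
      (_ : ∀ s, Lp s = partialInverseLiouvillian ⟨D, H s⟩ (Icc (am s) (ap s))),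
    -- `L⁺(s)` is well defined
    (∀ s ∈ Ico 0 T, IsPartialInverseLiouvillian ⟨D, H s⟩ (Icc (am s) (ap s)) (Lp s)) ∧
    -- regularity of `P` in operator norm
    ContDiffOn ℝ n P (Ico 0 T) ∧
    -- regularity of `L⁺`: pointwise, and in the norm of bounded superoperators
    (∀ A : E →L[ℂ] E, ContDiffOn ℝ n (fun s => Lp s A) (Ico 0 T)) ∧
    ContDiffOn ℝ (n - 1 : ℕ) Lp (Ico 0 T) ∧
    ((∀ s ∈ Ico 0 T, HasCompactResolvent (⟨D, H s⟩ : E →ₗ.[ℂ] E)) →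
      ContDiffOn ℝ n Lp (Ico 0 T)) ∧
    -- `[P(s), H'(s)]`, defined on `D`, extends to a bounded operator `B`, and `P'(s) = L⁺(s) B`
    (∀ s ∈ Ico 0 T, ∃ B : E →L[ℂ] E,
      (∀ φ : D, ∃ hφ : P s φ ∈ D,
        B φ = P s (derivWithin (fun t => H t φ) (Ico 0 T) s) -
          derivWithin (fun t => H t ⟨P s φ, hφ⟩) (Ico 0 T) s) ∧
      HasDerivWithinAt P (Lp s B) (Ico 0 T) s) ∧
    -- bounds
    (∀ s ∈ Ico 0 T, CompNormLE ⟨D, H s⟩ (P s) M) ∧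
    (∀ l ≤ n, ∀ s ∈ Ico 0 T,
      CompNormLE ⟨D, H s⟩ (iteratedDerivWithin l P (Ico 0 T) s) (C l / g s ^ (l + 1))) ∧
    (∀ l ≤ n, ∀ s ∈ Ico 0 T, ∀ A : E →L[ℂ] E,
      CompNormLE ⟨D, H s⟩ (iteratedDerivWithin l (fun t => Lp t A) (Ico 0 T) s)
        (C l / g s ^ (l + 3) * ‖A‖)) ∧
    -- ranks
    (∀ l ≤ n, ∀ s ∈ Ico 0 T,
      LinearMap.rank ((iteratedDerivWithin l P (Ico 0 T) s : E →L[ℂ] E) : E →ₗ[ℂ] E)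
        ≤ (((l + 1) * N : ℕ) : Cardinal)) ∧
    (∀ l ≤ n, ∀ s ∈ Ico 0 T, ∀ A : E →L[ℂ] E,
      LinearMap.rank
          ((iteratedDerivWithin l (fun t => Lp t A) (Ico 0 T) s : E →L[ℂ] E) : E →ₗ[ℂ] E)
        ≤ ((c l * N : ℕ) : Cardinal)) := by
  -- The finite differences give `2 (l + 1)`, since `L⁺ A` has rank at most `2 N`. The larger `2 + 8
  -- l` takes the prescribed values `2` and `10`.
  refine ⟨fun l => 2 + 8 * l, rfl, rfl, fun n hn α M => ?_⟩
  -- Absolute values keep the constants nonnegative, since they are chosen before any family, and so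
  -- before any sign of `α` or `M`, is known.
  refine ⟨SpectralFamily.finalConst n (extendIndex α) |M|, SpectralFamily.finalConst_nonneg
    (extendIndex_nonneg α) (abs_nonneg M), ?_⟩
  intro E _ _ _ T hT D H hsa h1 h2 h2' am ap ham hap hI g hg hg0 P hP N hN hrank Lp hLp
  have hIcc : Ico 0 T ⊆ Icc 0 T := Ico_subset_Icc_self
  have hM : 0 ≤ M := by
    obtain ⟨i1, i2, i3⟩ := hI 0 ⟨le_rfl, hT.le⟩
    linarith
  rw [abs_of_nonneg hM]
  have hH : HamiltonianFamily H n (extendIndex α) (Ico 0 T) :=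
    { convex := convex_Ico 0 T
      uniqueDiff := uniqueDiffOn_Ico 0 T
      one_le := hn
      α_nonneg := extendIndex_nonneg α
      isSelfAdjoint := hsa
      sq_norm_le := h1
      contDiffOn := h2
      norm_le := fun i hi1 hin s hs φ => by
        have hi : i - 1 < n := by omega
        have h3 := h2' ⟨i - 1, hi⟩ s hs φ
        simp only [Nat.sub_add_cancel hi1] at h3
        rw [extendIndex, dif_pos hi]
        exact h3.trans (mul_le_mul_of_nonneg_right (le_abs_self _) (norm_nonneg _)) }
  obtain ⟨F, hFR, hFT, rfl, rfl⟩ := hH.exists_spectralFamily hM (ham.mono hIcc) (hap.mono hIcc)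
    (fun s hs => hI s (hIcc hs)) hg hg0 hP hrank
  have hKs : ∀ s ∈ Ico 0 T,
      IsPartialInverseLiouvillian ⟨D, H s⟩ (Icc (am s) (ap s)) (F.K s) := by
    intro s hs
    rw [IsPartialInverseLiouvillian, ← hP s]
    refine ⟨F.isOffDiagonal_K hs, fun A => ?_, fun A hA B hB => ?_, fun A hA => F.K_eq_zero hs hA⟩
    · rw [hH.isLiouvillian_iff hs, ← hFR]
      exact F.K_mul_R hs A
    · rw [hH.isLiouvillian_iff hs, ← hFR] at hB
      exact F.offDiagonal_eq_K hs hA hB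
  have hLpK : ∀ s ∈ Ico 0 T, Lp s = F.K s := by
    intro s hs
    have hex : ∃ K, IsPartialInverseLiouvillian ⟨D, H s⟩ (Icc (am s) (ap s)) K := ⟨_, hKs s hs⟩
    rw [hLp, partialInverseLiouvillian, dif_pos hex]
    exact hex.choose_spec.unique (by rw [← hP s]; exact F.P_mul_P s hs) (hKs s hs)
  have hLpA : ∀ A, EqOn (fun s => Lp s A) (fun s => F.K s A) (Ico 0 T) := fun A s hs => by
    simp only [hLpK s hs]
  have hLpd : ∀ l A, EqOn (iteratedDerivWithin l (fun s => Lp s A) (Ico 0 T))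
      (iteratedDerivWithin l (fun s => F.K s A) (Ico 0 T)) (Ico 0 T) := fun l A s hs =>
    iteratedDerivWithin_congr (hLpA A) hs
  refine ⟨fun s hs => by rw [hLpK s hs]; exact hKs s hs, F.contDiffOn_P,
    fun A => (F.contDiffOn_K_apply A).congr (hLpA A),
    (F.contDiffOn_K_of_lt (by omega)).congr hLpK, fun hcomp => ?_, fun s hs => ?_, fun s hs => ?_,
    fun l hl s hs => ?_, fun l hl s hs A => ?_, fun l hl s hs => ?_, fun l hl s hs A => ?_⟩
  · exact (F.contDiffOn_K_of_isCompactOperator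
      (fun s hs => by rw [hFR]; exact hH.isCompactOperator_R hs (hcomp s hs))
      (fun s hs => by rw [hFR, hFT]; exact hH.star_R_mul_T hn le_rfl hs)).congr hLpK
  · have hPR : ∀ φ, F.P s φ = hH.Rd s (F.m s φ) := fun φ => by
      rw [← F.R_mul_m s hs, hFR]; rfl
    have hPD : ∀ φ, F.P s φ ∈ D := fun φ => by rw [hPR]; exact (hH.Rd s _).2
    have hTm : ∀ φ, (F.T 1 s * F.m s) φ = hH.Hd 1 s ⟨F.P s φ, hPD φ⟩ := fun φ => by
      rw [hFT, mul_apply_eq_comp, hH.T_apply le_rfl hn hs]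
      congr 1
      exact Subtype.ext (hPR φ).symm
    -- On `D`, the adjoint of `H' P = T 1 m` is `P H'`. So `(T 1 m)* - T 1 m` is the bounded
    -- extension of `[P, H']`.
    have hadj : ∀ φ : D, star (F.T 1 s * F.m s) φ = F.P s (hH.Hd 1 s φ) := fun φ => by
      refine ext_inner_right ℂ fun ψ => ?_
      have h3 := F.star_P s hs
      rw [ContinuousLinearMap.star_eq_adjoint] at h3 ⊢
      rw [ContinuousLinearMap.adjoint_inner_left, hTm, ← hH.Hd_inner_left hn hs]
      conv_rhs => rw [← h3, ContinuousLinearMap.adjoint_inner_left]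
    refine ⟨star (F.T 1 s * F.m s) - F.T 1 s * F.m s, fun φ => ⟨hPD φ, ?_⟩, ?_⟩
    · rw [sub_apply, hadj, hTm, HamiltonianFamily.Hd, HamiltonianFamily.Hd, iteratedDerivWithin_one,
        iteratedDerivWithin_one]
    · rw [hLpK s hs, ← F.P'_eq_K hs]
      exact F.hasDerivWithinAt_P hs
  · exact hH.compNormLE_of_eq hs (F.norm_m s hs) (by rw [← hFR, F.R_mul_m s hs])
  · obtain ⟨Y, hY, hd⟩ := F.exists_iteratedDerivWithin_P hl hs
    exact hH.compNormLE_of_eq hs hY (by rw [← hFR]; exact hd)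
  · obtain ⟨Y, hY, hd⟩ := F.exists_iteratedDerivWithin_K A hl hs
    exact hH.compNormLE_of_eq hs hY (by rw [hLpd l A hs, ← hFR]; exact hd)
  · exact rank_iteratedDerivWithin_le (convex_Ico 0 T) hs
      (F.contDiffOn_P.of_le (by exact_mod_cast hl)) (eventually_add_mem_Ico hs)
      fun t ht => (F.rank_P t ht).le
  · rw [hLpd l A hs]
    refine (rank_iteratedDerivWithin_le (convex_Ico 0 T) hs
      ((F.contDiffOn_K_apply A).of_le (by exact_mod_cast hl)) (eventually_add_mem_Ico hs)
      fun t ht => F.rank_K_le A ht).trans ?_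
    exact_mod_cast (by nlinarith : (l + 1) * (2 * N) ≤ (2 + 8 * l) * N)
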